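/- Let $F$ be a non-archimedean local field (of any characteristic), $E/F$ a separable quadratic extension, and $n\ge 1$. Let $W$ be the standard symplectic space of dimension $2n$ over $F$, and let ${\rm U}(n,n)(F)$ be the isometry group of the skew-hermitian space $W\otimes_F E$, so that ${\rm Sp}_{2n}(F)={\rm Sp}(W)\subset {\rm U}(n,n)(F)$. A smooth complex representation $\pi$ of ${\rm U}(n,n)(F)$ is said to be distinguished by ${\rm Sp}_{2n}(F)$ if there is a nonzero linear form $\ell:\pi\to\mathbb{C}$ with $\ell(\pi(h)v)=\ell(v)$ for all $h\in{\rm Sp}_{2n}(F)$ and $v\in\pi$. Let $\pi$ be a smooth representation of ${\rm U}(n,n)(F)$ distinguished by ${\rm Sp}_{2n}(F)$. (i) If $\pi$ is irreducible, then $\pi$ is a subquotient of a principal series representation ${\rm Ind}_P^{{\rm U}(n,n)(F)}\sigma$, where $P$ is the Siegel parabolic subgroup (with Levi subgroup ${\rm GL}_n(E)$), and $\sigma$ is some irreducible smooth representation of ${\rm GL}_n(E)$, extended trivially to the unipotent radical of $P$. (ii) Whether or not $\pi$ is irreducible, $\pi$ is not cuspidal, i.e. its Jacquet module with respect to the unipotent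 radical of some proper parabolic subgroup of ${\rm U}(n,n)(F)$ is nonzero. -/

import Mathlib

open scoped Matrix

universe u

noncomputable section

namespace UnitaryPeriod

/-! ### Smooth complex representations -/

section Generic

variable {G : Type*} [Group G] {V : Type*} [AddCommGroup V] [Module ℂ V]

/-- A complex representation of a topological group is smooth if every vector is fixed by an open
subgroup. -/
def IsSmooth [TopologicalSpace G] (π : Representation ℂ G V) : Prop :=
  ∀ v : V, ∃ K : Subgroup G, IsOpen (K : Set G) ∧ ∀ k ∈ K, π k v = v

/-- `π` is distinguished by the subgroup `H`: there is a nonzero `H`-invariant linear form. -/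
def IsDistinguished (π : Representation ℂ G V) (H : Subgroup G) : Prop :=
  ∃ ℓ : V →ₗ[ℂ] ℂ, ℓ ≠ 0 ∧ ∀ h ∈ H, ∀ v : V, ℓ (π h v) = ℓ v

/-- `π` is a subquotient of `ρ`: it is isomorphic to a quotient of a subrepresentation of `ρ`,
i.e. some subrepresentation of `ρ` maps onto it equivariantly. -/
def IsSubquotient {W : Type*} [AddCommGroup W] [Module ℂ W]
    (π : Representation ℂ G V) (ρ : Representation ℂ G W) : Prop :=
  ∃ (B : Subrepresentation ρ) (T : B.toRepresentation.IntertwiningMap π), Function.Surjective T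

/-- The Jacquet module (space of coinvariants) of `π` with respect to the subgroup `N`. -/
abbrev JacquetModule (π : Representation ℂ G V) (N : Subgroup G) : Type _ :=
  Representation.Coinvariants (π.comp N.subtype)

/-- The subrepresentation of smooth vectors (those fixed by an open subgroup). -/
def smoothVectors [TopologicalSpace G] [IsTopologicalGroup G] (π : Representation ℂ G V) :
    Subrepresentation π where
  toSubmodule :=
    { carrier := {v | ∃ K : Subgroup G, IsOpen (K : Set G) ∧ ∀ k ∈ K, π k v = v}
      zero_mem' := ⟨⊤, isOpen_univ, fun k _ => map_zero _⟩
      add_mem' := by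
        rintro v w ⟨K, hK, hv⟩ ⟨L, hL, hw⟩
        refine ⟨K ⊓ L, hK.inter hL, fun k hk => ?_⟩
        rw [map_add, hv k hk.1, hw k hk.2]
      smul_mem' := by
        rintro a v ⟨K, hK, hv⟩
        refine ⟨K, hK, fun k hk => ?_⟩
        rw [map_smul, hv k hk] }
  apply_mem_toSubmodule := by
    rintro g v ⟨K, hK, hv⟩
    refine ⟨K.comap (MulAut.conj g⁻¹).toMonoidHom, ?_, fun k hk => ?_⟩
    · have hc : Continuous fun x : G => g⁻¹ * x * g := by fun_prop
      have := hK.preimage hc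
      convert this using 1
      ext x
      simp
    · have h1 : g⁻¹ * k * g ∈ K := by simpa using hk
      have h2 := hv _ h1
      have h3 : k * g = g * (g⁻¹ * k * g) := by group
      rw [← Module.End.mul_apply, ← map_mul, h3, map_mul, Module.End.mul_apply, h2]

/-- The space of the (unnormalized) smooth induction from `P` to `G` of a representation `τ` of
`P`: functions `f : G → V` with `f (p * g) = τ p (f g)` that are right invariant under some open
subgroup; `G` acts by right translation. -/
def smoothInd [TopologicalSpace G] [IsTopologicalGroup G] (P : Subgroup G)
    (τ : Representation ℂ P V) :
    Representation ℂ G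
      (smoothVectors (Representation.coind P.subtype τ)).toSubmodule :=
  (smoothVectors (Representation.coind P.subtype τ)).toRepresentation

end Generic

/-! ### The quasi-split unitary group `U(n,n)` -/

section Unitary

variable {F E : Type*} [Field F] [Field E] [Algebra F E] (c : E ≃ₐ[F] E) (n : ℕ)

/-- The underlying space `E²ⁿ`. -/
abbrev Space (E : Type*) (n : ℕ) : Type _ := (Fin n ⊕ Fin n) → E

/-- The group of matrices `g ∈ GL₂ₙ(E)` with `ᵗ(c g) J g = J`, where
`J = [[0, -1], [1, 0]]`. For `c` the nontrivial automorphism of a quadratic extension `E/F`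
this is `U(n,n)(F)`, the isometry group of the skew-hermitian space obtained by extending scalars
to `E` from the standard symplectic space of dimension `2n` over `F`. -/
def U : Subgroup (GL (Fin n ⊕ Fin n) E) where
  carrier := {g | (g.val.map c)ᵀ * Matrix.J (Fin n) E * g.val = Matrix.J (Fin n) E}
  one_mem' := by
    simp only [Set.mem_ofPred_eq, Units.val_one]
    rw [Matrix.map_one _ (map_zero c) (map_one c)]
    simp
  mul_mem' := by
    intro g h hg hh
    simp only [Set.mem_ofPred_eq, Units.val_mul] at *
    rw [Matrix.map_mul, Matrix.transpose_mul]
    calc (h.val.map c)ᵀ * (g.val.map c)ᵀ * Matrix.J (Fin n) E * (g.val * h.val)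
        = (h.val.map c)ᵀ * ((g.val.map c)ᵀ * Matrix.J (Fin n) E * g.val) * h.val := by
          simp only [Matrix.mul_assoc]
      _ = _ := by rw [hg, hh]
  inv_mem' := by
    intro g hg
    simp only [Set.mem_ofPred_eq] at *
    have h1 : g.val * (g⁻¹).val = 1 := by simp
    have h2 : ((g⁻¹).val.map c)ᵀ * (g.val.map c)ᵀ = 1 := by
      rw [← Matrix.transpose_mul, ← Matrix.map_mul, h1,
        Matrix.map_one _ (map_zero c) (map_one c), Matrix.transpose_one]
    calc ((g⁻¹).val.map c)ᵀ * Matrix.J (Fin n) E * (g⁻¹).val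
        = ((g⁻¹).val.map c)ᵀ * ((g.val.map c)ᵀ * Matrix.J (Fin n) E * g.val) * (g⁻¹).val := by
          rw [hg]
      _ = (((g⁻¹).val.map c)ᵀ * (g.val.map c)ᵀ) * Matrix.J (Fin n) E * (g.val * (g⁻¹).val) := by
          simp only [Matrix.mul_assoc]
      _ = _ := by rw [h1, h2]; simp

/-- `Sp₂ₙ(F)` as a subgroup of `U(n,n)(F)`: the elements that come from a symplectic matrix
over `F` by extension of scalars. -/
def Sp : Subgroup (U c n) where
  carrier := {g | ∃ s ∈ Matrix.symplecticGroup (Fin n) F, g.val.val = s.map (algebraMap F E)}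
  one_mem' := ⟨1, one_mem _, by
    rw [Matrix.map_one _ (map_zero _) (map_one _)]; simp⟩
  mul_mem' := by
    rintro g h ⟨s, hs, hgs⟩ ⟨t, ht, hht⟩
    refine ⟨s * t, mul_mem hs ht, ?_⟩
    rw [Matrix.map_mul, ← hgs, ← hht]
    simp
  inv_mem' := by
    rintro g ⟨s, hs, hgs⟩
    refine ⟨((⟨s, hs⟩ : Matrix.symplecticGroup (Fin n) F)⁻¹).val, Subtype.property _, ?_⟩
    have h1 : s * ((⟨s, hs⟩ : Matrix.symplecticGroup (Fin n) F)⁻¹).val = 1 :=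
      congrArg Subtype.val (mul_inv_cancel (⟨s, hs⟩ : Matrix.symplecticGroup (Fin n) F))
    have h2 := congrArg (fun M => M.map (algebraMap F E)) h1
    simp only [Matrix.map_mul, Matrix.map_one _ (map_zero (algebraMap F E))
      (map_one (algebraMap F E)), ← hgs] at h2
    have h3 : (g⁻¹).val.val * g.val.val = 1 := by simp
    exact left_inv_eq_right_inv h3 h2

/-! ### The Siegel parabolic -/

/-- The Siegel parabolic subgroup: the stabilizer in `U(n,n)(F)` of the Lagrangian subspace
spanned by the first `n` basis vectors, i.e. the block upper triangular matrices. (The condition on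
`g⁻¹` follows from that on `g`; it is included for convenience.) -/
def siegelParabolic : Subgroup (U c n) where
  carrier := {g | g.val.val.toBlocks₂₁ = 0 ∧ (g⁻¹).val.val.toBlocks₂₁ = 0}
  one_mem' := by
    have h : (1 : Matrix (Fin n ⊕ Fin n) (Fin n ⊕ Fin n) E).toBlocks₂₁ = 0 := by
      rw [← Matrix.fromBlocks_one, Matrix.toBlocks_fromBlocks₂₁]
    simpa using h
  mul_mem' := by
    have key : ∀ A B : Matrix (Fin n ⊕ Fin n) (Fin n ⊕ Fin n) E,
        A.toBlocks₂₁ = 0 → B.toBlocks₂₁ = 0 → (A * B).toBlocks₂₁ = 0 := by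
      intro A B hA hB
      rw [← Matrix.fromBlocks_toBlocks A, ← Matrix.fromBlocks_toBlocks B,
        Matrix.fromBlocks_multiply, Matrix.toBlocks_fromBlocks₂₁, hA, hB]
      simp
    rintro g h ⟨hg, hg'⟩ ⟨hh, hh'⟩
    refine ⟨?_, ?_⟩
    · simpa using key _ _ hg hh
    · rw [mul_inv_rev]
      exact key _ _ hh' hg'
  inv_mem' := by
    rintro g ⟨hg, hg'⟩
    exact ⟨hg', by simpa using hg⟩

variable {c n} in
theorem toBlocks₁₁_mul (A B : Matrix (Fin n ⊕ Fin n) (Fin n ⊕ Fin n) E)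
    (hB : B.toBlocks₂₁ = 0) : (A * B).toBlocks₁₁ = A.toBlocks₁₁ * B.toBlocks₁₁ := by
  conv_lhs => rw [← Matrix.fromBlocks_toBlocks A, ← Matrix.fromBlocks_toBlocks B]
  rw [Matrix.fromBlocks_multiply, Matrix.toBlocks_fromBlocks₁₁, hB]
  simp

theorem toBlocks₁₁_one :
    (1 : Matrix (Fin n ⊕ Fin n) (Fin n ⊕ Fin n) E).toBlocks₁₁ = 1 := by
  rw [← Matrix.fromBlocks_one, Matrix.toBlocks_fromBlocks₁₁]

/-- The projection of the Siegel parabolic onto its Levi quotient `GLₙ(E)`: the action on the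
Lagrangian subspace, i.e. the upper left block. -/
def siegelLevi : siegelParabolic c n →* GL (Fin n) E where
  toFun p :=
    { val := p.val.val.val.toBlocks₁₁
      inv := (p⁻¹).val.val.val.toBlocks₁₁
      val_inv := by
        rw [← toBlocks₁₁_mul _ _ (p⁻¹).property.1, ← toBlocks₁₁_one]
        simp
      inv_val := by
        rw [← toBlocks₁₁_mul _ _ p.property.1, ← toBlocks₁₁_one]
        simp }
  map_one' := by
    ext1
    exact toBlocks₁₁_one n
  map_mul' p q := by
    ext1
    exact toBlocks₁₁_mul _ _ q.property.1

/-- The representation of `U(n,n)(F)` (parabolically) induced from the Siegel parabolic and a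
representation `σ` of its Levi `GLₙ(E)`, extended trivially to the unipotent radical.
The induction is unnormalized; normalizing it only twists `σ` by a character. -/
def siegelInd [TopologicalSpace E] [IsTopologicalRing E] {W : Type*} [AddCommGroup W] [Module ℂ W]
    (σ : Representation ℂ (GL (Fin n) E) W) :=
  smoothInd (siegelParabolic c n) (σ.comp (siegelLevi c n))

/-! ### Parabolic subgroups and cuspidality -/

/-- The skew-hermitian form `h(v, w) = ᵗ(c v) J w`. -/
def herm (v w : Space E n) : E := (fun i => c (v i)) ⬝ᵥ (Matrix.J (Fin n) E *ᵥ w)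

/-- The orthogonal complement of a subspace. -/
def perp (X : Submodule E (Space E n)) : Submodule E (Space E n) where
  carrier := {w | ∀ v ∈ X, herm c n v w = 0}
  zero_mem' := by intro v _; simp [herm]
  add_mem' := by
    intro a b ha hb v hv
    have h1 := ha v hv
    have h2 := hb v hv
    simp only [herm] at *
    rw [Matrix.mulVec_add, dotProduct_add, h1, h2, add_zero]
  smul_mem' := by
    intro r a ha v hv
    have h1 := ha v hv
    simp only [herm] at *
    rw [Matrix.mulVec_smul, dotProduct_smul, h1, smul_zero]

/-- A nonempty flag (chain) of nonzero totally isotropic subspaces. The proper parabolic subgroups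
of `U(n,n)(F)` are exactly the stabilizers of such flags. -/
structure IsIsotropicFlag (s : Set (Submodule E (Space E n))) : Prop where
  nonempty : s.Nonempty
  isChain : IsChain (· ≤ ·) s
  ne_bot : ∀ X ∈ s, X ≠ ⊥
  isotropic : ∀ X ∈ s, X ≤ perp c n X

/-- The full flag `0 < X₁ < ⋯ < Xₖ ≤ Xₖ^⊥ < ⋯ < X₁^⊥ < E²ⁿ` attached to an isotropic flag. -/
def fullFlag (s : Set (Submodule E (Space E n))) : Set (Submodule E (Space E n)) :=
  {⊥, ⊤} ∪ s ∪ perp c n '' s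

/-- The predecessor of `Y` in the full flag. -/
def pred (s : Set (Submodule E (Space E n))) (Y : Submodule E (Space E n)) :
    Submodule E (Space E n) :=
  sSup {Z | Z ∈ fullFlag c n s ∧ Z < Y}

/-- Auxiliary: a matrix moving each member of the flag by elements of its predecessor preserves
the predecessors. -/
theorem mulVec_mem_pred {s : Set (Submodule E (Space E n))}
    {A : Matrix (Fin n ⊕ Fin n) (Fin n ⊕ Fin n) E}
    (hA : ∀ Y ∈ fullFlag c n s, ∀ v ∈ Y, A *ᵥ v - v ∈ pred c n s Y)
    (Y : Submodule E (Space E n)) {v : Space E n} (hv : v ∈ pred c n s Y) :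
    A *ᵥ v ∈ pred c n s Y := by
  suffices h : pred c n s Y ≤ (pred c n s Y).comap A.mulVecLin from h hv
  refine sSup_le ?_
  rintro Z ⟨hZ, hZY⟩ w hw
  have h1 : pred c n s Z ≤ Z := sSup_le fun X hX => hX.2.le
  have h2 : A *ᵥ w ∈ Z := by
    have := add_mem (h1 (hA Z hZ w hw)) hw
    simpa using this
  have h3 : Z ≤ pred c n s Y := le_sSup ⟨hZ, hZY⟩
  exact h3 h2

/-- The unipotent radical of the parabolic subgroup stabilizing the isotropic flag `s`: the
elements of `U(n,n)(F)` that act trivially on all successive quotients of the full flag. -/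
def unipotentRadical (s : Set (Submodule E (Space E n))) : Subgroup (U c n) where
  carrier := {g | ∀ Y ∈ fullFlag c n s, ∀ v ∈ Y, g.val.val *ᵥ v - v ∈ pred c n s Y}
  one_mem' := by intro Y _ v _; simp
  mul_mem' := by
    intro g h hg hh Y hY v hv
    have h1 := mulVec_mem_pred c n hg Y (hh Y hY v hv)
    have h2 := add_mem h1 (hg Y hY v hv)
    simpa [Matrix.mulVec_sub, Matrix.mulVec_mulVec] using h2
  inv_mem' := by
    intro g hg Y hY v hv
    set A : Matrix (Fin n ⊕ Fin n) (Fin n ⊕ Fin n) E := g.val.val with hA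
    set B : Matrix (Fin n ⊕ Fin n) (Fin n ⊕ Fin n) E := (g⁻¹).val.val with hB
    have hAB : B * A = 1 := by simp [hA, hB]
    have hBA : A * B = 1 := by simp [hA, hB]
    have hinj : Function.Injective A.mulVecLin := by
      intro x y hxy
      have := congrArg (fun z => B *ᵥ z) hxy
      simpa [Matrix.mulVec_mulVec, hAB] using this
    have hle : (pred c n s Y).map A.mulVecLin ≤ pred c n s Y := by
      rintro _ ⟨w, hw, rfl⟩
      exact mulVec_mem_pred c n hg Y hw
    have heq : (pred c n s Y).map A.mulVecLin = pred c n s Y :=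
      Submodule.eq_of_le_of_finrank_eq hle
        (Submodule.equivMapOfInjective _ hinj _).finrank_eq.symm
    have hleY : Y.map A.mulVecLin ≤ Y := by
      rintro _ ⟨w, hw, rfl⟩
      have h1 : pred c n s Y ≤ Y := sSup_le fun X hX => hX.2.le
      have := add_mem (h1 (hg Y hY w hw)) hw
      simpa using this
    have heqY : Y.map A.mulVecLin = Y :=
      Submodule.eq_of_le_of_finrank_eq hleY
        (Submodule.equivMapOfInjective _ hinj _).finrank_eq.symm
    rw [← heqY] at hv
    obtain ⟨w, hw, rfl⟩ := hv
    have h1 := hg Y hY w hw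
    have h2 : B *ᵥ (A.mulVecLin w) - A.mulVecLin w = -(A *ᵥ w - w) := by
      simp [Matrix.mulVec_mulVec, hAB]
    change B *ᵥ (A.mulVecLin w) - A.mulVecLin w ∈ _
    rw [h2]
    exact neg_mem h1

/-- A representation of `U(n,n)(F)` is cuspidal if its Jacquet modules with respect to the
unipotent radicals of all proper parabolic subgroups vanish. -/
def IsCuspidal {V : Type*} [AddCommGroup V] [Module ℂ V]
    (π : Representation ℂ (U c n) V) : Prop :=
  ∀ s : Set (Submodule E (Space E n)), IsIsotropicFlag c n s →
    Subsingleton (JacquetModule π (unipotentRadical c n s))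

end Unitary

end UnitaryPeriod

end

set_option linter.unusedSectionVars false

noncomputable section

namespace UnitaryPeriod

/-! Write e_k, f_k for the standard symplectic basis (indices `inl k`, `inr k`), P for the Siegel
parabolic and N for its unipotent radical. Everything rests on a nonzero linear form fixed by N.
Such a form factors through the N-coinvariants, so π is not cuspidal. If π is irreducible,
finiteness of P\G/K for K open (`exists_finite_cover`) makes the Jacquet module finitely generated
over the Levi subgroup; hence it has an irreducible quotient σ, and Frobenius reciprocity embeds π
into the representation induced from σ.

The Sp-invariant form is traded for an N-invariant one along e_0, e_1, ... (`IsStage.exists_succ`).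
Fix ε in E outside F. At stage i, the Eichler transformations u_b attached to e_i with parameter εb,
where b runs over the symplectic F-space of the later basis vectors, compose on ℓ like translations
of that space: the central discrepancies are transvections along e_i, which already fix ℓ. Each
vector v gives a function φ(b) = ℓ(u_b v), which by smoothness is unchanged by small translations
and, in each direction, by small transvections. A transvection along z with coefficient 1/⟨z,b⟩
moves b to b + z, and this coefficient is small when ⟨z,b⟩ is large; it follows that φ(b + z) - φ(b)
has compact support (`IsSlow.hasCompactSupport_sub`), although φ itself need not.

So the differences have Fourier coefficients. If those at one nonzero frequency ξ vanish for all v,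
they vanish at every nonzero frequency, because transvections permute these transitively; frequency
0 is a null set, so Fourier inversion makes every φ constant and ℓ is itself invariant under all
u_b. Otherwise the coefficient at ξ is a new nonzero form, invariant under the stabilizer of ξ
(`exists_functional`). With ξ = e_{i+1} this is enough to go on, and the invariance left at stage n
- 1 contains N. -/

open Filter MeasureTheory Topology ValuativeRel

/-! ### Balls and a nontrivial additive character of a local field -/

section LocalField

variable {F : Type*} [Field F] [ValuativeRel F] [TopologicalSpace F]
  [IsNonarchimedeanLocalField F]

variable (F) in
/-- The closed ball of radius `γ` around `0`. -/
def closedBall (γ : ValueGroupWithZero F) : AddSubgroup F where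
  carrier := {x | valuation F x ≤ γ}
  zero_mem' := by simp
  add_mem' := fun ha hb => (valuation F).map_add_le ha hb
  neg_mem' := by
    intro x hx
    simpa [Valuation.map_neg] using hx

theorem mem_closedBall {γ : ValueGroupWithZero F} {x : F} :
    x ∈ closedBall F γ ↔ valuation F x ≤ γ := Iff.rfl

theorem isCompact_closedBall (γ : ValueGroupWithZero F) :
    IsCompact (closedBall F γ : Set F) :=
  IsNonarchimedeanLocalField.isCompact_closedBall F γ

theorem closedBall_mem_nhds {γ : ValueGroupWithZero F} (hγ : γ ≠ 0) :
    (closedBall F γ : Set F) ∈ 𝓝 (0 : F) :=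
  Filter.mem_of_superset ((IsValuativeTopology.hasBasis_nhds_zero' F).mem_of_mem hγ)
    fun _ hx => mem_closedBall.2 (le_of_lt hx)

theorem isOpen_closedBall {γ : ValueGroupWithZero F} (hγ : γ ≠ 0) :
    IsOpen (closedBall F γ : Set F) :=
  AddSubgroup.isOpen_of_mem_nhds _ (closedBall_mem_nhds hγ)

theorem exists_closedBall_subset {U : Set F} (hU : U ∈ 𝓝 (0 : F)) :
    ∃ γ : ValueGroupWithZero F, γ ≠ 0 ∧ (closedBall F γ : Set F) ⊆ U := by
  obtain ⟨γ, hγ, h⟩ := (IsValuativeTopology.hasBasis_nhds_zero' F).mem_iff.mp hU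
  obtain ⟨ϖ, hϖ, hϖ1⟩ := Valuation.IsNontrivial.exists_lt_one (v := valuation F)
  refine ⟨γ * valuation F ϖ, mul_ne_zero hγ (by simpa using hϖ), fun x hx => h ?_⟩
  refine lt_of_le_of_lt (mem_closedBall.1 hx) ?_
  exact mul_lt_of_lt_one_right (zero_lt_iff.2 hγ) hϖ1

instance t2Space_of_localField : T2Space F := by
  refine IsTopologicalAddGroup.t2Space_of_zero_sep ?_
  intro x hx
  refine ⟨_, (IsValuativeTopology.hasBasis_nhds_zero' F).mem_of_mem
    (i := valuation F x) (by simpa using hx), ?_⟩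
  simp

/-- Elements outside a large ball are units with small inverse. -/
theorem exists_forall_inv_mem {U : Set F} (hU : U ∈ 𝓝 (0 : F)) :
    ∃ γ : ValueGroupWithZero F, ∀ x, x ∉ closedBall F γ → x ≠ 0 ∧ x⁻¹ ∈ U := by
  obtain ⟨γ, hγ, h⟩ := exists_closedBall_subset hU
  refine ⟨γ⁻¹, fun x hx => ?_⟩
  have hx' : γ⁻¹ < valuation F x := not_le.1 hx
  have hx0 : x ≠ 0 := by
    rintro rfl
    simp at hx'
  refine ⟨hx0, h (mem_closedBall.2 ?_)⟩
  rw [map_inv₀]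
  exact inv_le_of_inv_le₀ (zero_lt_iff.2 hγ) hx'.le

theorem exists_mem_nhds_ne_zero {U : Set F} (hU : U ∈ 𝓝 (0 : F)) : ∃ x ∈ U, x ≠ 0 := by
  obtain ⟨γ, hγ, h⟩ := exists_closedBall_subset hU
  obtain ⟨x, rfl⟩ := ValuativeRel.valuation_surjective γ
  exact ⟨x, h (mem_closedBall.2 le_rfl), by simpa using hγ⟩

/-- The embedding of `ℚ/ℤ` into the unit circle. -/
def ratCircleHom : AddCircle (1 : ℚ) →+ Additive ℂˣ :=
  QuotientAddGroup.lift _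
    { toFun := fun q : ℚ => Additive.ofMul
        (Units.mk0 (Complex.exp (q * (2 * Real.pi * Complex.I))) (Complex.exp_ne_zero _))
      map_zero' := by
        apply Additive.toMul.injective
        ext
        simp
      map_add' := by
        intro a b
        apply Additive.toMul.injective
        ext
        simp [add_mul, Complex.exp_add] }
    (by
      rintro x ⟨k, rfl⟩
      apply Additive.toMul.injective
      ext
      simp only [zsmul_eq_mul, mul_one, AddMonoidHom.coe_mk, ZeroHom.coe_mk, Rat.cast_intCast,
        toMul_ofMul, Units.val_mk0, toMul_zero, Units.val_one]
      exact Complex.exp_int_mul_two_pi_mul_I k)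

theorem ratCircleHom_injective : Function.Injective ratCircleHom := by
  rw [injective_iff_map_eq_zero]
  intro x
  induction x using QuotientAddGroup.induction_on with
  | H q =>
    intro h
    have h1 := congrArg (fun z => (Additive.toMul z : ℂˣ).val) h
    have h2 : Complex.exp (q * (2 * Real.pi * Complex.I)) = 1 := h1
    obtain ⟨k, hk⟩ := Complex.exp_eq_one_iff.1 h2
    have h3 : (q : ℂ) = k := mul_right_cancel₀ Complex.two_pi_I_ne_zero hk
    have h4 : q = k := by exact_mod_cast h3
    rw [QuotientAddGroup.eq_zero_iff]
    exact ⟨k, by simp [h4]⟩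

-- The quotient of F by its ring of integers is a nonzero abelian group, and characters into ℚ/ℤ
-- separate its points. This treats all characteristics uniformly. Being trivial on an open
-- subgroup, the resulting character is continuous.
variable (F) in
theorem exists_addChar : ∃ ψ : AddChar F ℂ, Continuous ψ ∧
    (∃ γ : ValueGroupWithZero F, γ ≠ 0 ∧ ∀ x ∈ closedBall F γ, ψ x = 1) ∧ ∃ t, ψ t ≠ 1 := by
  obtain ⟨ϖ, hϖ, hϖ1⟩ := Valuation.IsNontrivial.exists_lt_one (v := valuation F)
  have ht : ϖ⁻¹ ∉ closedBall F 1 := by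
    rw [mem_closedBall, map_inv₀, not_le]
    exact (one_lt_inv₀ (zero_lt_iff.2 (by simpa using hϖ))).2 hϖ1
  have ht' : (QuotientAddGroup.mk ϖ⁻¹ : F ⧸ closedBall F 1) ≠ 0 := by
    rwa [Ne, QuotientAddGroup.eq_zero_iff]
  obtain ⟨χ, hχ⟩ := CharacterModule.exists_character_apply_ne_zero_of_ne_zero ht'
  let f : F →+ Additive ℂˣ :=
    ratCircleHom.comp ((χ : (F ⧸ closedBall F 1) →+ AddCircle (1 : ℚ)).comp
      (QuotientAddGroup.mk' _))
  let ψ : AddChar F ℂ :=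
    { toFun := fun x => ((Additive.toMul (f x) : ℂˣ) : ℂ)
      map_zero_eq_one' := by simp
      map_add_eq_mul' := by intro a b; simp }
  have h1 : ∀ x ∈ closedBall F 1, ψ x = 1 := by
    intro x hx
    have h2 : (QuotientAddGroup.mk x : F ⧸ closedBall F 1) = 0 := by
      rwa [QuotientAddGroup.eq_zero_iff]
    have h3 : f x = 0 := by
      change ratCircleHom (χ (QuotientAddGroup.mk x)) = 0
      rw [h2, map_zero, map_zero]
    change ((Additive.toMul (f x) : ℂˣ) : ℂ) = 1
    rw [h3]
    rfl
  refine ⟨ψ, ?_, ⟨1, one_ne_zero, h1⟩, ϖ⁻¹, ?_⟩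
  · rw [continuous_iff_continuousAt]
    intro x
    refine (continuousAt_const (y := ψ x)).congr ?_
    have hmem : (fun y => y - x) ⁻¹' (closedBall F 1 : Set F) ∈ 𝓝 x := by
      have hc : ContinuousAt (fun y => y - x) x := by fun_prop
      refine hc.preimage_mem_nhds ?_
      rw [sub_self]
      exact closedBall_mem_nhds one_ne_zero
    filter_upwards [hmem] with y hy
    have := h1 _ hy
    rw [← sub_add_cancel y x, AddChar.map_add_eq_mul, this, one_mul]
  · intro h
    have h2 : f ϖ⁻¹ = 0 := Additive.toMul.injective (Units.ext h)
    have h3 := (injective_iff_map_eq_zero _).1 ratCircleHom_injective _ h2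
    exact hχ h3

end LocalField

/-! ### The standard symplectic form and transvections -/

section Symplectic

variable {F : Type*} [Field F] {κ : Type*} [Fintype κ]

variable (F κ) in
/-- The standard symplectic form. -/
def symp : (κ ⊕ κ → F) →ₗ[F] (κ ⊕ κ → F) →ₗ[F] F :=
  LinearMap.mk₂ F (fun x y => ∑ k, (x (.inr k) * y (.inl k) - x (.inl k) * y (.inr k)))
    (by
      intro x x' y
      rw [← Finset.sum_add_distrib]
      exact Finset.sum_congr rfl fun k _ => by simp only [Pi.add_apply]; ring)
    (by
      intro a x y
      rw [Finset.smul_sum]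
      exact Finset.sum_congr rfl fun k _ => by simp only [Pi.smul_apply, smul_eq_mul]; ring)
    (by
      intro x y y'
      rw [← Finset.sum_add_distrib]
      exact Finset.sum_congr rfl fun k _ => by simp only [Pi.add_apply]; ring)
    (by
      intro a x y
      rw [Finset.smul_sum]
      exact Finset.sum_congr rfl fun k _ => by simp only [Pi.smul_apply, smul_eq_mul]; ring)

theorem symp_apply (x y : κ ⊕ κ → F) :
    symp F κ x y = ∑ k, (x (.inr k) * y (.inl k) - x (.inl k) * y (.inr k)) := rfl

theorem symp_self (x : κ ⊕ κ → F) : symp F κ x x = 0 := by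
  rw [symp_apply]
  exact Finset.sum_eq_zero fun k _ => by ring

theorem symp_swap (x y : κ ⊕ κ → F) : symp F κ x y = - symp F κ y x := by
  rw [symp_apply, symp_apply, ← Finset.sum_neg_distrib]
  exact Finset.sum_congr rfl fun k _ => by ring

variable [DecidableEq κ]

theorem symp_single_inr (k : κ) (y : κ ⊕ κ → F) :
    symp F κ (Pi.single (.inr k) 1) y = y (.inl k) := by
  rw [symp_apply, Finset.sum_eq_single k]
  · simp
  · intro j _ hj
    simp [hj]
  · simp

theorem symp_single_inl (k : κ) (y : κ ⊕ κ → F) :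
    symp F κ (Pi.single (.inl k) 1) y = - y (.inr k) := by
  rw [symp_apply, Finset.sum_eq_single k]
  · simp
  · intro j _ hj
    simp [hj]
  · simp

theorem exists_symp_ne_zero {x : κ ⊕ κ → F} (hx : x ≠ 0) : ∃ w, symp F κ x w ≠ 0 := by
  by_contra! h
  apply hx
  ext k
  rcases k with k | k
  · have h1 := h (Pi.single (.inr k) 1)
    rw [symp_swap, symp_single_inr] at h1
    simpa using h1
  · have h1 := h (Pi.single (.inl k) 1)
    rw [symp_swap, symp_single_inl] at h1
    simpa using h1

/-- A vector space is not the union of two proper subspaces, here the orthogonals of x and y. -/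
theorem exists_symp_ne_zero₂ {x y : κ ⊕ κ → F} (hx : x ≠ 0) (hy : y ≠ 0) :
    ∃ w, symp F κ x w ≠ 0 ∧ symp F κ y w ≠ 0 := by
  obtain ⟨w, hw⟩ := exists_symp_ne_zero hx
  obtain ⟨w', hw'⟩ := exists_symp_ne_zero hy
  by_cases h1 : symp F κ y w = 0
  · by_cases h2 : symp F κ x w' = 0
    · exact ⟨w + w', by simpa [h2] using hw, by simpa [h1] using hw'⟩
    · exact ⟨w', h2, hw'⟩
  · exact ⟨w, hw, h1⟩

/-- Symplectic transvections act transitively on nonzero vectors. -/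
theorem mem_of_transvection_stable {S : Set (κ ⊕ κ → F)}
    (hS : ∀ x ∈ S, ∀ z, ∀ a : F, x + (a * symp F κ z x) • z ∈ S)
    {x y : κ ⊕ κ → F} (hx : x ∈ S) (hx0 : x ≠ 0) (hy0 : y ≠ 0) : y ∈ S := by
  have key : ∀ x ∈ S, ∀ y, symp F κ x y ≠ 0 → y ∈ S := by
    intro x hx y hxy
    -- The transvection along y - x with coefficient 1/⟨y - x, x⟩ sends x to y. When ⟨x, y⟩ = 0 it
    -- is unavailable, whence the detour through w below.
    have h1 : symp F κ (y - x) x ≠ 0 := by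
      rw [map_sub, LinearMap.sub_apply, symp_self, sub_zero, symp_swap]
      exact neg_ne_zero.2 hxy
    have := hS x hx (y - x) (symp F κ (y - x) x)⁻¹
    rwa [inv_mul_cancel₀ h1, one_smul, add_sub_cancel] at this
  obtain ⟨w, hxw, hyw⟩ := exists_symp_ne_zero₂ hx0 hy0
  refine key w (key x hx w hxw) y ?_
  rw [symp_swap]
  exact neg_ne_zero.2 hyw

/-- The symplectic transvection `x ↦ x + a ⟨z, x⟩ z`. -/
def transvection (z : κ ⊕ κ → F) (a : F) : (κ ⊕ κ → F) ≃+ (κ ⊕ κ → F) where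
  toFun x := x + (a * symp F κ z x) • z
  invFun x := x - (a * symp F κ z x) • z
  left_inv x := by simp [symp_self]
  right_inv x := by simp [symp_self]
  map_add' x y := by simp [mul_add, add_smul]; abel

theorem transvection_apply (z : κ ⊕ κ → F) (a : F) (x : κ ⊕ κ → F) :
    transvection z a x = x + (a * symp F κ z x) • z := rfl

theorem transvection_neg_apply (z : κ ⊕ κ → F) (a : F) (x : κ ⊕ κ → F) :
    transvection z (-a) x = x - (a * symp F κ z x) • z := by
  rw [transvection_apply, neg_mul, neg_smul, sub_eq_add_neg]

theorem symp_transvection (z : κ ⊕ κ → F) (a : F) (x y : κ ⊕ κ → F) :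
    symp F κ x (transvection z (-a) y) = symp F κ (transvection z a x) y := by
  rw [transvection_neg_apply, transvection_apply]
  simp only [map_sub, map_add, map_smul, LinearMap.add_apply, LinearMap.smul_apply, smul_eq_mul]
  rw [symp_swap x z]
  ring

end Symplectic

/-! ### Haar measure -/

section Haar

/-- The modulus scales the volume of K, which is finite and positive because K is compact, open and
nonempty. -/
theorem addEquivAddHaarChar_eq_one {G : Type*} [AddGroup G] [TopologicalSpace G]
    [MeasurableSpace G] [BorelSpace G] [IsTopologicalAddGroup G] [LocallyCompactSpace G]
    (φ : G ≃ₜ+ G) {K : Set G} (hK : IsCompact K) (hKo : IsOpen K) (hne : K.Nonempty)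
    (hφ : φ ⁻¹' K = K) : addEquivAddHaarChar φ = 1 := by
  have h := addEquivAddHaarChar_smul_preimage Measure.addHaar (X := K) φ
  rw [hφ] at h
  have h0 : Measure.addHaar K ≠ 0 := (hKo.measure_pos _ hne).ne'
  have h1 : Measure.addHaar K ≠ ⊤ := hK.measure_lt_top.ne
  have h2 : (addEquivAddHaarChar φ : ENNReal) * Measure.addHaar K = 1 * Measure.addHaar K := by
    rw [one_mul]
    exact h
  exact_mod_cast (ENNReal.mul_left_inj h0 h1).1 h2

end Haar

/-! ### Transvections preserve Haar measure; Fourier inversion on the symplectic space -/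

section Analysis

variable {F : Type*} [Field F] [ValuativeRel F] [TopologicalSpace F]
  [IsNonarchimedeanLocalField F] {κ : Type*} [Fintype κ] [DecidableEq κ]

theorem continuous_symp (x : κ ⊕ κ → F) : Continuous (symp F κ x) := by
  change Continuous fun y : κ ⊕ κ → F => ∑ k, (x (.inr k) * y (.inl k) - x (.inl k) * y (.inr k))
  fun_prop

theorem continuous_symp₂ : Continuous fun p : (κ ⊕ κ → F) × (κ ⊕ κ → F) => symp F κ p.1 p.2 := by
  change Continuous fun p : (κ ⊕ κ → F) × (κ ⊕ κ → F) =>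
    ∑ k, (p.1 (.inr k) * p.2 (.inl k) - p.1 (.inl k) * p.2 (.inr k))
  fun_prop

/-- The transvection as a homeomorphism. -/
def contTransvection (z : κ ⊕ κ → F) (a : F) : (κ ⊕ κ → F) ≃ₜ+ (κ ⊕ κ → F) where
  toAddEquiv := transvection z a
  continuous_toFun := by
    have := continuous_symp z
    change Continuous fun x : κ ⊕ κ → F => x + (a * symp F κ z x) • z
    fun_prop
  continuous_invFun := by
    have := continuous_symp z
    change Continuous fun x : κ ⊕ κ → F => x - (a * symp F κ z x) • z
    fun_prop

theorem isCompact_pi_closedBall (γ : ValueGroupWithZero F) :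
    IsCompact {x : κ ⊕ κ → F | ∀ k, x k ∈ closedBall F γ} := by
  have := isCompact_univ_pi (fun _ : κ ⊕ κ => isCompact_closedBall (F := F) γ)
  convert this using 1
  ext x
  simp

theorem isOpen_pi_closedBall {γ : ValueGroupWithZero F} (hγ : γ ≠ 0) :
    IsOpen {x : κ ⊕ κ → F | ∀ k, x k ∈ closedBall F γ} := by
  have := isOpen_set_pi (Set.finite_univ) (fun (_ : κ ⊕ κ) _ => isOpen_closedBall (F := F) hγ)
  convert this using 1
  ext x
  simp

variable [MeasurableSpace (κ ⊕ κ → F)] [BorelSpace (κ ⊕ κ → F)]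

/-- A transvection preserves the compact open set of integral b whose increment a⟨z,b⟩z is integral
too, since the increment is unchanged by the transvection. -/
theorem addEquivAddHaarChar_contTransvection (z : κ ⊕ κ → F) (a : F) :
    addEquivAddHaarChar (contTransvection z a) = 1 := by
  have hc : Continuous fun b : κ ⊕ κ → F => (a * symp F κ z b) • z := by
    have := continuous_symp z
    fun_prop
  have ho := isOpen_pi_closedBall (F := F) (κ := κ) one_ne_zero
  have hcl : IsClosed {x : κ ⊕ κ → F | ∀ k, x k ∈ closedBall F 1} :=
    (isCompact_pi_closedBall 1).isClosed
  refine addEquivAddHaarChar_eq_one _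
    (K := {x | ∀ k, x k ∈ closedBall F 1} ∩
      (fun b : κ ⊕ κ → F => (a * symp F κ z b) • z) ⁻¹' {x | ∀ k, x k ∈ closedBall F 1})
    ((isCompact_pi_closedBall 1).inter_right (hcl.preimage hc))
    (ho.inter (ho.preimage hc)) ⟨0, ?_⟩ ?_
  · constructor
    · intro k
      exact zero_mem _
    · intro k
      simp
  · ext x
    have h1 : symp F κ z (contTransvection z a x) = symp F κ z x := by
      change symp F κ z (x + (a * symp F κ z x) • z) = _
      simp [symp_self]
    simp only [Set.mem_preimage, Set.mem_inter_iff, Set.mem_ofPred_eq, h1]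
    refine and_congr_left fun h => forall_congr' fun k => ?_
    change x k + ((a * symp F κ z x) • z) k ∈ _ ↔ _
    exact AddSubgroup.add_mem_cancel_right _ (h k)

theorem integral_comp_transvection (z : κ ⊕ κ → F) (a : F) (f : (κ ⊕ κ → F) → ℂ) :
    ∫ b, f (transvection z a b) ∂Measure.addHaar = ∫ b, f b ∂Measure.addHaar := by
  have h1 := addEquivAddHaarChar_smul_map (Measure.addHaar : Measure (κ ⊕ κ → F))
    (contTransvection z a)
  rw [addEquivAddHaarChar_contTransvection, one_smul] at h1
  have h2 : MeasurableEmbedding (contTransvection z a) :=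
    (contTransvection z a).toHomeomorph.measurableEmbedding
  conv_rhs => rw [← h1, h2.integral_map]
  rfl

/-! ### Fourier inversion -/

/-- A locally constant compactly supported function all of whose Fourier coefficients at nonzero
frequencies vanish is zero. -/
theorem eq_zero_of_fourier_eq_zero [Nonempty κ] {ψ : AddChar F ℂ} (hψ : Continuous ψ)
    (hψ1 : ∃ γ : ValueGroupWithZero F, γ ≠ 0 ∧ ∀ x ∈ closedBall F γ, ψ x = 1) {t : F}
    (ht : ψ t ≠ 1) {f : (κ ⊕ κ → F) → ℂ} (hf : Continuous f) (hfc : HasCompactSupport f)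
    (hfs : ∀ᶠ b' in 𝓝 0, ∀ b, f (b + b') = f b)
    (h : ∀ ξ, ξ ≠ 0 → ∫ b, f b * ψ (- symp F κ ξ b) ∂Measure.addHaar = 0) : f = 0 := by
  obtain ⟨α, hα, hαs⟩ : ∃ α : ValueGroupWithZero F, α ≠ 0 ∧
      ∀ b' : κ ⊕ κ → F, (∀ k, b' k ∈ closedBall F α) → ∀ b, f (b + b') = f b := by
    rw [nhds_pi, Filter.Eventually, Filter.mem_pi] at hfs
    obtain ⟨I, hI, U, hU, hs⟩ := hfs
    have h1 : (⋂ k, U k) ∈ 𝓝 (0 : F) := Filter.iInter_mem.2 hU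
    obtain ⟨α, hα, h2⟩ := exists_closedBall_subset h1
    exact ⟨α, hα, fun b' hb' b => hs (fun k _ => Set.mem_iInter.1 (h2 (hb' k)) k) b⟩
  obtain ⟨a, rfl⟩ := ValuativeRel.valuation_surjective α
  have ha : a ≠ 0 := by simpa using hα
  -- The radius of Λ is chosen so that its annihilator D under ψ∘⟨ , ⟩ lies in the ball of radius
  -- |a|, on whose translates f is constant: a coordinate larger than |a| could be paired with an
  -- element of Λ to give t.
  set δ := valuation F (t / a) with hδ
  have ht0 : t ≠ 0 := by
    rintro rfl
    simp at ht
  have hδ0 : δ ≠ 0 := by simp [hδ, ha, ht0]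
  set Λ : Set (κ ⊕ κ → F) := {x | ∀ k, x k ∈ closedBall F δ} with hΛ
  have hΛo : IsOpen Λ := isOpen_pi_closedBall hδ0
  have hΛc : IsCompact Λ := isCompact_pi_closedBall δ
  have hΛcl : IsClopen Λ := ⟨hΛc.isClosed, hΛo⟩
  set D : Set (κ ⊕ κ → F) := {y | ∀ ξ ∈ Λ, ψ (symp F κ ξ y) = 1} with hD
  have hDa : ∀ y ∈ D, ∀ k, y k ∈ closedBall F (valuation F a) := by
    intro y hy k
    by_contra hk
    have hk' : valuation F a < valuation F (y k) := not_le.1 hk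
    have hyk : y k ≠ 0 := by
      intro h0
      rw [h0, map_zero] at hk'
      exact not_lt_zero hk'
    have hmem : t / y k ∈ closedBall F δ := by
      rw [mem_closedBall, hδ, map_div₀, map_div₀]
      exact div_le_div_of_nonneg_left zero_le (zero_lt_iff.2 hα) hk'.le
    rcases k with k | k
    · have h1 : (t / y (.inl k)) • (Pi.single (.inr k) 1 : κ ⊕ κ → F) ∈ Λ := by
        intro j
        by_cases hj : j = .inr k
        · subst hj
          simpa using hmem
        · simp [hj]
      apply ht
      have := hy _ h1
      rwa [map_smul, LinearMap.smul_apply, symp_single_inr, smul_eq_mul, div_mul_cancel₀ _ hyk]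
        at this
    · have h1 : (-(t / y (.inr k))) • (Pi.single (.inl k) 1 : κ ⊕ κ → F) ∈ Λ := by
        intro j
        by_cases hj : j = .inl k
        · subst hj
          simpa using hmem
        · simp [hj]
      apply ht
      have := hy _ h1
      rwa [map_smul, LinearMap.smul_apply, symp_single_inl, smul_eq_mul, neg_mul_neg,
        div_mul_cancel₀ _ hyk] at this
  -- Truncating the frequencies to Λ gives a kernel whose integral over ξ is vol(Λ) times the
  -- indicator of D.
  let χ : (κ ⊕ κ → F) → (κ ⊕ κ → F) → ℂ := fun ξ y => Λ.indicator (fun ξ => ψ (- symp F κ ξ y)) ξ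
  have hχc : Continuous fun p : (κ ⊕ κ → F) × (κ ⊕ κ → F) => χ p.1 p.2 := by
    have h1 : (fun p : (κ ⊕ κ → F) × (κ ⊕ κ → F) => χ p.1 p.2)
        = (Prod.fst ⁻¹' Λ).indicator (fun p => ψ (- symp F κ p.1 p.2)) := by
      ext p
      rfl
    rw [h1]
    refine Continuous.indicator ?_ (hψ.comp continuous_symp₂.neg)
    intro p hp
    rw [(hΛcl.preimage continuous_fst).frontier_eq] at hp
    exact hp.elim
  set m : ℝ := Measure.addHaar.real Λ with hm
  have hm0 : 0 < m :=
    ENNReal.toReal_pos (hΛo.measure_pos _ ⟨0, fun k => zero_mem _⟩).ne' hΛc.measure_lt_top.ne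
  have hadd : ∀ ξ ∈ Λ, ∀ ξ', ξ' + ξ ∈ Λ ↔ ξ' ∈ Λ := fun ξ hξ ξ' =>
    forall_congr' fun k => AddSubgroup.add_mem_cancel_right _ (hξ k)
  have hint : ∀ y, ∫ ξ, χ ξ y ∂Measure.addHaar = D.indicator (fun _ => (m : ℂ)) y := by
    intro y
    by_cases hy : y ∈ D
    · rw [Set.indicator_of_mem hy]
      have h1 : (fun ξ => χ ξ y) = Λ.indicator fun _ => (1 : ℂ) := by
        ext ξ
        by_cases hξ : ξ ∈ Λ
        · simp only [χ, Set.indicator_of_mem hξ]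
          rw [AddChar.map_neg_eq_inv, hy ξ hξ, inv_one]
        · simp only [χ, Set.indicator_of_notMem hξ]
      rw [h1, integral_indicator hΛo.measurableSet]
      simp [hm]
    · rw [Set.indicator_of_notMem hy]
      simp only [hD, Set.mem_ofPred_eq, not_forall] at hy
      obtain ⟨ξ₀, hξ₀, hne⟩ := hy
      have h1 : ∀ ξ, χ (ξ + ξ₀) y = ψ (- symp F κ ξ₀ y) * χ ξ y := by
        intro ξ
        by_cases hξ : ξ ∈ Λ
        · simp only [χ, Set.indicator_of_mem hξ, Set.indicator_of_mem ((hadd ξ₀ hξ₀ ξ).2 hξ)]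
          rw [map_add, LinearMap.add_apply, neg_add_rev, AddChar.map_add_eq_mul]
        · simp only [χ, Set.indicator_of_notMem hξ,
            Set.indicator_of_notMem (mt (hadd ξ₀ hξ₀ ξ).1 hξ), mul_zero]
      have h2 := integral_add_right_eq_self (μ := Measure.addHaar) (fun ξ => χ ξ y) ξ₀
      simp only [h1] at h2
      rw [integral_const_mul] at h2
      by_contra h3
      have h4 : ψ (- symp F κ ξ₀ y) = 1 := mul_right_cancel₀ h3 (h2.trans (one_mul _).symm)
      rw [AddChar.map_neg_eq_inv, inv_eq_one] at h4
      exact hne h4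
  ext x
  -- The double integral is computed both ways: integrating over b first gives Fourier coefficients
  -- of f, integrating over ξ first gives f(x) vol(Λ) vol(D).
  have hswap : ∫ b, (∫ ξ, f b * χ ξ (b - x) ∂Measure.addHaar) ∂Measure.addHaar
      = ∫ ξ, (∫ b, f b * χ ξ (b - x) ∂Measure.addHaar) ∂Measure.addHaar := by
    refine integral_integral_swap_of_hasCompactSupport ?_ ?_
    · have : Continuous fun p : (κ ⊕ κ → F) × (κ ⊕ κ → F) => χ p.2 (p.1 - x) :=
        hχc.comp (continuous_snd.prodMk (continuous_fst.sub continuous_const))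
      exact (hf.comp continuous_fst).mul this
    · refine HasCompactSupport.intro (K := tsupport f ×ˢ Λ) (hfc.prod hΛc) ?_
      rintro ⟨b, ξ⟩ hp
      rw [Set.mem_prod, not_and_or] at hp
      rcases hp with hp | hp
      · simp [Function.uncurry, image_eq_zero_of_notMem_tsupport hp]
      · have : χ ξ (b - x) = 0 := Set.indicator_of_notMem hp _
        simp [Function.uncurry, this]
  -- Only ξ = 0 escapes the hypothesis `h`; points are null because the space is not discrete.
  have hz : ∀ᵐ ξ ∂(Measure.addHaar : Measure (κ ⊕ κ → F)),
      ∫ b, f b * χ ξ (b - x) ∂Measure.addHaar = 0 := by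
    have hne : (𝓝[≠] (0 : κ ⊕ κ → F)).NeBot := by
      rw [← mem_closure_iff_nhdsWithin_neBot, mem_closure_iff_nhds]
      intro s hs
      obtain ⟨k⟩ := ‹Nonempty κ›
      have hc : Continuous fun a : F => (Pi.single (.inl k) a : κ ⊕ κ → F) := by
        simpa only [Pi.single, id] using
          (continuous_const (y := (0 : κ ⊕ κ → F))).update (Sum.inl k) continuous_id
      have h1 : (fun a : F => (Pi.single (.inl k) a : κ ⊕ κ → F)) ⁻¹' s ∈ 𝓝 0 :=
        hc.continuousAt.preimage_mem_nhds (by simpa using hs)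
      obtain ⟨a, has, ha0⟩ := exists_mem_nhds_ne_zero h1
      exact ⟨_, has, by simpa using ha0⟩
    have h0 : (Measure.addHaar : Measure (κ ⊕ κ → F)) {0} = 0 := measure_singleton 0
    filter_upwards [measure_eq_zero_iff_ae_notMem.1 h0] with ξ hξ
    by_cases hξΛ : ξ ∈ Λ
    · have h1 : ∀ b, f b * χ ξ (b - x) = (f b * ψ (- symp F κ ξ b)) * ψ (symp F κ ξ x) := by
        intro b
        simp only [χ, Set.indicator_of_mem hξΛ]
        rw [map_sub, neg_sub, sub_eq_add_neg, AddChar.map_add_eq_mul]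
        ring
      simp only [h1]
      rw [integral_mul_const, h ξ hξ, zero_mul]
    · have : ∀ b, χ ξ (b - x) = 0 := fun b => Set.indicator_of_notMem hξΛ _
      simp [this]
  rw [integral_congr_ae hz, integral_zero] at hswap
  simp only [integral_const_mul, hint] at hswap
  have h1 : ∀ b, f b * D.indicator (fun _ => (m : ℂ)) (b - x)
      = f x * D.indicator (fun _ => (m : ℂ)) (b - x) := by
    intro b
    by_cases hb : b - x ∈ D
    · have := hαs (b - x) (hDa _ hb) x
      rw [add_sub_cancel] at this
      rw [this]
    · simp [Set.indicator_of_notMem hb]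
  simp only [h1, integral_const_mul] at hswap
  rw [integral_sub_right_eq_self (fun b => D.indicator (fun _ => (m : ℂ)) b) x] at hswap
  rcases mul_eq_zero.1 hswap with h2 | h2
  · exact h2
  exfalso
  have hDc : IsClosed D := by
    have : D = ⋂ ξ ∈ Λ, {y | ψ (symp F κ ξ y) = 1} := by
      ext y
      simp [hD]
    rw [this]
    exact isClosed_biInter fun ξ _ =>
      isClosed_eq (hψ.comp (continuous_symp ξ)) continuous_const
  have hDk : IsCompact D := (isCompact_pi_closedBall (valuation F a)).of_isClosed_subset hDc hDa
  have hDn : D ∈ 𝓝 (0 : κ ⊕ κ → F) := by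
    obtain ⟨γ, hγ, hγ1⟩ := hψ1
    refine Filter.mem_of_superset ((isOpen_pi_closedBall (div_ne_zero hγ hδ0)).mem_nhds
      fun k => zero_mem _) fun y hy ξ hξ => hγ1 _ ?_
    have hmul : ∀ x ∈ closedBall F δ, ∀ y ∈ closedBall F (γ / δ), x * y ∈ closedBall F γ := by
      intro x hx y hy
      rw [mem_closedBall, map_mul]
      exact (mul_le_mul' hx hy).trans_eq (mul_div_cancel₀ _ hδ0)
    rw [symp_apply]
    exact sum_mem fun k _ => sub_mem (hmul _ (hξ _) _ (hy _)) (hmul _ (hξ _) _ (hy _))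
  rw [integral_indicator hDc.measurableSet] at h2
  simp only [integral_const, MeasurableSet.univ, measureReal_restrict_apply,
    Set.univ_inter, Complex.real_smul] at h2
  rcases mul_eq_zero.1 h2 with h3 | h3
  · have : 0 < Measure.addHaar.real D :=
      ENNReal.toReal_pos (Measure.measure_pos_of_mem_nhds _ hDn).ne' hDk.measure_lt_top.ne
    exact this.ne' (by exact_mod_cast h3)
  · exact hm0.ne' (by exact_mod_cast h3)

end Analysis

/-! ### Slow functions, and Fourier coefficients of their differences -/

section Analysis

variable {F : Type*} [Field F] [ValuativeRel F] [TopologicalSpace F]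
  [IsNonarchimedeanLocalField F] {κ : Type*} [Fintype κ] [DecidableEq κ]

/-- A function on the standard symplectic space that is invariant under small translations and
under small transvections in every direction. -/
structure IsSlow (φ : (κ ⊕ κ → F) → ℂ) : Prop where
  translation : ∀ᶠ b' in 𝓝 0, ∀ b, φ (b + b') = φ b
  transvection : ∀ z, ∀ᶠ a in 𝓝 (0 : F), ∀ b, φ (b - (a * symp F κ z b) • z) = φ b

theorem continuous_of_eventually_translation {φ : (κ ⊕ κ → F) → ℂ}
    (h : ∀ᶠ b' in 𝓝 0, ∀ b, φ (b + b') = φ b) : Continuous φ := by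
  rw [continuous_iff_continuousAt]
  intro x
  refine (continuousAt_const (y := φ x)).congr ?_
  have hc : Tendsto (fun y => y - x) (𝓝 x) (𝓝 0) := by
    have : ContinuousAt (fun y => y - x) x := by fun_prop
    simpa [ContinuousAt] using this
  filter_upwards [hc.eventually h] with y hy
  have := hy x
  rw [add_sub_cancel] at this
  exact this.symm

namespace IsSlow

variable {φ : (κ ⊕ κ → F) → ℂ}

theorem continuous (hφ : IsSlow φ) : Continuous φ :=
  continuous_of_eventually_translation hφ.translation

/-- The transvection along z with coefficient 1/⟨z,b⟩ carries b to b + z, and this coefficient is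
small when ⟨z,b⟩ is large. -/
theorem exists_forall_add_eq (hφ : IsSlow φ) (z : κ ⊕ κ → F) :
    ∃ γ : ValueGroupWithZero F, ∀ b, symp F κ z b ∉ closedBall F γ → φ (b + z) = φ b := by
  have h1 : ∀ᶠ a in 𝓝 (0 : F), ∀ b, φ (b - (-a * symp F κ z b) • z) = φ b := by
    have : Tendsto (fun a : F => -a) (𝓝 0) (𝓝 0) := by
      simpa using (continuous_neg (G := F)).tendsto 0
    exact this.eventually (hφ.transvection z)
  obtain ⟨γ, hγ⟩ := exists_forall_inv_mem h1
  refine ⟨γ, fun b hb => ?_⟩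
  obtain ⟨h0, h2⟩ := hγ _ hb
  have := h2 b
  rwa [neg_mul, inv_mul_cancel₀ h0, neg_smul, one_smul, sub_neg_eq_add] at this

/-- It suffices that φ(b + z) = φ(b) once ⟨β,b⟩ is large, for β in the symplectic basis, since this
bounds every coordinate of b on the support. If ⟨z,b⟩ is large, translation by z is free. Otherwise
⟨z + β, b⟩ and ⟨β, b + z⟩ are both large, so one goes from b to b + z + β and then back by -β. -/
theorem hasCompactSupport_sub (hφ : IsSlow φ) (z : κ ⊕ κ → F) :
    HasCompactSupport fun b => φ (b + z) - φ b := by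
  choose γ hγ using hφ.exists_forall_add_eq
  have key : ∀ β, ∃ δ : ValueGroupWithZero F, ∀ b, symp F κ β b ∉ closedBall F δ →
      φ (b + z) = φ b := by
    intro β
    refine ⟨max (max (γ z) (γ (z + β))) (max (γ (-β)) (valuation F (symp F κ β z))), ?_⟩
    intro b hb
    rw [mem_closedBall, not_le, max_lt_iff, max_lt_iff, max_lt_iff] at hb
    obtain ⟨⟨h1, h2⟩, h3, h4⟩ := hb
    by_cases hz : symp F κ z b ∈ closedBall F (γ z)
    · have h5 : φ (b + (z + β)) = φ b := by
        refine hγ _ _ ?_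
        rw [mem_closedBall, not_le, map_add, LinearMap.add_apply,
          Valuation.map_add_eq_of_lt_right _ ((mem_closedBall.1 hz).trans_lt h1)]
        exact h2
      have h6 : φ (b + (z + β) + -β) = φ (b + (z + β)) := by
        refine hγ _ _ ?_
        have h7 : symp F κ (-β) (b + (z + β)) = -(symp F κ β b + symp F κ β z) := by
          simp [symp_self]
        rw [mem_closedBall, not_le, h7, Valuation.map_neg, Valuation.map_add_eq_of_lt_left _ h4]
        exact h3
      rw [← h5, ← h6]
      congr 1
      abel
    · exact hγ z b hz
  choose δ hδ using key
  let K : Set (κ ⊕ κ → F) := Set.univ.pi fun k => Sum.rec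
    (fun k => (closedBall F (δ (Pi.single (.inr k) 1)) : Set F))
    (fun k => (closedBall F (δ (Pi.single (.inl k) 1)) : Set F)) k
  refine HasCompactSupport.intro (K := K) (isCompact_univ_pi ?_) ?_
  · rintro (k | k) <;> exact isCompact_closedBall _
  · intro b hb
    simp only [K, Set.mem_univ_pi, not_forall] at hb
    obtain ⟨k | k, hk⟩ := hb
    · rw [sub_eq_zero]
      refine hδ (Pi.single (.inr k) 1) b ?_
      rw [symp_single_inr]
      exact hk
    · rw [sub_eq_zero]
      refine hδ (Pi.single (.inl k) 1) b ?_
      rw [symp_single_inl, neg_mem_iff]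
      exact hk

end IsSlow

variable [MeasurableSpace (κ ⊕ κ → F)] [BorelSpace (κ ⊕ κ → F)]

theorem addChar_ne_zero (ψ : AddChar F ℂ) (x : F) : ψ x ≠ 0 := by
  intro h
  have := ψ.map_add_eq_mul x (-x)
  rw [h, zero_mul, add_neg_cancel, AddChar.map_zero_eq_one] at this
  exact one_ne_zero this

/-- The Fourier coefficient at `ξ` of the difference function `b ↦ φ (b + β) - φ b`. -/
def fourierDiff (ψ : AddChar F ℂ) (ξ : κ ⊕ κ → F) (φ : (κ ⊕ κ → F) → ℂ) (β : κ ⊕ κ → F) : ℂ :=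
  ∫ b, (φ (b + β) - φ b) * ψ (- symp F κ ξ b) ∂Measure.addHaar

variable {ψ : AddChar F ℂ}

theorem IsSlow.integrable (hψ : Continuous ψ) {φ : (κ ⊕ κ → F) → ℂ} (hφ : IsSlow φ)
    (ξ β : κ ⊕ κ → F) :
    Integrable (fun b => (φ (b + β) - φ b) * ψ (- symp F κ ξ b)) Measure.addHaar := by
  have hc := hφ.continuous
  have hs := continuous_symp ξ
  refine Continuous.integrable_of_hasCompactSupport (by fun_prop) ?_
  exact (hφ.hasCompactSupport_sub β).mul_right

/-- In β the coefficient is a cocycle twisted by the character ψ(⟨ξ, ·⟩), from φ(b + β + β') - φ(b)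
= (φ(b + β' + β) - φ(b + β')) + (φ(b + β') - φ(b)). -/
theorem fourierDiff_add (hψ : Continuous ψ) {φ : (κ ⊕ κ → F) → ℂ} (hφ : IsSlow φ)
    (ξ β β' : κ ⊕ κ → F) :
    fourierDiff ψ ξ φ (β + β')
      = ψ (symp F κ ξ β') * fourierDiff ψ ξ φ β + fourierDiff ψ ξ φ β' := by
  have h1 : ψ (symp F κ ξ β') * fourierDiff ψ ξ φ β
      = ∫ b, (φ (b + β' + β) - φ (b + β')) * ψ (- symp F κ ξ b) ∂Measure.addHaar := by
    rw [fourierDiff, ← integral_add_right_eq_self _ β', ← integral_const_mul]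
    refine integral_congr_ae (ae_of_all _ fun b => ?_)
    simp only [map_add, neg_add, AddChar.map_add_eq_mul, AddChar.map_neg_eq_inv (ψ) (symp F κ ξ β')]
    have := addChar_ne_zero ψ (symp F κ ξ β')
    field_simp
  have h2 : Integrable (fun b => (φ (b + β' + β) - φ (b + β')) * ψ (- symp F κ ξ b))
      Measure.addHaar := by
    have := (hφ.integrable hψ ξ (β' + β)).sub (hφ.integrable hψ ξ β')
    refine this.congr (ae_of_all _ fun b => ?_)
    simp only [Pi.sub_apply, add_assoc]
    ring
  rw [h1, fourierDiff, fourierDiff, ← integral_add h2 (hφ.integrable hψ ξ β')]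
  refine integral_congr_ae (ae_of_all _ fun b => ?_)
  simp only [add_assoc, add_comm β β']
  ring

/-- Comparing the two expansions of β + β' shows that the cocycle is proportional to ψ(⟨ξ,β⟩) - 1,
so it is governed by its value at any β₀ with ψ(⟨ξ,β₀⟩) ≠ 1. -/
theorem fourierDiff_mul_sub_one (hψ : Continuous ψ) {φ : (κ ⊕ κ → F) → ℂ} (hφ : IsSlow φ)
    (ξ β β' : κ ⊕ κ → F) :
    fourierDiff ψ ξ φ β * (ψ (symp F κ ξ β') - 1)
      = fourierDiff ψ ξ φ β' * (ψ (symp F κ ξ β) - 1) := by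
  have h1 := fourierDiff_add hψ hφ ξ β β'
  have h2 := fourierDiff_add hψ hφ ξ β' β
  rw [add_comm β' β] at h2
  linear_combination h2 - h1

/-- Change of variables by a transvection, which preserves both Haar measure and the symplectic
form. -/
theorem fourierDiff_transvection (φ : (κ ⊕ κ → F) → ℂ) (ξ β z : κ ⊕ κ → F) (a : F) :
    fourierDiff ψ ξ (fun b => φ (b - (a * symp F κ z b) • z)) β
      = fourierDiff ψ (transvection z (-a) ξ) φ (transvection z (-a) β) := by
  simp only [← transvection_neg_apply]
  rw [fourierDiff, fourierDiff, ← integral_comp_transvection z (-a)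
    (fun b => (φ (b + transvection z (-a) β) - φ b) * ψ (- symp F κ (transvection z (-a) ξ) b))]
  refine integral_congr_ae (ae_of_all _ fun b => ?_)
  have h1 : symp F κ (transvection z (-a) ξ) (transvection z (-a) b) = symp F κ ξ b := by
    rw [symp_transvection, transvection_neg_apply, transvection_apply]
    simp [symp_self]
  simp only [map_add, h1]

theorem fourierDiff_translate (φ : (κ ⊕ κ → F) → ℂ) (ξ β β' : κ ⊕ κ → F) :
    fourierDiff ψ ξ (fun b => φ (b + β')) β = ψ (symp F κ ξ β') * fourierDiff ψ ξ φ β := by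
  rw [fourierDiff, fourierDiff,
    ← integral_add_right_eq_self (fun b => (φ (b + β) - φ b) * ψ (- symp F κ ξ b)) β',
    ← integral_const_mul]
  refine integral_congr_ae (ae_of_all _ fun b => ?_)
  simp only [map_add, neg_add, AddChar.map_add_eq_mul, AddChar.map_neg_eq_inv (ψ) (symp F κ ξ β'),
    add_right_comm]
  have := addChar_ne_zero ψ (symp F κ ξ β')
  field_simp

end Analysis

/-! ### Replacing a functional by a Fourier coefficient -/

section Functional

variable {F : Type*} [Field F] [ValuativeRel F] [TopologicalSpace F]
  [IsNonarchimedeanLocalField F] {κ : Type*} [Fintype κ] [DecidableEq κ]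

/-- Localization of an invariant functional at a frequency: if the translations `u b` and the
transvections `τ z a` of the symplectic space act compatibly on a functional `ℓ`, there is
a nonzero functional which is invariant under the stabilizer of `ξ`, and under everything that
stabilizes all translates of `ℓ`. -/
theorem exists_functional {V : Type*} [AddCommGroup V] [Module ℂ V] (ℓ : V →ₗ[ℂ] ℂ)
    (u : (κ ⊕ κ → F) → V →ₗ[ℂ] V) (τ : (κ ⊕ κ → F) → F → V →ₗ[ℂ] V)
    (hu : ∀ b b' v, ℓ (u b (u b' v)) = ℓ (u (b + b') v))
    (hτ : ∀ z a b v, ℓ (u b (τ z a v)) = ℓ (u (b - (a * symp F κ z b) • z) v))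
    (hu0 : ∀ v, ∀ᶠ b in 𝓝 0, u b v = v) (hτ0 : ∀ z v, ∀ᶠ a in 𝓝 (0 : F), τ z a v = v)
    (hℓ : ℓ ≠ 0) {ξ : κ ⊕ κ → F} (hξ : ξ ≠ 0) :
    ∃ ℓ' : V →ₗ[ℂ] ℂ, ℓ' ≠ 0 ∧ (∀ b v, symp F κ ξ b = 0 → ℓ' (u b v) = ℓ' v) ∧
      (∀ z a v, symp F κ ξ z = 0 → ℓ' (τ z a v) = ℓ' v) ∧
      ∀ q : V →ₗ[ℂ] V, (∀ b v, ℓ (u b (q v)) = ℓ (u b v)) → ∀ v, ℓ' (q v) = ℓ' v := by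
  have hu00 : ∀ v, u 0 v = v := fun v => (hu0 v).self_of_nhds
  -- If all the functions b ↦ ℓ (u b v) are constant, their differences have no nonzero Fourier
  -- coefficient, and ℓ itself serves.
  by_cases hconst : ∀ b v, ℓ (u b v) = ℓ v
  · refine ⟨ℓ, hℓ, fun b v _ => hconst b v, fun z a v _ => ?_, fun q hq v => ?_⟩
    · have := hτ z a 0 v
      simpa [hu00] using this
    · have := hq 0 v
      simpa [hu00] using this
  let : MeasurableSpace (κ ⊕ κ → F) := borel _
  have : BorelSpace (κ ⊕ κ → F) := ⟨rfl⟩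
  obtain ⟨ψ, hψ, hψ1, t, ht⟩ := exists_addChar F
  let φ : V → (κ ⊕ κ → F) → ℂ := fun v b => ℓ (u b v)
  have hslow : ∀ v, IsSlow (φ v) := by
    intro v
    constructor
    · filter_upwards [hu0 v] with b' hb' b
      change ℓ (u (b + b') v) = ℓ (u b v)
      rw [← hu, hb']
    · intro z
      filter_upwards [hτ0 z v] with a ha b
      change ℓ (u _ v) = ℓ (u b v)
      rw [← hτ, ha]
  have hφu : ∀ b' v, φ (u b' v) = fun b => φ v (b + b') := fun b' v => funext fun b => hu b b' v
  have hφτ : ∀ z a v, φ (τ z a v) = fun b => φ v (b - (a * symp F κ z b) • z) :=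
    fun z a v => funext fun b => hτ z a b v
  obtain ⟨w, hw⟩ := exists_symp_ne_zero hξ
  -- With ψ(⟨ξ,β₀⟩) ≠ 1, the single coefficient at β₀ controls the whole cocycle at ξ.
  obtain ⟨β₀, hβ₀⟩ : ∃ β₀, symp F κ ξ β₀ = t := ⟨(t / symp F κ ξ w) • w, by simp [hw]⟩
  let ℓ' : V →ₗ[ℂ] ℂ :=
    { toFun := fun v => fourierDiff ψ ξ (φ v) β₀
      map_add' := by
        intro v v'
        rw [fourierDiff, fourierDiff, fourierDiff,
          ← integral_add ((hslow v).integrable hψ ξ β₀) ((hslow v').integrable hψ ξ β₀)]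
        refine integral_congr_ae (ae_of_all _ fun b => ?_)
        simp only [φ, map_add]
        ring
      map_smul' := by
        intro a v
        rw [fourierDiff, fourierDiff, RingHom.id_apply, smul_eq_mul, ← integral_const_mul]
        refine integral_congr_ae (ae_of_all _ fun b => ?_)
        simp only [φ, map_smul, smul_eq_mul]
        ring }
  have hℓ' : ∀ v, ℓ' v = fourierDiff ψ ξ (φ v) β₀ := fun v => rfl
  refine ⟨ℓ', ?_, ?_, ?_, ?_⟩
  · intro h0
    apply hconst
    obtain ⟨k⟩ : Nonempty κ := by
      by_contra hne
      rw [not_nonempty_iff] at hne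
      exact hξ (Subsingleton.elim _ _)
    have hne : Nonempty κ := ⟨k⟩
    -- S is the set of frequencies at which nothing is seen. Since τ permutes the functions φ v
    -- through transvections, S is stable under transvections; once it contains ξ it contains every
    -- nonzero frequency, contradicting `hconst`.
    let S : Set (κ ⊕ κ → F) := {ξ | ∀ v β, fourierDiff ψ ξ (φ v) β = 0}
    have hξS : ξ ∈ S := by
      intro v β
      have h1 := fourierDiff_mul_sub_one hψ (hslow v) ξ β β₀
      rw [← hℓ', h0, LinearMap.zero_apply, zero_mul, hβ₀] at h1
      exact (mul_eq_zero.1 h1).resolve_right (sub_ne_zero.2 ht)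
    have hS : ∀ x ∈ S, ∀ z, ∀ a : F, x + (a * symp F κ z x) • z ∈ S := by
      intro x hx z a v β
      obtain ⟨β', rfl⟩ := (transvection z a).surjective β
      have h1 := fourierDiff_transvection (ψ := ψ) (φ v) x β' z (-a)
      rw [← hφτ z (-a) v, hx, neg_neg] at h1
      exact h1.symm
    intro β v
    have hf : (fun b => φ v (b + β) - φ v b) = 0 := by
      refine eq_zero_of_fourier_eq_zero hψ hψ1 ht ?_ ((hslow v).hasCompactSupport_sub β) ?_ ?_
      · have := (hslow v).continuous
        fun_prop
      · filter_upwards [(hslow v).translation] with b' hb' b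
        rw [add_right_comm, hb', hb']
      · intro x hx
        exact mem_of_transvection_stable hS hξS hξ hx v β
    have h1 := congrFun hf 0
    simp only [zero_add, Pi.zero_apply, sub_eq_zero] at h1
    change ℓ (u β v) = ℓ (u 0 v) at h1
    rw [h1, hu00]
  · intro b v hb
    rw [hℓ', hφu, fourierDiff_translate, hb, AddChar.map_zero_eq_one, one_mul]
    rfl
  · intro z a v hz
    rw [hℓ', hφτ, fourierDiff_transvection]
    have h0 : ∀ a, transvection z a ξ = ξ := by
      intro a
      rw [transvection_apply, symp_swap, hz]
      simp
    rw [h0]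
    -- A transvection fixing ξ moves β₀ without changing ⟨ξ,β₀⟩, and the cocycle depends on this
    -- pairing alone.
    have h2 := fourierDiff_mul_sub_one hψ (hslow v) ξ (transvection z (-a) β₀) β₀
    rw [symp_transvection, h0, hβ₀] at h2
    exact mul_right_cancel₀ (sub_ne_zero.2 ht) h2
  · intro q hq v
    have : φ (q v) = φ v := funext fun b => hq b v
    rw [hℓ', hℓ', this]

end Functional

/-! ### Quadratic extensions -/

section Quadratic

variable {F E : Type*} [Field F] [Field E] [Algebra F E] [Algebra.IsQuadraticExtension F E]
  {c : E ≃ₐ[F] E}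

theorem exists_conj_ne (hc : c ≠ AlgEquiv.refl) : ∃ ε : E, c ε ≠ ε := by
  by_contra! h
  exact hc (AlgEquiv.ext h)

/-- The basis `1, ε` of a quadratic extension. -/
def quadraticBasis {ε : E} (hε : c ε ≠ ε) : Module.Basis (Fin 2) F E :=
  basisOfLinearIndependentOfCardEqFinrank (b := ![1, ε])
    (by
      rw [LinearIndependent.pair_iff]
      intro s t hst
      by_cases ht : t = 0
      · subst ht
        simpa using hst
      · exfalso
        apply hε
        have h1 : ε = algebraMap F E (-(s / t)) := by
          have ht' : algebraMap F E t ≠ 0 := by simpa using ht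
          rw [Algebra.smul_def, Algebra.smul_def, mul_one] at hst
          rw [map_neg, map_div₀, ← neg_div, eq_div_iff ht']
          linear_combination hst
        rw [h1, AlgEquiv.commutes])
    (by simp [Algebra.IsQuadraticExtension.finrank_eq_two F E])

theorem quadraticBasis_sum {ε : E} (hε : c ε ≠ ε) (x : E) :
    x = algebraMap F E ((quadraticBasis hε).equivFun x 0)
      + ε * algebraMap F E ((quadraticBasis hε).equivFun x 1) := by
  have h := (quadraticBasis hε).sum_equivFun x
  rw [Fin.sum_univ_two] at h
  conv_lhs => rw [← h]
  simp [quadraticBasis, Algebra.smul_def, mul_comm]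

theorem exists_eq_add_mul {ε : E} (hε : c ε ≠ ε) (x : E) :
    ∃ a b : F, x = algebraMap F E a + ε * algebraMap F E b :=
  ⟨_, _, quadraticBasis_sum hε x⟩

theorem conj_fixed (hc : c ≠ AlgEquiv.refl) {x : E} (hx : c x = x) :
    ∃ a : F, x = algebraMap F E a := by
  obtain ⟨ε, hε⟩ := exists_conj_ne hc
  obtain ⟨a, b, rfl⟩ := exists_eq_add_mul hε x
  refine ⟨a, ?_⟩
  rw [map_add, map_mul, AlgEquiv.commutes, AlgEquiv.commutes] at hx
  have h1 : (c ε - ε) * algebraMap F E b = 0 := by linear_combination hx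
  rw [(mul_eq_zero.1 h1).resolve_left (sub_ne_zero.2 hε)]
  simp

/-- Both ε and c ε are roots of a monic quadratic polynomial over F, so c ε = q - ε with q in F;
this computation is indifferent to characteristic 2. -/
theorem conj_conj (hc : c ≠ AlgEquiv.refl) (x : E) : c (c x) = x := by
  obtain ⟨ε, hε⟩ := exists_conj_ne hc
  obtain ⟨p, q, hpq⟩ := exists_eq_add_mul hε (ε * ε)
  have h1 := congrArg c hpq
  simp only [map_add, map_mul, AlgEquiv.commutes] at h1
  have h2 : (c ε - ε) * (c ε + ε - algebraMap F E q) = 0 := by linear_combination h1 - hpq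
  have h3 : c ε = algebraMap F E q - ε := by
    linear_combination (mul_eq_zero.1 h2).resolve_left (sub_ne_zero.2 hε)
  have h4 : c (c ε) = ε := by
    rw [h3, map_sub, AlgEquiv.commutes, h3]
    ring
  obtain ⟨a, b, rfl⟩ := exists_eq_add_mul hε x
  simp only [map_add, map_mul, AlgEquiv.commutes, h4]

theorem exists_trace (hc : c ≠ AlgEquiv.refl) (x : E) : ∃ a : F, x + c x = algebraMap F E a :=
  conj_fixed hc (by rw [map_add, conj_conj hc, add_comm])

theorem exists_norm (hc : c ≠ AlgEquiv.refl) (x : E) : ∃ a : F, x * c x = algebraMap F E a :=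
  conj_fixed hc (by rw [map_mul, conj_conj hc, mul_comm])

end Quadratic

/-! ### The hermitian form and the unitary group -/

section Herm

variable {F E : Type*} [Field F] [Field E] [Algebra F E] {c : E ≃ₐ[F] E} {n : ℕ}

theorem herm_apply (v w : Space E n) :
    herm c n v w = ∑ k, (c (v (.inr k)) * w (.inl k) - c (v (.inl k)) * w (.inr k)) := by
  simp only [herm, Matrix.J, Matrix.fromBlocks_mulVec, dotProduct, Fintype.sum_sum_type,
    Sum.elim_inl, Sum.elim_inr, Matrix.neg_mulVec, Matrix.one_mulVec, Matrix.zero_mulVec,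
    zero_add, add_zero, Pi.neg_apply, Function.comp_apply, Finset.sum_sub_distrib, mul_neg,
    Finset.sum_neg_distrib]
  ring

theorem herm_add_left (v v' w : Space E n) :
    herm c n (v + v') w = herm c n v w + herm c n v' w := by
  simp only [herm_apply, ← Finset.sum_add_distrib, Pi.add_apply, map_add]
  exact Finset.sum_congr rfl fun k _ => by ring

theorem herm_add_right (v w w' : Space E n) :
    herm c n v (w + w') = herm c n v w + herm c n v w' := by
  simp only [herm_apply, ← Finset.sum_add_distrib, Pi.add_apply]
  exact Finset.sum_congr rfl fun k _ => by ring

theorem herm_smul_left (a : E) (v w : Space E n) :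
    herm c n (a • v) w = c a * herm c n v w := by
  simp only [herm_apply, Finset.mul_sum, Pi.smul_apply, smul_eq_mul, map_mul]
  exact Finset.sum_congr rfl fun k _ => by ring

theorem herm_smul_right (a : E) (v w : Space E n) :
    herm c n v (a • w) = a * herm c n v w := by
  simp only [herm_apply, Finset.mul_sum, Pi.smul_apply, smul_eq_mul]
  exact Finset.sum_congr rfl fun k _ => by ring

theorem herm_zero_left (w : Space E n) : herm c n 0 w = 0 := by simp [herm_apply]

theorem herm_zero_right (w : Space E n) : herm c n w 0 = 0 := by simp [herm_apply]

theorem conj_herm (hcc : ∀ x, c (c x) = x) (v w : Space E n) :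
    c (herm c n v w) = - herm c n w v := by
  simp only [herm_apply, map_sum, map_sub, map_mul, hcc, ← Finset.sum_neg_distrib]
  exact Finset.sum_congr rfl fun k _ => by ring

theorem herm_eq_zero_symm (hcc : ∀ x, c (c x) = x) {v w : Space E n} (h : herm c n v w = 0) :
    herm c n w v = 0 := by
  have := conj_herm hcc v w
  rwa [h, map_zero, eq_comm, neg_eq_zero] at this

theorem herm_mulVec (A : Matrix (Fin n ⊕ Fin n) (Fin n ⊕ Fin n) E) (v w : Space E n) :
    herm c n (A *ᵥ v) (A *ᵥ w)
      = (fun i => c (v i)) ⬝ᵥ (((A.map c)ᵀ * Matrix.J (Fin n) E * A) *ᵥ w) := by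
  have h1 : (fun i => c ((A *ᵥ v) i)) = (fun i => c (v i)) ᵥ* (A.map c)ᵀ := by
    rw [Matrix.vecMul_transpose]
    ext i
    simp [Matrix.mulVec, dotProduct]
  rw [herm, h1, ← Matrix.dotProduct_mulVec, Matrix.mulVec_mulVec, Matrix.mulVec_mulVec,
    Matrix.mul_assoc]

theorem herm_unitary (g : U c n) (v w : Space E n) :
    herm c n (g.val.val *ᵥ v) (g.val.val *ᵥ w) = herm c n v w := by
  rw [herm_mulVec, show (g.val.val.map c)ᵀ * Matrix.J (Fin n) E * g.val.val = _ from g.property]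
  rfl

theorem unitary_of_herm {A : Matrix (Fin n ⊕ Fin n) (Fin n ⊕ Fin n) E}
    (h : ∀ v w, herm c n (A *ᵥ v) (A *ᵥ w) = herm c n v w) :
    (A.map c)ᵀ * Matrix.J (Fin n) E * A = Matrix.J (Fin n) E := by
  ext i j
  have h1 := h (Pi.single i 1) (Pi.single j 1)
  have h2 : (fun k => c ((Pi.single i 1 : Space E n) k)) = Pi.single i 1 := by
    ext k
    by_cases hk : k = i
    · subst hk
      simp
    · simp [hk]
  rw [herm_mulVec, herm, h2] at h1
  simpa using h1

/-- The element of the unitary group with a given matrix. -/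
def unitaryMk (A : Matrix (Fin n ⊕ Fin n) (Fin n ⊕ Fin n) E)
    (h : (A.map c)ᵀ * Matrix.J (Fin n) E * A = Matrix.J (Fin n) E) : U c n :=
  have h1 : (-Matrix.J (Fin n) E * ((A.map c)ᵀ * Matrix.J (Fin n) E)) * A = 1 := by
    rw [Matrix.mul_assoc, h, Matrix.neg_mul, Matrix.J_squared, neg_neg]
  ⟨⟨A, -Matrix.J (Fin n) E * ((A.map c)ᵀ * Matrix.J (Fin n) E),
    mul_eq_one_comm.1 h1, h1⟩, h⟩

theorem unitary_ext_val {g g' : U c n} (h : g.val.val = g'.val.val) : g = g' :=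
  Subtype.ext (Units.ext h)

theorem unitary_ext {g g' : U c n} (h : ∀ v, g.val.val *ᵥ v = g'.val.val *ᵥ v) : g = g' :=
  unitary_ext_val (Matrix.ext_of_mulVec_single fun _ => h _)

theorem mul_mulVec (g g' : U c n) (v : Space E n) :
    (g * g').val.val *ᵥ v = g.val.val *ᵥ (g'.val.val *ᵥ v) := by
  rw [Matrix.mulVec_mulVec]
  rfl

theorem mulVec_inv_mulVec (g : U c n) (v : Space E n) :
    g.val.val *ᵥ ((g⁻¹).val.val *ᵥ v) = v := by
  rw [← mul_mulVec, mul_inv_cancel]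
  exact Matrix.one_mulVec v

theorem unitary_inv_val (g : U c n) :
    (g⁻¹).val.val = -Matrix.J (Fin n) E * ((g.val.val.map c)ᵀ * Matrix.J (Fin n) E) := by
  have h : unitaryMk g.val.val g.property = g := unitary_ext_val rfl
  conv_lhs => rw [← h]
  rfl

/-! ### Eichler transformations -/

/-- `g` is the Eichler transformation `x ↦ x + h(e,x) y + h(y,x) e + s h(e,x) e`. -/
def IsEichler (g : U c n) (e y : Space E n) (s : E) : Prop :=
  ∀ x, g.val.val *ᵥ x
    = x + herm c n e x • y + herm c n y x • e + (s * herm c n e x) • e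

variable (c n) in
/-- The matrix of an Eichler transformation. -/
def eichlerMatrix (e y : Space E n) (s : E) : Matrix (Fin n ⊕ Fin n) (Fin n ⊕ Fin n) E :=
  let r : Space E n → Space E n := fun v => (fun i => c (v i)) ᵥ* Matrix.J (Fin n) E
  1 + Matrix.vecMulVec y (r e) + Matrix.vecMulVec e (r y) + s • Matrix.vecMulVec e (r e)

theorem eichlerMatrix_mulVec (e y : Space E n) (s : E) (x : Space E n) :
    eichlerMatrix c n e y s *ᵥ x
      = x + herm c n e x • y + herm c n y x • e + (s * herm c n e x) • e := by
  simp only [eichlerMatrix, Matrix.add_mulVec, Matrix.one_mulVec, Matrix.smul_mulVec,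
    Matrix.vecMulVec_mulVec, ← Matrix.dotProduct_mulVec, op_smul_eq_smul, smul_smul]
  rfl

theorem IsEichler.val_eq {g : U c n} {e y : Space E n} {s : E} (h : IsEichler g e y s) :
    g.val.val = eichlerMatrix c n e y s :=
  Matrix.ext_of_mulVec_single fun _ => by rw [h, eichlerMatrix_mulVec]

/-- In h(gv, gw) all cross terms cancel because e is isotropic and orthogonal to y. What remains is
c(h(e,v)) h(e,w) times h(y,y) - s + c s, so the condition on s is what makes g an isometry. -/
theorem exists_isEichler (hcc : ∀ x, c (c x) = x) {e y : Space E n} {s : E}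
    (he : herm c n e e = 0) (hey : herm c n e y = 0) (hs : s - c s = herm c n y y) :
    ∃ g : U c n, IsEichler g e y s := by
  refine ⟨unitaryMk (eichlerMatrix c n e y s) (unitary_of_herm fun v w => ?_), fun x =>
    eichlerMatrix_mulVec e y s x⟩
  have hye := herm_eq_zero_symm hcc hey
  rw [eichlerMatrix_mulVec, eichlerMatrix_mulVec]
  simp only [herm_add_left, herm_add_right, herm_smul_left, herm_smul_right, he, hey, hye, ← hs,
    map_mul, conj_herm hcc]
  ring

namespace IsEichler

variable {g g' : U c n} {e y y' : Space E n} {s s' : E}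

theorem unique (h : IsEichler g e y s) (h' : IsEichler g' e y s) : g = g' :=
  unitary_ext fun v => by rw [h, h']

theorem conj (h : IsEichler g e y s) (k : U c n) :
    IsEichler (k * g * k⁻¹) (k.val.val *ᵥ e) (k.val.val *ᵥ y) s := by
  intro x
  have h1 : ∀ v, herm c n (k.val.val *ᵥ v) x = herm c n v ((k⁻¹).val.val *ᵥ x) := by
    intro v
    rw [← herm_unitary k v, mulVec_inv_mulVec]
  rw [mul_mulVec, mul_mulVec, h, h1, h1]
  simp only [Matrix.mulVec_add, Matrix.mulVec_smul, mulVec_inv_mulVec]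

/-- For fixed e these transformations form a Heisenberg group whose centre is y = 0. The correction
h(y, y') is what transvections along e must absorb later. -/
theorem mul (hcc : ∀ x, c (c x) = x) (he : herm c n e e = 0) (hey : herm c n e y = 0)
    (hey' : herm c n e y' = 0) (h : IsEichler g e y s) (h' : IsEichler g' e y' s') :
    IsEichler (g * g') e (y + y') (s + s' + herm c n y y') := by
  intro x
  have hye := herm_eq_zero_symm hcc hey
  rw [mul_mulVec, h, h']
  simp only [herm_add_left, herm_add_right, herm_smul_right, he, hey', hye]
  ext i
  simp only [Pi.add_apply, Pi.smul_apply, smul_eq_mul]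
  ring

theorem one (e : Space E n) : IsEichler (1 : U c n) e 0 0 := by
  intro x
  simp [herm_zero_left]

theorem eq_one (h : IsEichler g e 0 0) : g = 1 := h.unique (one e)

end IsEichler

/-! ### Real vectors -/

variable (E) in
/-- The extension of scalars of a vector. -/
def ofReal (b : Fin n ⊕ Fin n → F) : Space E n := fun i => algebraMap F E (b i)

@[simp]
theorem ofReal_add (a b : Fin n ⊕ Fin n → F) : ofReal E (a + b) = ofReal E a + ofReal E b := by
  ext i
  simp [ofReal]

@[simp]
theorem ofReal_smul (t : F) (b : Fin n ⊕ Fin n → F) :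
    ofReal E (t • b) = algebraMap F E t • ofReal E b := by
  ext i
  simp [ofReal]

theorem herm_ofReal (a b : Fin n ⊕ Fin n → F) :
    herm c n (ofReal E a) (ofReal E b) = algebraMap F E (symp F (Fin n) a b) := by
  simp [herm_apply, symp_apply, ofReal]

theorem herm_ofReal_self (a : Fin n ⊕ Fin n → F) :
    herm c n (ofReal E a) (ofReal E a) = 0 := by
  rw [herm_ofReal, symp_self, map_zero]

theorem mem_Sp_of_val_eq_map {g : U c n} {A : Matrix (Fin n ⊕ Fin n) (Fin n ⊕ Fin n) F}
    (h : g.val.val = A.map (algebraMap F E)) : g ∈ Sp c n := by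
  refine ⟨A, ?_, h⟩
  rw [SymplecticGroup.mem_iff']
  have h1 : (g.val.val.map c)ᵀ * Matrix.J (Fin n) E * g.val.val = Matrix.J (Fin n) E := g.property
  have h2 : (A.map (algebraMap F E)).map c = A.map (algebraMap F E) := by
    ext i j
    simp
  have h3 : (Matrix.J (Fin n) F).map (algebraMap F E) = Matrix.J (Fin n) E :=
    Matrix.map_J ..
  rw [h, h2, ← Matrix.transpose_map, ← h3, ← Matrix.map_mul, ← Matrix.map_mul] at h1
  exact Matrix.map_injective (algebraMap F E).injective h1

/-- With y = 0 and real z and a, the transformation is a symplectic transvection over F. This is the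
only way in which the distinguishing hypothesis is used. -/
theorem IsEichler.mem_Sp {g : U c n} {z : Fin n ⊕ Fin n → F} {a : F}
    (h : IsEichler g (ofReal E z) 0 (algebraMap F E a)) : g ∈ Sp c n := by
  let A : Matrix (Fin n ⊕ Fin n) (Fin n ⊕ Fin n) F :=
    Matrix.of fun i j =>
      (Pi.single j 1 : Fin n ⊕ Fin n → F) i + a * symp F (Fin n) z (Pi.single j 1) * z i
  refine mem_Sp_of_val_eq_map (A := A) (Matrix.ext_of_mulVec_single fun j => ?_)
  have h1 : (Pi.single j 1 : Space E n) = ofReal E (Pi.single j (1 : F)) := by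
    ext i
    by_cases hi : i = j
    · subst hi
      simp [ofReal]
    · simp [ofReal, hi]
  rw [h]
  conv_lhs => rw [h1]
  rw [herm_ofReal]
  ext i
  simp [A, ofReal, herm_zero_left]

end Herm

/-! ### Topology -/

section Topology

variable {F E : Type*} [Field F] [Field E] [Algebra F E] {c : E ≃ₐ[F] E} {n : ℕ}
  [TopologicalSpace F] [IsTopologicalRing F] [TopologicalSpace E] [IsTopologicalRing E]
  [IsModuleTopology F E]

variable (c) in
theorem continuous_conj : Continuous c :=
  IsModuleTopology.continuous_of_linearMap (R := F) c.toLinearMap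

variable (F E) in
theorem continuous_algebraMap_of_moduleTopology : Continuous (algebraMap F E) :=
  IsModuleTopology.continuous_of_linearMap (Algebra.linearMap F E)

/-- On the unitary group the inverse is -J ᵗ(c g) J, so continuity of the matrix entries already
gives continuity in the unit group. -/
theorem continuous_unitary {X : Type*} [TopologicalSpace X] {f : X → U c n}
    (hf : Continuous fun x => (f x).val.val) : Continuous f := by
  refine Continuous.subtype_mk (Units.continuous_iff.2 ⟨hf, ?_⟩) _
  have h1 : ∀ x, ((f x).val⁻¹).val
      = -Matrix.J (Fin n) E * (((f x).val.val.map c)ᵀ * Matrix.J (Fin n) E) :=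
    fun x => unitary_inv_val (f x)
  have hc := continuous_conj (F := F) c
  have h2 : Continuous fun x => (f x).val.val.map c := hf.matrix_map hc
  change Continuous fun x => ((f x).val⁻¹).val
  simp only [h1]
  fun_prop

theorem continuous_eichlerMatrix {X : Type*} [TopologicalSpace X] {e y : X → Space E n} {s : X → E}
    (he : Continuous e) (hy : Continuous y) (hs : Continuous s) :
    Continuous fun x => eichlerMatrix c n (e x) (y x) (s x) := by
  have hc := continuous_conj (F := F) c
  have h1 : Continuous fun x => fun i => c (e x i) := by fun_prop
  have h2 : Continuous fun x => fun i => c (y x i) := by fun_prop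
  simp only [eichlerMatrix]
  have h3 := h1.matrix_vecMul (continuous_const (y := Matrix.J (Fin n) E))
  have h4 := h2.matrix_vecMul (continuous_const (y := Matrix.J (Fin n) E))
  exact ((continuous_const.add (hy.matrix_vecMulVec h3)).add (he.matrix_vecMulVec h4)).add
    (hs.smul (he.matrix_vecMulVec h3))

theorem continuous_ofReal : Continuous (ofReal E : (Fin n ⊕ Fin n → F) → Space E n) := by
  have := continuous_algebraMap_of_moduleTopology F E
  exact continuous_pi fun i => this.comp (continuous_apply i)

theorem IsSmooth.eventually_eq {V : Type*} [AddCommGroup V] [Module ℂ V]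
    {π : Representation ℂ (U c n) V} (hπ : IsSmooth π) {X : Type*} [TopologicalSpace X]
    {f : X → U c n} (hf : Continuous f) {x : X} (hx : f x = 1) (v : V) :
    ∀ᶠ y in 𝓝 x, π (f y) v = v := by
  obtain ⟨K, hK, hv⟩ := hπ v
  have : f ⁻¹' (K : Set (U c n)) ∈ 𝓝 x := by
    refine (hK.preimage hf).mem_nhds ?_
    rw [Set.mem_preimage, hx]
    exact one_mem K
  filter_upwards [this] with y hy
  exact hv _ hy

end Topology

/-! ### Coordinates beyond a given index -/

section Tail

variable {F : Type*} [Field F] {n : ℕ}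

/-- The indices beyond `i`. -/
abbrev Tail (n i : ℕ) : Type := {k : Fin n // i < k.val}

/-- Extension by zero of a vector supported on the indices beyond `i`. -/
def tailIncl (i : ℕ) (b : Tail n i ⊕ Tail n i → F) : Fin n ⊕ Fin n → F :=
  Sum.elim (fun k => if h : i < k.val then b (.inl ⟨k, h⟩) else 0)
    (fun k => if h : i < k.val then b (.inr ⟨k, h⟩) else 0)

theorem tailIncl_inl {i : ℕ} (b : Tail n i ⊕ Tail n i → F) {k : Fin n} (hk : k.val ≤ i) :
    tailIncl i b (.inl k) = 0 := by
  simp [tailIncl, not_lt.2 hk]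

theorem tailIncl_inr {i : ℕ} (b : Tail n i ⊕ Tail n i → F) {k : Fin n} (hk : k.val ≤ i) :
    tailIncl i b (.inr k) = 0 := by
  simp [tailIncl, not_lt.2 hk]

theorem tailIncl_add (i : ℕ) (b b' : Tail n i ⊕ Tail n i → F) :
    tailIncl i (b + b') = tailIncl i b + tailIncl i b' := by
  ext (k | k) <;> by_cases hk : i < k.val <;> simp [tailIncl, hk]

theorem tailIncl_smul (i : ℕ) (a : F) (b : Tail n i ⊕ Tail n i → F) :
    tailIncl i (a • b) = a • tailIncl i b := by
  ext (k | k) <;> by_cases hk : i < k.val <;> simp [tailIncl, hk]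

theorem tailIncl_zero (i : ℕ) : tailIncl i (0 : Tail n i ⊕ Tail n i → F) = 0 := by
  ext (k | k) <;> simp [tailIncl]

theorem exists_tailIncl_eq {i : ℕ} {z : Fin n ⊕ Fin n → F} (h : ∀ k : Fin n, k.val ≤ i → z (.inl k) = 0)
    (h' : ∀ k : Fin n, k.val ≤ i → z (.inr k) = 0) :
    tailIncl i (fun k => Sum.elim (fun k => z (.inl k.val)) (fun k => z (.inr k.val)) k) = z := by
  ext (k | k) <;> by_cases hk : i < k.val
  · simp [tailIncl, hk]
  · simp [tailIncl, hk, h k (not_lt.1 hk)]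
  · simp [tailIncl, hk]
  · simp [tailIncl, hk, h' k (not_lt.1 hk)]

theorem symp_tailIncl (i : ℕ) (b b' : Tail n i ⊕ Tail n i → F) :
    symp F (Fin n) (tailIncl i b) (tailIncl i b') = symp F (Tail n i) b b' := by
  rw [symp_apply, symp_apply]
  have h1 : ∀ k : Tail n i, b (.inr k) * b' (.inl k) - b (.inl k) * b' (.inr k)
      = (fun k : Fin n => tailIncl i b (.inr k) * tailIncl i b' (.inl k)
        - tailIncl i b (.inl k) * tailIncl i b' (.inr k)) k.val := by
    rintro ⟨k, hk⟩
    simp [tailIncl, hk]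
  rw [Fintype.sum_congr _ _ h1, ← Finset.sum_subtype (Finset.univ.filter fun k : Fin n => i < k.val)
    (by simp) (fun k : Fin n => tailIncl i b (.inr k) * tailIncl i b' (.inl k)
        - tailIncl i b (.inl k) * tailIncl i b' (.inr k)), Finset.sum_filter]
  refine Finset.sum_congr rfl fun k _ => ?_
  split_ifs with hk
  · rfl
  · rw [tailIncl_inl b (not_lt.1 hk), tailIncl_inr b (not_lt.1 hk)]
    simp

theorem continuous_tailIncl [TopologicalSpace F] (i : ℕ) :
    Continuous (tailIncl i : (Tail n i ⊕ Tail n i → F) → Fin n ⊕ Fin n → F) := by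
  refine continuous_pi ?_
  rintro (k | k) <;> by_cases hk : i < k.val <;> simp only [tailIncl, hk, Sum.elim_inl,
    Sum.elim_inr, dif_pos, dif_neg, not_false_iff] <;> fun_prop

end Tail

/-! ### Passing from an Sp-invariant functional to later stages -/

section Stage

variable {F E : Type*} [Field F] [Field E] [Algebra F E] {c : E ≃ₐ[F] E} {n : ℕ}
  {V : Type*} [AddCommGroup V] [Module ℂ V]

/-- A nonzero functional on a representation of the unitary group that is invariant under the
transvections in all directions beyond the `i`-th isotropic basis vector, and under suitable Eichler
transformations attached to the previous ones. -/
structure IsStage (π : Representation ℂ (U c n) V) (ℓ : V →ₗ[ℂ] ℂ) (i : ℕ) : Prop where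
  ne_zero : ℓ ≠ 0
  transvection : ∀ z : Fin n ⊕ Fin n → F, (∀ k, k.val < i → z (.inl k) = 0) →
    (∀ k, k.val ≤ i → z (.inr k) = 0) → ∀ (a : F) (g : U c n),
    IsEichler g (ofReal E z) 0 (algebraMap F E a) → ∀ v, ℓ (π g v) = ℓ v
  -- The parameter y must avoid f_{j+1} as well as f_k for k ≤ j: leaving stage j localizes at the
  -- frequency e_{j+1}, and only parameters orthogonal to it survive.
  eichler : ∀ j : Fin n, j.val < i → ∀ y : Space E n, (∀ k, k ≤ j → y (.inl k) = 0) →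
    (∀ k : Fin n, k.val ≤ j.val + 1 → y (.inr k) = 0) → ∀ (s : E) (g : U c n),
    s - c s = herm c n y y → IsEichler g (ofReal E (Pi.single (.inl j) (1 : F))) y s →
    ∀ v, ℓ (π g v) = ℓ v

theorem exists_isStage_zero {π : Representation ℂ (U c n) V} (h : IsDistinguished π (Sp c n)) :
    ∃ ℓ, IsStage π ℓ 0 := by
  obtain ⟨ℓ, hℓ, hinv⟩ := h
  exact ⟨ℓ, hℓ, fun z _ _ a g hg v => hinv g hg.mem_Sp v, fun j hj => absurd hj (Nat.not_lt_zero _)⟩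

variable {π : Representation ℂ (U c n) V} {ℓ : V →ₗ[ℂ] ℂ} {i : Fin n}

theorem herm_single_inl (i : Fin n) (x : Space E n) :
    herm c n (ofReal E (Pi.single (.inl i) (1 : F))) x = - x (.inr i) := by
  rw [herm_apply, Finset.sum_eq_single i]
  · simp [ofReal]
  · intro j _ hj
    simp [ofReal, hj]
  · simp

variable [Algebra.IsQuadraticExtension F E]

/-- Central elements act trivially: an Eichler transformation acts on the functional independently
of the central coordinate. -/
theorem IsStage.eichler_center (hc : c ≠ AlgEquiv.refl) (h : IsStage π ℓ i) {y : Space E n}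
    {s s' : E} {g g' : U c n} (hy : y (.inr i) = 0)
    (hs : s - c s = herm c n y y) (hs' : s' - c s' = herm c n y y)
    (hg : IsEichler g (ofReal E (Pi.single (.inl i) (1 : F))) y s)
    (hg' : IsEichler g' (ofReal E (Pi.single (.inl i) (1 : F))) y s') (v : V) :
    ℓ (π g v) = ℓ (π g' v) := by
  have hcc := conj_conj hc
  -- The two transformations differ by a central one whose coordinate is fixed by c, that is, by a
  -- transvection along e_i.
  obtain ⟨a, ha⟩ : ∃ a, s - s' = algebraMap F E a := by
    refine conj_fixed hc ?_
    rw [map_sub]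
    linear_combination hs' - hs
  have he : herm c n (ofReal E (Pi.single (.inl i) (1 : F)))
      (ofReal E (Pi.single (.inl i) (1 : F))) = 0 := herm_ofReal_self _
  obtain ⟨τ, hτ⟩ := exists_isEichler hcc (s := algebraMap F E a) he
    (herm_zero_right _) (by simp [herm_zero_left])
  have h1 := hτ.mul hcc he (herm_zero_right _) (by rw [herm_single_inl, hy, neg_zero]) hg'
  rw [zero_add, herm_zero_left, add_zero, ← ha, sub_add_cancel] at h1
  rw [hg.unique h1, map_mul, Module.End.mul_apply]
  refine h.transvection _ (fun k hk => ?_) (fun k _ => by simp) a τ hτ _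
  have hk' : k ≠ i := fun hki => by simp [hki] at hk
  simp [hk']

/-- A real Eichler transformation is a quotient of transvections: that along e + α equals the
Eichler transformation with parameters (e, α, 1) times the transvection along α. The central
coordinate is then adjusted freely. -/
theorem IsStage.eichler_real (hc : c ≠ AlgEquiv.refl) (h : IsStage π ℓ i)
    {α : Fin n ⊕ Fin n → F} (hl : ∀ k, k ≤ i → α (.inl k) = 0) (hr : ∀ k, k ≤ i → α (.inr k) = 0)
    {s : E} {g : U c n} (hs : s - c s = 0)
    (hg : IsEichler g (ofReal E (Pi.single (.inl i) (1 : F))) (ofReal E α) s) (v : V) :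
    ℓ (π g v) = ℓ v := by
  have hcc := conj_conj hc
  set e : Fin n ⊕ Fin n → F := Pi.single (.inl i) 1 with he_def
  have he : herm c n (ofReal E e) (ofReal E e) = 0 := herm_ofReal_self _
  have heα : herm c n (ofReal E e) (ofReal E α) = 0 := by
    rw [he_def, herm_single_inl]
    simp [ofReal, hr i le_rfl]
  have hαα : herm c n (ofReal E α) (ofReal E α) = 0 := herm_ofReal_self _
  have hαe := herm_eq_zero_symm hcc heα
  obtain ⟨r, hr'⟩ := exists_isEichler hcc (s := algebraMap F E 1) he heα (by simp [hαα])
  obtain ⟨τ₁, hτ₁⟩ := exists_isEichler (c := c) (e := ofReal E (e + α)) (y := 0)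
    (s := algebraMap F E 1) hcc (herm_ofReal_self _) (herm_zero_right _) (by simp [herm_zero_left])
  obtain ⟨τ₂, hτ₂⟩ := exists_isEichler (c := c) (e := ofReal E α) (y := 0)
    (s := algebraMap F E 1) hcc (herm_ofReal_self _) (herm_zero_right _) (by simp [herm_zero_left])
  have h1 : τ₁ = r * τ₂ := by
    refine unitary_ext fun x => ?_
    rw [mul_mulVec, hτ₁, hτ₂, hr']
    simp only [ofReal_add, herm_add_left, herm_add_right, herm_smul_right, heα, hαα, herm_zero_left, herm_zero_right]
    ext k
    simp only [Pi.add_apply, Pi.smul_apply, smul_eq_mul, map_one, Pi.zero_apply]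
    ring
  have hi1 : ∀ w, ℓ (π τ₁ w) = ℓ w := fun w => by
    refine h.transvection (e + α) (fun k hk => ?_) (fun k hk => ?_) 1 τ₁ hτ₁ w
    · have hk' : k ≠ i := fun hki => by simp [hki] at hk
      simp [he_def, hk', hl k (le_of_lt hk)]
    · simp [he_def, hr k hk]
  have hi2 : ∀ w, ℓ (π τ₂ w) = ℓ w := fun w =>
    h.transvection α (fun k hk => hl k (le_of_lt hk)) (fun k hk => hr k hk) 1 τ₂ hτ₂ w
  have h2 : ∀ w, ℓ (π r w) = ℓ w := by
    intro w
    have h3 : π r w = π τ₁ (π τ₂⁻¹ w) := by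
      rw [h1, map_mul, Module.End.mul_apply, Representation.self_inv_apply]
    rw [h3, hi1, ← hi2, Representation.self_inv_apply]
  rw [h.eichler_center hc (by simp [ofReal, hr i le_rfl]) (by rw [hs, hαα]) (by simp [hαα]) hg hr',
    h2]

/-- `exists_functional` is applied to the symplectic space of indices beyond i, with translations
u_b = Eichler(e_i, εb, 0) and frequency ξ = e_{i+1}. -/
theorem IsStage.exists_succ [ValuativeRel F] [TopologicalSpace F] [IsNonarchimedeanLocalField F]
    [TopologicalSpace E] [IsTopologicalRing E] [IsModuleTopology F E]
    (hc : c ≠ AlgEquiv.refl) (hπ : IsSmooth π) (h : IsStage π ℓ i) (hi : i.val + 1 < n) :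
    ∃ ℓ', IsStage π ℓ' (i.val + 1) := by
  have hcc := conj_conj hc
  obtain ⟨ε, hε⟩ := exists_conj_ne hc
  set e : Fin n ⊕ Fin n → F := Pi.single (.inl i) 1 with he_def
  have he : herm c n (ofReal E e) (ofReal E e) = 0 := herm_ofReal_self _
  have heb : ∀ b : Tail n i ⊕ Tail n i → F, herm c n (ofReal E e) (ofReal E (tailIncl i b)) = 0 := by
    intro b
    rw [he_def, herm_single_inl]
    simp [ofReal, tailIncl_inr b le_rfl]
  have hbe := fun b => herm_eq_zero_symm hcc (heb b)
  -- Central coordinate 0 is allowed because εb is isotropic for real b.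
  choose uu hu using fun b : Tail n i ⊕ Tail n i → F =>
    exists_isEichler hcc (e := ofReal E e) (y := ε • ofReal E (tailIncl i b)) (s := 0) he
      (by rw [herm_smul_right, heb, mul_zero])
      (by rw [herm_smul_left, herm_smul_right, herm_ofReal_self]; simp)
  choose t ht using fun (z : Tail n i ⊕ Tail n i → F) (a : F) =>
    exists_isEichler hcc (c := c) (e := ofReal E (tailIncl i z)) (y := 0) (s := algebraMap F E a)
      (herm_ofReal_self _) (herm_zero_right _) (by simp [herm_zero_left])
  have hℓt : ∀ z a v, ℓ (π (t z a) v) = ℓ v := fun z a v =>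
    h.transvection _ (fun k hk => tailIncl_inl z (le_of_lt hk)) (fun k hk => tailIncl_inr z hk) a _
      (ht z a) v
  have hy0 : ∀ b : Tail n i ⊕ Tail n i → F, (ε • ofReal E (tailIncl i b)) (.inr i) = 0 := by
    intro b
    simp [ofReal, tailIncl_inr b le_rfl]
  have hey : ∀ b : Tail n i ⊕ Tail n i → F, herm c n (ofReal E e) (ε • ofReal E (tailIncl i b)) = 0 := fun b => by
    rw [herm_smul_right, heb, mul_zero]
  have hyy : ∀ b b' : Tail n i ⊕ Tail n i → F, herm c n (ε • ofReal E (tailIncl i b)) (ε • ofReal E (tailIncl i b'))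
      = ε * c ε * algebraMap F E (symp F _ b b') := fun b b' => by
    rw [herm_smul_left, herm_smul_right, herm_ofReal, symp_tailIncl]
    ring
  obtain ⟨N, hN⟩ := exists_norm hc ε
  let ξ : Tail n i ⊕ Tail n i → F := Pi.single (.inl ⟨⟨i.val + 1, hi⟩, Nat.lt_succ_self _⟩) 1
  have hsympξ : ∀ b, symp F _ ξ b = - b (.inr ⟨⟨i.val + 1, hi⟩, Nat.lt_succ_self _⟩) := fun b =>
    symp_single_inl _ _
  -- The Heisenberg correction is ε c(ε)⟨b,b'⟩, which lies in F and is therefore invisible to ℓ.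
  have hF1 : ∀ b b' v, ℓ (π (uu b) (π (uu b') v)) = ℓ (π (uu (b + b')) v) := by
    intro b b' v
    have h1 := (hu b).mul hcc he (hey b) (hey b') (hu b')
    rw [← smul_add, ← ofReal_add, ← tailIncl_add] at h1
    change ℓ (π (uu b) (π (uu b') v)) = ℓ (π (uu (b + b')) v)
    rw [← Module.End.mul_apply, ← map_mul]
    refine h.eichler_center hc (hy0 _) ?_ ?_ h1 (hu _) v
    · rw [hyy, hyy, hN, symp_self, zero_add, zero_add, map_mul, AlgEquiv.commutes, AlgEquiv.commutes]
      simp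
    · rw [hyy, symp_self]
      simp
  -- Conjugating by the transvection moves it to the far left, where ℓ absorbs it, at the cost of
  -- applying its inverse to b.
  have hF2 : ∀ z a b v, ℓ (π (uu b) (π (t z a) v)) = ℓ (π (uu (b - (a * symp F _ z b) • z)) v) := by
    intro z a b v
    have h1 := (hu (b - (a * symp F _ z b) • z)).conj (t z a)
    have h2 : (t z a).val.val *ᵥ ofReal E e = ofReal E e := by
      rw [ht, hbe]
      simp [herm_zero_left]
    have h3 : (t z a).val.val *ᵥ (ε • ofReal E (tailIncl i (b - (a * symp F _ z b) • z)))
        = ε • ofReal E (tailIncl i b) := by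
      rw [Matrix.mulVec_smul, ht, herm_ofReal, symp_tailIncl, herm_zero_left, sub_eq_add_neg,
        ← neg_smul, tailIncl_add, tailIncl_smul, ofReal_add, ofReal_smul]
      simp [symp_self]
    rw [h2, h3] at h1
    have h4 := h1.unique (hu b)
    change ℓ (π (uu b) (π (t z a) v)) = ℓ (π (uu _) v)
    rw [← h4, ← Module.End.mul_apply, ← map_mul, inv_mul_cancel_right, map_mul,
      Module.End.mul_apply, hℓt]
  have hF3 : ∀ v, ∀ᶠ b in 𝓝 0, π (uu b) v = v := by
    intro v
    refine hπ.eventually_eq (f := uu) ?_ ?_ v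
    · refine continuous_unitary (F := F) ?_
      simp only [fun b => (hu b).val_eq]
      have h1 : Continuous fun b : Tail n i ⊕ Tail n i → F => ofReal E (tailIncl i b) :=
        continuous_ofReal.comp (continuous_tailIncl _)
      exact continuous_eichlerMatrix (F := F) continuous_const (h1.const_smul ε) continuous_const
    · have := hu 0
      rw [tailIncl_zero, show ofReal E (0 : Fin n ⊕ Fin n → F) = 0 by ext k; simp [ofReal],
        smul_zero] at this
      exact this.eq_one
  have hF4 : ∀ z v, ∀ᶠ a in 𝓝 (0 : F), π (t z a) v = v := by
    intro z v
    refine hπ.eventually_eq (f := t z) ?_ ?_ v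
    · refine continuous_unitary (F := F) ?_
      simp only [fun a => (ht z a).val_eq]
      exact continuous_eichlerMatrix (F := F) continuous_const continuous_const
        (continuous_algebraMap_of_moduleTopology F E)
    · have := ht z 0
      rw [map_zero] at this
      exact this.eq_one
  obtain ⟨ℓ', hne, hℓu, hℓτ, hℓq⟩ := exists_functional ℓ (fun b => π (uu b))
    (fun z a => π (t z a)) (ξ := ξ) hF1 hF2 hF3 hF4 h.ne_zero (by simp [ξ])
  refine ⟨ℓ', hne, ?_, ?_⟩
  · intro z hzl hzr a g hg v
    have hz := exists_tailIncl_eq (i := i) (z := z) (fun k hk => hzl k (Nat.lt_succ_of_le hk))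
      (fun k hk => hzr k (hk.trans (Nat.le_succ _)))
    rw [← hz] at hg
    rw [hg.unique (ht _ a)]
    refine hℓτ _ a v ?_
    rw [hsympξ]
    simp [hzr]
  · intro j hj y hyl hyr s g hs hg v
    rcases Nat.lt_succ_iff_lt_or_eq.1 hj with hj | hj
    · refine hℓq (π g) (fun b v => ?_) v
      -- The earlier Eichler transformations are normalized by u_b: e_j is fixed, and the vanishing
      -- conditions on y persist because u_b changes y only in indices at least i > j. So they fix
      -- every translate of ℓ.
      have h1 := hg.conj (uu b)
      have hij : j ≠ i := fun hji => by simp [hji] at hj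
      have h2 : (uu b).val.val *ᵥ ofReal E (Pi.single (.inl j) (1 : F))
          = ofReal E (Pi.single (.inl j) (1 : F)) := by
        rw [hu b, he_def, herm_single_inl, herm_smul_left]
        have h3 : herm c n (ofReal E (tailIncl i b)) (ofReal E (Pi.single (.inl j) (1 : F))) = 0 := by
          refine herm_eq_zero_symm hcc ?_
          rw [herm_single_inl]
          simp [ofReal, tailIncl_inr b (le_of_lt hj)]
        rw [h3]
        simp [ofReal]
      rw [h2] at h1
      have h4 := fun w => h.eichler j hj _ ?_ ?_ s _ ?_ h1 w
      · rw [← Module.End.mul_apply, ← map_mul, show uu b * g = (uu b * g * (uu b)⁻¹) * uu b by group,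
          map_mul, Module.End.mul_apply, h4]
      · intro k hk
        have hki : k.val < i.val := lt_of_le_of_lt hk hj
        have hki' : k ≠ i := fun h => by simp [h] at hki
        rw [hu b]
        simp [hyl k hk, ofReal, tailIncl_inl b (le_of_lt hki), he_def, hki']
      · intro k hk
        rw [hu b]
        simp [hyr k hk, ofReal, tailIncl_inr b (hk.trans hj), he_def]
      · rw [herm_unitary, hs]
    · have hji : j = i := Fin.ext hj
      subst hji
      -- For j = i write y = a + εb. The real part fixes all translates of ℓ, and u_b fixes ℓ'
      -- because b has no f_{i+1} component, that is, ⟨ξ,b⟩ = 0.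
      set a : Fin n ⊕ Fin n → F := fun k => (quadraticBasis hε).equivFun (y k) 0 with ha
      set b : Fin n ⊕ Fin n → F := fun k => (quadraticBasis hε).equivFun (y k) 1 with hb
      have hyab : y = ofReal E a + ε • ofReal E b := by
        ext k
        exact quadraticBasis_sum hε (y k)
      have hbl : ∀ k, k ≤ j → b (.inl k) = 0 := fun k hk => by simp [hb, hyl k hk]
      have hbr : ∀ k : Fin n, k.val ≤ j.val + 1 → b (.inr k) = 0 :=
        fun k hk => by simp [hb, hyr k hk]
      have hal : ∀ k, k ≤ j → a (.inl k) = 0 := fun k hk => by simp [ha, hyl k hk]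
      have har : ∀ k : Fin n, k.val ≤ j.val + 1 → a (.inr k) = 0 :=
        fun k hk => by simp [ha, hyr k hk]
      have hbt := exists_tailIncl_eq (i := j) (z := b) (fun k hk => hbl k hk)
        (fun k hk => hbr k (hk.trans (Nat.le_succ _)))
      set β : Tail n j ⊕ Tail n j → F :=
        fun k => Sum.elim (fun k => b (.inl k.val)) (fun k => b (.inr k.val)) k with hβ
      have hea : herm c n (ofReal E e) (ofReal E a) = 0 := by
        rw [he_def, herm_single_inl]
        simp [ofReal, har j (Nat.le_succ _)]
      -- The central coordinate is lowered by the Heisenberg correction h(a, εb), so that ρ u_β has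
      -- parameters exactly (y, s).
      set s₀ := s - herm c n (ofReal E a) (ε • ofReal E b) with hs₀
      have hs0 : s₀ - c s₀ = 0 := by
        rw [hyab, herm_add_left, herm_add_right, herm_add_right, herm_ofReal_self,
          herm_smul_left ε _ (ε • _), herm_smul_right ε (ofReal E b) (ofReal E b),
          herm_ofReal_self] at hs
        rw [hs₀, map_sub, conj_herm hcc]
        linear_combination hs
      obtain ⟨ρ, hρ⟩ := exists_isEichler hcc (s := s₀) he hea (by rw [hs0, herm_ofReal_self])
      have h1 := hρ.mul hcc he hea (hey β) (hu β)
      rw [hbt, ← hyab, hs₀, add_zero, sub_add_cancel] at h1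
      rw [hg.unique h1, map_mul, Module.End.mul_apply]
      rw [hℓq (π ρ) (fun b' w => ?_), hℓu β v ?_]
      · rw [hsympξ]
        simp [hβ, hbr]
      -- The products ρ u_{b'} and u_{b'} ρ differ only in the centre, so ρ can be moved next to ℓ.
      · have h2 := (hu b').mul hcc he (hey b') hea hρ
        have h3 := hρ.mul hcc he hea (hey b') (hu b')
        rw [add_comm (ofReal E a)] at h3
        have hc0 : c s₀ = s₀ := (sub_eq_zero.1 hs0).symm
        have h4 := h.eichler_center hc (by simp [ofReal, tailIncl_inr b' le_rfl,
          har j (Nat.le_succ _)]) ?_ ?_ h2 h3 w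
        · rw [map_mul, map_mul, Module.End.mul_apply, Module.End.mul_apply] at h4
          rw [h4]
          exact h.eichler_real hc hal (fun k hk => har k (le_trans hk (Nat.le_succ _))) hs0 hρ _
        all_goals
          simp only [map_add, map_zero, hc0, conj_herm hcc, herm_add_left, herm_add_right,
            herm_ofReal_self, hyy, symp_self]
          ring

theorem exists_isStage [ValuativeRel F] [TopologicalSpace F] [IsNonarchimedeanLocalField F]
    [TopologicalSpace E] [IsTopologicalRing E] [IsModuleTopology F E]
    (hc : c ≠ AlgEquiv.refl) (hπ : IsSmooth π) (hd : IsDistinguished π (Sp c n)) :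
    ∀ i : ℕ, i < n → ∃ ℓ, IsStage π ℓ i
  | 0, _ => exists_isStage_zero hd
  | i + 1, hi => by
    obtain ⟨ℓ, hℓ⟩ := exists_isStage hc hπ hd i (by omega)
    exact IsStage.exists_succ (i := ⟨i, by omega⟩) hc hπ hℓ hi

end Stage

/-! ### Block matrices in the unitary group -/

section Blocks

variable {F E : Type*} [Field F] [Field E] [Algebra F E] {c : E ≃ₐ[F] E} {n : ℕ}

theorem map_conj_one : (1 : Matrix (Fin n) (Fin n) E).map c = 1 :=
  Matrix.map_one _ (map_zero c) (map_one c)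

theorem blocks_unitary {A B C D : Matrix (Fin n) (Fin n) E}
    (h₁₁ : (C.map c)ᵀ * A = (A.map c)ᵀ * C) (h₁₂ : (C.map c)ᵀ * B - (A.map c)ᵀ * D = -1)
    (h₂₁ : (D.map c)ᵀ * A - (B.map c)ᵀ * C = 1) (h₂₂ : (D.map c)ᵀ * B = (B.map c)ᵀ * D) :
    ((Matrix.fromBlocks A B C D).map c)ᵀ * Matrix.J (Fin n) E * Matrix.fromBlocks A B C D
      = Matrix.J (Fin n) E := by
  rw [Matrix.fromBlocks_map, Matrix.fromBlocks_transpose, Matrix.J, Matrix.fromBlocks_multiply,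
    Matrix.fromBlocks_multiply]
  congr 1
  · simp [h₁₁]
  · refine Eq.trans ?_ h₁₂
    simp [sub_eq_add_neg]
  · refine Eq.trans ?_ h₂₁
    simp [sub_eq_add_neg]
  · simp [h₂₂]

theorem unitary_val_fromBlocks (g : U c n) : g.val.val = Matrix.fromBlocks g.val.val.toBlocks₁₁
    g.val.val.toBlocks₁₂ g.val.val.toBlocks₂₁ g.val.val.toBlocks₂₂ :=
  (Matrix.fromBlocks_toBlocks _).symm

theorem unitary_inv_blocks (g : U c n) :
    (g⁻¹).val.val = Matrix.fromBlocks (g.val.val.toBlocks₂₂.map c)ᵀ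
      (-(g.val.val.toBlocks₁₂.map c)ᵀ) (-(g.val.val.toBlocks₂₁.map c)ᵀ)
      (g.val.val.toBlocks₁₁.map c)ᵀ := by
  rw [unitary_inv_val]
  conv_lhs => rw [unitary_val_fromBlocks g]
  rw [Matrix.fromBlocks_map, Matrix.fromBlocks_transpose, Matrix.J, Matrix.fromBlocks_neg,
    Matrix.fromBlocks_multiply, Matrix.fromBlocks_multiply]
  simp

theorem mem_siegelParabolic {g : U c n} :
    g ∈ siegelParabolic c n ↔ g.val.val.toBlocks₂₁ = 0 := by
  refine ⟨fun h => h.1, fun h => ⟨h, ?_⟩⟩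
  rw [unitary_inv_blocks, Matrix.toBlocks_fromBlocks₂₁, h]
  simp

/-- The unipotent element of the Siegel parabolic attached to a hermitian matrix. -/
def upperU (X : Matrix (Fin n) (Fin n) E) (hX : (X.map c)ᵀ = X) : U c n :=
  unitaryMk (Matrix.fromBlocks 1 X 0 1) (by
    apply blocks_unitary <;> simp [hX])

/-- The opposite unipotent element attached to a hermitian matrix. -/
def lowerU (S : Matrix (Fin n) (Fin n) E) (hS : (S.map c)ᵀ = S) : U c n :=
  unitaryMk (Matrix.fromBlocks 1 0 S 1) (by
    apply blocks_unitary <;> simp [hS])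

theorem map_conj_mul_inv (a : GL (Fin n) E) :
    (((a⁻¹).val.map c)ᵀ.map c)ᵀ = ((a⁻¹).val.map c).map c := by
  rw [Matrix.transpose_map, Matrix.transpose_transpose]

/-- The element of the Levi subgroup of the Siegel parabolic attached to `a ∈ GLₙ(E)`. -/
def leviU (hcc : ∀ x, c (c x) = x) (a : GL (Fin n) E) : U c n :=
  unitaryMk (Matrix.fromBlocks a.val 0 0 ((a⁻¹).val.map c)ᵀ) (by
    have h1 : ((((a⁻¹).val.map c)ᵀ).map c)ᵀ = (a⁻¹).val := by
      rw [map_conj_mul_inv]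
      ext i j
      simp [hcc]
    have h2 : (a.val.map c)ᵀ * ((a⁻¹).val.map c)ᵀ = 1 := by
      rw [← Matrix.transpose_mul, ← Matrix.map_mul, Units.inv_mul, map_conj_one,
        Matrix.transpose_one]
    apply blocks_unitary
    · simp
    · simpa using h2
    · rw [h1]
      simp
    · simp)

theorem leviU_mem (hcc : ∀ x, c (c x) = x) (a : GL (Fin n) E) :
    leviU hcc a ∈ siegelParabolic c n := by
  rw [mem_siegelParabolic]
  exact Matrix.toBlocks_fromBlocks₂₁ ..

theorem leviU_mul (hcc : ∀ x, c (c x) = x) (a b : GL (Fin n) E) :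
    leviU hcc (a * b) = leviU hcc a * leviU hcc b := by
  apply unitary_ext_val
  change Matrix.fromBlocks (a * b).val 0 0 (((a * b)⁻¹).val.map c)ᵀ
    = Matrix.fromBlocks a.val 0 0 ((a⁻¹).val.map c)ᵀ
      * Matrix.fromBlocks b.val 0 0 ((b⁻¹).val.map c)ᵀ
  rw [Matrix.fromBlocks_multiply, mul_inv_rev, Units.val_mul, Units.val_mul, Matrix.map_mul,
    Matrix.transpose_mul]
  simp

theorem leviU_one (hcc : ∀ x, c (c x) = x) : leviU hcc (1 : GL (Fin n) E) = 1 := by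
  apply unitary_ext_val
  change Matrix.fromBlocks (1 : GL (Fin n) E).val 0 0 (((1 : GL (Fin n) E)⁻¹).val.map c)ᵀ = 1
  rw [inv_one, Units.val_one, map_conj_one, Matrix.transpose_one, Matrix.fromBlocks_one]

/-- A unipotent element of the Siegel parabolic: an element with blocks `[[1, X], [0, 1]]`. -/
def IsSiegelUnipotent (g : U c n) : Prop :=
  g.val.val.toBlocks₁₁ = 1 ∧ g.val.val.toBlocks₂₁ = 0

theorem IsSiegelUnipotent.exists_upperU {g : U c n} (hg : IsSiegelUnipotent g) :
    ∃ (X : Matrix (Fin n) (Fin n) E) (hX : (X.map c)ᵀ = X), g = upperU X hX := by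
  have h1 : (g * g⁻¹).val.val = 1 := by rw [mul_inv_cancel]; rfl
  have h2 : (g * g⁻¹).val.val = g.val.val * (g⁻¹).val.val := rfl
  have h3 : g.val.val = Matrix.fromBlocks 1 g.val.val.toBlocks₁₂ 0 g.val.val.toBlocks₂₂ := by
    conv_lhs => rw [unitary_val_fromBlocks g, hg.1, hg.2]
  rw [h2, unitary_inv_blocks, hg.1, hg.2] at h1
  conv_lhs at h1 => rw [h3]
  rw [Matrix.fromBlocks_multiply, ← Matrix.fromBlocks_one, Matrix.fromBlocks_inj] at h1
  obtain ⟨-, h12, -, h22⟩ := h1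
  rw [map_conj_one, Matrix.transpose_one, mul_one, one_mul, neg_add_eq_sub, sub_eq_zero] at h12
  rw [map_conj_one, Matrix.transpose_one, mul_one, zero_mul, zero_add] at h22
  refine ⟨g.val.val.toBlocks₁₂, h12.symm, unitary_ext_val ?_⟩
  conv_lhs => rw [h3, h22]
  rfl

end Blocks

/-! ### The functional is invariant under the Siegel unipotent radical -/

section Invariance

variable {F E : Type*} [Field F] [Field E] [Algebra F E] {c : E ≃ₐ[F] E} {n : ℕ}
  [Algebra.IsQuadraticExtension F E]
  {V : Type*} [AddCommGroup V] [Module ℂ V] {π : Representation ℂ (U c n) V} {ℓ : V →ₗ[ℂ] ℂ}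

theorem upperU_mulVec (X : Matrix (Fin n) (Fin n) E) (hX : (X.map c)ᵀ = X) (x : Space E n) :
    (upperU X hX).val.val *ᵥ x = x + Sum.elim (X *ᵥ fun k => x (.inr k)) 0 := by
  change Matrix.fromBlocks 1 X 0 1 *ᵥ x = _
  rw [Matrix.fromBlocks_mulVec]
  ext (k | k) <;> simp [Function.comp_def]

theorem map_single (i j : Fin n) (t : E) :
    (Matrix.single i j t).map c = Matrix.single i j (c t) :=
  Matrix.map_single ..

/-- The hermitian matrices whose unipotent elements fix the functional. -/
def fixingMatrices (π : Representation ℂ (U c n) V) (ℓ : V →ₗ[ℂ] ℂ) :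
    AddSubmonoid (Matrix (Fin n) (Fin n) E) where
  carrier := {X | ∃ hX : (X.map c)ᵀ = X, ∀ v, ℓ (π (upperU X hX) v) = ℓ v}
  zero_mem' := by
    refine ⟨by simp, fun v => ?_⟩
    have : upperU (0 : Matrix (Fin n) (Fin n) E) (by simp) = (1 : U c n) :=
      unitary_ext_val Matrix.fromBlocks_one
    rw [this, map_one, Module.End.one_apply]
  add_mem' := by
    rintro X Y ⟨hX, hX'⟩ ⟨hY, hY'⟩
    have hXY : ((X + Y).map c)ᵀ = X + Y := by
      rw [Matrix.map_add _ (map_add c), Matrix.transpose_add, hX, hY]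
    refine ⟨hXY, fun v => ?_⟩
    have : upperU (X + Y) hXY = upperU X hX * upperU Y hY := by
      apply unitary_ext_val
      change Matrix.fromBlocks 1 (X + Y) 0 1
        = Matrix.fromBlocks 1 X 0 1 * Matrix.fromBlocks 1 Y 0 1
      rw [Matrix.fromBlocks_multiply]
      simp [add_comm]
    rw [this, map_mul, Module.End.mul_apply, hX', hY']

theorem IsStage.diagonal_mem (h : IsStage π ℓ (n - 1)) (j : Fin n) {t : E} (ht : c t = t)
    (hc : c ≠ AlgEquiv.refl) :
    Matrix.single j j t ∈ fixingMatrices π ℓ := by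
  have hX : ((Matrix.single j j t).map c)ᵀ = Matrix.single j j t := by
    rw [map_single, ht, Matrix.transpose_single]
  refine ⟨hX, fun v => ?_⟩
  obtain ⟨a, rfl⟩ := conj_fixed hc ht
  have hE : IsEichler (upperU _ hX) (ofReal E (Pi.single (.inl j) (1 : F))) 0
      (algebraMap F E (-a)) := by
    intro x
    rw [upperU_mulVec, herm_single_inl, herm_zero_left, smul_zero, zero_smul, add_zero, add_zero,
      Matrix.single_mulVec]
    congr 1
    ext (k | k)
    · by_cases hk : k = j
      · subst hk
        simp [ofReal]
      · simp [ofReal, hk]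
    · simp [ofReal]
  -- The last index has no Eichler invariance at stage n - 1; there the transvections along e_{n-1}
  -- take over.
  by_cases hj : j.val < n - 1
  · exact h.eichler j hj 0 (fun _ _ => rfl) (fun _ _ => rfl) _ _ (by simp [herm_zero_left]) hE v
  · refine h.transvection _ (fun k hk => ?_) (fun k _ => by simp) (-a) _ hE v
    have : k ≠ j := fun hkj => by
      subst hkj
      exact hj hk
    simp [this]

theorem IsStage.offDiagonal_mem (h : IsStage π ℓ (n - 1)) {j k : Fin n} (hjk : j < k) (t : E)
    (hcc : ∀ x, c (c x) = x) :
    Matrix.single j k t + Matrix.single k j (c t) ∈ fixingMatrices π ℓ := by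
  have hX : ((Matrix.single j k t + Matrix.single k j (c t)).map c)ᵀ
      = Matrix.single j k t + Matrix.single k j (c t) := by
    rw [Matrix.map_add _ (map_add c), map_single, map_single, hcc, Matrix.transpose_add,
      Matrix.transpose_single, Matrix.transpose_single, add_comm]
  refine ⟨hX, fun v => ?_⟩
  have hjk' : (j : ℕ) < k := hjk
  -- The elementary hermitian matrix in positions (j,k) and (k,j) is the Eichler transformation
  -- attached to e_j with parameter -c(t) e_k.
  refine h.eichler j (by omega) (-(c t) • ofReal E (Pi.single (.inl k) (1 : F))) ?_ ?_ 0 _ ?_ ?_ v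
  · intro i hi
    have : i ≠ k := fun hik => by
      subst hik
      exact absurd hjk (not_lt.2 hi)
    simp [ofReal, this]
  · intro i _
    simp [ofReal]
  · rw [herm_smul_left, herm_smul_right, herm_ofReal_self]
    simp
  · intro x
    rw [upperU_mulVec, herm_single_inl, herm_smul_left, herm_single_inl, Matrix.add_mulVec,
      Matrix.single_mulVec, Matrix.single_mulVec]
    simp only [zero_mul, zero_smul, add_zero]
    rw [add_assoc]
    congr 1
    ext (i | i)
    · by_cases hi : i = j
      · subst hi
        simp [ofReal, hjk.ne, hcc]
      · by_cases hi' : i = k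
        · subst hi'
          simp [ofReal, hi]
          ring
        · simp [ofReal, hi, hi']
    · simp [ofReal]

theorem IsStage.invariant (hc : c ≠ AlgEquiv.refl) (h : IsStage π ℓ (n - 1)) {g : U c n}
    (hg : IsSiegelUnipotent g) (v : V) : ℓ (π g v) = ℓ v := by
  have hcc := conj_conj hc
  obtain ⟨X, hX, rfl⟩ := hg.exists_upperU
  have hX' : ∀ j k, c (X k j) = X j k := fun j k => by
    conv_rhs => rw [← hX]
    rfl
  suffices hmem : X ∈ fixingMatrices π ℓ by
    obtain ⟨_, h1⟩ := hmem
    exact h1 v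
  -- With Y the strictly upper triangular part, X is the sum of Y, its conjugate transpose and a
  -- diagonal matrix fixed by c.
  let Y : Matrix (Fin n) (Fin n) E := Matrix.of fun j k => if j < k then X j k else 0
  have hdecomp : X = (∑ j, ∑ k, (Matrix.single j k (Y j k) + Matrix.single k j (c (Y j k))))
      + ∑ j, Matrix.single j j (X j j) := by
    have h1 : ∑ j, ∑ k, Matrix.single j k (Y j k) = Y := (Matrix.matrix_eq_sum_single Y).symm
    have h2 : ∑ j, ∑ k, Matrix.single k j (c (Y j k)) = (Y.map c)ᵀ := by
      rw [Finset.sum_comm]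
      exact (Matrix.matrix_eq_sum_single (Y.map c)ᵀ).symm
    have h3 : ∑ j, Matrix.single j j (X j j) = Matrix.diagonal fun j => X j j := by
      ext p q
      rw [Matrix.sum_apply, Matrix.diagonal_apply]
      simp only [Matrix.single_apply]
      split_ifs with hpq
      · subst hpq
        simp
      · refine Finset.sum_eq_zero fun j _ => if_neg ?_
        rintro ⟨rfl, h⟩
        exact hpq h
    simp only [Finset.sum_add_distrib]
    rw [h1, h2, h3]
    ext p q
    simp only [Matrix.add_apply, Matrix.transpose_apply, Matrix.map_apply, Matrix.diagonal_apply, Y,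
      Matrix.of_apply]
    rcases lt_trichotomy p q with hpq | rfl | hpq
    · simp [hpq, hpq.ne, not_lt.2 hpq.le]
    · simp
    · simp [hpq, hpq.ne', not_lt.2 hpq.le, hX']
  rw [hdecomp]
  refine add_mem (sum_mem fun j _ => sum_mem fun k _ => ?_)
    (sum_mem fun j _ => h.diagonal_mem j (hX' j j) hc)
  by_cases hjk : j < k
  · exact h.offDiagonal_mem hjk _ hcc
  · have : Y j k = 0 := if_neg hjk
    rw [this, map_zero, Matrix.single_zero, Matrix.single_zero, add_zero]
    exact zero_mem _

end Invariance

/-! ### The norm of a quadratic extension -/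

section Norm

variable {F E : Type*} [Field F] [Field E] [Algebra F E] [Algebra.IsQuadraticExtension F E]
  {c : E ≃ₐ[F] E} (hc : c ≠ AlgEquiv.refl)

/-- The norm `x ↦ x · c x`. -/
def quadNorm (x : E) : F := (exists_norm hc x).choose

theorem algebraMap_quadNorm (x : E) : algebraMap F E (quadNorm hc x) = x * c x :=
  (exists_norm hc x).choose_spec.symm

theorem quadNorm_mul (x y : E) : quadNorm hc (x * y) = quadNorm hc x * quadNorm hc y := by
  apply (algebraMap F E).injective
  rw [map_mul, algebraMap_quadNorm, algebraMap_quadNorm, algebraMap_quadNorm, map_mul]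
  ring

theorem quadNorm_algebraMap (a : F) : quadNorm hc (algebraMap F E a) = a * a := by
  apply (algebraMap F E).injective
  rw [algebraMap_quadNorm, AlgEquiv.commutes, map_mul]

theorem quadNorm_eq_zero {x : E} : quadNorm hc x = 0 ↔ x = 0 := by
  rw [← (algebraMap F E).injective.eq_iff, algebraMap_quadNorm, map_zero, mul_eq_zero]
  simp

variable [ValuativeRel F] [TopologicalSpace F] [IsNonarchimedeanLocalField F]
    [TopologicalSpace E] [IsTopologicalRing E] [IsModuleTopology F E]

theorem exists_closedBall_of_isCompact {K : Set F} (hK : IsCompact K) :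
    ∃ γ : ValueGroupWithZero F, K ⊆ closedBall F γ := by
  obtain ⟨t, -, ht⟩ := hK.elim_nhds_subcover
    (fun x => (closedBall F (max (valuation F x) 1) : Set F)) fun x _ =>
      (isOpen_closedBall (ne_of_gt (lt_max_of_lt_right zero_lt_one))).mem_nhds
        (mem_closedBall.2 (le_max_left _ _))
  obtain ⟨γ, hγ⟩ := (t.image fun x => max (valuation F x) 1).exists_le
  refine ⟨γ, fun x hx => ?_⟩
  obtain ⟨y, hy, hxy⟩ := Set.mem_iUnion₂.1 (ht hx)
  exact le_trans (mem_closedBall.1 hxy) (hγ _ (Finset.mem_image_of_mem _ hy))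

/-- Elements of integral norm have bounded coordinates. -/
theorem exists_forall_coord_mem {ε : E} (hε : c ε ≠ ε) :
    ∃ γ : ValueGroupWithZero F, ∀ a b : F,
      valuation F (quadNorm hc (algebraMap F E a + ε * algebraMap F E b)) ≤ 1 →
        a ∈ closedBall F γ ∧ b ∈ closedBall F γ := by
  obtain ⟨T, hT⟩ := exists_trace hc ε
  let Q : F × F → F := fun p => p.1 * p.1 + T * (p.1 * p.2) + quadNorm hc ε * (p.2 * p.2)
  have hQ : ∀ a b, Q (a, b) = quadNorm hc (algebraMap F E a + ε * algebraMap F E b) := by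
    intro a b
    apply (algebraMap F E).injective
    simp only [Q, map_add, map_mul, algebraMap_quadNorm, AlgEquiv.commutes, ← hT]
    ring
  have hQc : Continuous Q := by fun_prop
  -- Integral pairs with a coordinate equal to 1: a compact set on which the anisotropic form Q has
  -- no zero, so 1/Q is bounded there.
  let S : Set (F × F) := ((closedBall F 1 : Set F) ×ˢ (closedBall F 1 : Set F)) ∩
    {p | p.1 = 1 ∨ p.2 = 1}
  have hS : IsCompact S := by
    refine ((isCompact_closedBall 1).prod (isCompact_closedBall 1)).inter_right ?_
    exact (isClosed_eq continuous_fst continuous_const).union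
      (isClosed_eq continuous_snd continuous_const)
  have hind : ∀ a b : F, algebraMap F E a + ε * algebraMap F E b = 0 → a = 0 ∧ b = 0 := by
    intro a b h
    have h1 := congrArg c h
    simp only [map_add, map_mul, AlgEquiv.commutes, map_zero] at h1
    have h2 : (c ε - ε) * algebraMap F E b = 0 := by linear_combination h1 - h
    have h3 : b = 0 := by simpa [sub_ne_zero.2 hε] using h2
    subst h3
    exact ⟨by simpa using h, rfl⟩
  have hQ0 : ∀ p ∈ S, Q p ≠ 0 := by
    rintro ⟨a, b⟩ ⟨-, hab⟩ h
    rw [hQ, quadNorm_eq_zero] at h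
    obtain ⟨rfl, rfl⟩ := hind a b h
    simp at hab
  obtain ⟨γ, hγ⟩ := exists_closedBall_of_isCompact
    (hS.image_of_continuousOn (hQc.continuousOn.inv₀ hQ0))
  refine ⟨max γ 1, fun a b hab => ?_⟩
  rw [← hQ] at hab
  have key : ∀ t, t ≠ 0 → (t⁻¹ * a, t⁻¹ * b) ∈ S → valuation F t ≤ max γ 1 := by
    intro t ht hmem
    have h1 : Q (t⁻¹ * a, t⁻¹ * b) = t⁻¹ * t⁻¹ * Q (a, b) := by
      simp only [Q]
      ring
    have h2 := mem_closedBall.1 (hγ ⟨_, hmem, rfl⟩)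
    have h0 := hQ0 _ hmem
    -- Dividing by the larger coordinate t lands in S, and homogeneity of degree two bounds |t|² by
    -- γ.
    have h3 : t * t = Q (a, b) * (Q (t⁻¹ * a, t⁻¹ * b))⁻¹ := by
      rw [eq_mul_inv_iff_mul_eq₀ h0, h1]
      field_simp
    have h4 : valuation F t * valuation F t ≤ γ := by
      rw [← map_mul, h3, map_mul]
      exact (mul_le_mul' hab h2).trans_eq (one_mul _)
    by_contra hlt
    rw [not_le, max_lt_iff] at hlt
    have h5 : valuation F t ≤ valuation F t * valuation F t := le_mul_of_one_le_left' hlt.2.le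
    exact absurd (h5.trans h4) (not_le.2 hlt.1)
  have hdiv : ∀ s t : F, t ≠ 0 → valuation F s ≤ valuation F t → t⁻¹ * s ∈ closedBall F 1 := by
    intro s t ht hst
    rw [mem_closedBall, map_mul, map_inv₀]
    have ht' : valuation F t ≠ 0 := by simpa using ht
    calc (valuation F t)⁻¹ * valuation F s ≤ (valuation F t)⁻¹ * valuation F t :=
          mul_le_mul_right hst _
      _ = 1 := inv_mul_cancel₀ ht'
  have hmain : ∀ t, t ≠ 0 → valuation F a ≤ valuation F t → valuation F b ≤ valuation F t →
      (t = a ∨ t = b) → a ∈ closedBall F (max γ 1) ∧ b ∈ closedBall F (max γ 1) := by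
    intro t ht ha hb hor
    have hmem : (t⁻¹ * a, t⁻¹ * b) ∈ S := by
      refine ⟨⟨hdiv a t ht ha, hdiv b t ht hb⟩, ?_⟩
      rcases hor with rfl | rfl
      · exact Or.inl (inv_mul_cancel₀ ht)
      · exact Or.inr (inv_mul_cancel₀ ht)
    have h := key t ht hmem
    exact ⟨mem_closedBall.2 (ha.trans h), mem_closedBall.2 (hb.trans h)⟩
  rcases le_total (valuation F a) (valuation F b) with h | h
  · by_cases hb : b = 0
    · have ha : a = 0 := by simpa [hb] using h
      rw [ha, hb]
      exact ⟨zero_mem _, zero_mem _⟩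
    · exact hmain b hb h le_rfl (Or.inr rfl)
  · by_cases ha : a = 0
    · have hb : b = 0 := by simpa [ha] using h
      rw [ha, hb]
      exact ⟨zero_mem _, zero_mem _⟩
    · exact hmain a ha le_rfl h (Or.inl rfl)

variable (F) in
theorem t2Space_of_quadratic {c : E ≃ₐ[F] E} (hc : c ≠ AlgEquiv.refl) : T2Space E := by
  obtain ⟨ε, hε⟩ := exists_conj_ne hc
  exact T2Space.of_injective_continuous (quadraticBasis hε).equivFun.injective
    (IsModuleTopology.continuous_of_linearMap (quadraticBasis hε).equivFun.toLinearMap)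

theorem isCompact_quadNorm_le_one : IsCompact {x : E | valuation F (quadNorm hc x) ≤ 1} := by
  have := t2Space_of_quadratic F hc
  obtain ⟨ε, hε⟩ := exists_conj_ne hc
  obtain ⟨γ, hγ⟩ := exists_forall_coord_mem hc hε
  have halg := continuous_algebraMap_of_moduleTopology F E
  have h1 : IsCompact ((fun p : F × F => algebraMap F E p.1 + ε * algebraMap F E p.2) ''
      ((closedBall F γ : Set F) ×ˢ (closedBall F γ : Set F))) := by
    refine ((isCompact_closedBall γ).prod (isCompact_closedBall γ)).image ?_
    fun_prop
  refine h1.of_isClosed_subset ?_ ?_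
  · have h2 : {x : E | valuation F (quadNorm hc x) ≤ 1}
        = (fun x => x * c x) ⁻¹' (algebraMap F E '' (closedBall F 1 : Set F)) := by
      ext x
      constructor
      · intro hx
        exact ⟨_, hx, algebraMap_quadNorm hc x⟩
      · rintro ⟨a, ha, hax⟩
        have : quadNorm hc x = a := by
          apply (algebraMap F E).injective
          rw [algebraMap_quadNorm, hax]
        rw [Set.mem_ofPred_eq, this]
        exact ha
    rw [h2]
    have hcont := continuous_conj (F := F) c
    exact ((isCompact_closedBall 1).image halg).isClosed.preimage (by fun_prop)
  · intro x hx
    obtain ⟨a, b, rfl⟩ := exists_eq_add_mul hε x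
    exact ⟨(a, b), hγ a b hx, rfl⟩

end Norm

/-! ### Iwasawa decomposition -/

section Iwasawa

variable {F E : Type*} [Field F] [Field E] [Algebra F E] {c : E ≃ₐ[F] E} {n : ℕ}

/-- The vectors `±` basis vector. -/
def signedBasis (E : Type*) [Field E] (n : ℕ) : Set (Space E n) :=
  {x | ∃ i, x = Pi.single i 1 ∨ x = -Pi.single i 1}

theorem finite_signedBasis : (signedBasis E n).Finite := by
  have : signedBasis E n = Set.range (fun i => (Pi.single i 1 : Space E n)) ∪
      Set.range (fun i => -(Pi.single i 1 : Space E n)) := by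
    ext x
    simp only [signedBasis, Set.mem_ofPred_eq, Set.mem_union, Set.mem_range, exists_or, eq_comm]
  rw [this]
  exact (Set.finite_range _).union (Set.finite_range _)

variable (c n) in
/-- The elements of the unitary group permuting the basis vectors up to sign. -/
def weylMonoid : Submonoid (U c n) where
  carrier := {g | ∀ x ∈ signedBasis E n, g.val.val *ᵥ x ∈ signedBasis E n}
  one_mem' := by
    intro x hx
    simpa using hx
  mul_mem' := by
    intro g h hg hh x hx
    rw [mul_mulVec]
    exact hg _ (hh x hx)

theorem finite_weylMonoid : (weylMonoid c n : Set (U c n)).Finite := by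
  have h1 : (Set.univ.pi fun _ : Fin n ⊕ Fin n => signedBasis E n).Finite :=
    Set.Finite.pi' (ι := Fin n ⊕ Fin n) (fun _ => finite_signedBasis) |>.subset (by
      intro f hf i
      exact hf i trivial)
  refine Set.Finite.of_injOn (f := fun g i => g.val.val *ᵥ Pi.single i 1) ?_ ?_ h1
  · intro g hg i _
    exact hg _ ⟨i, Or.inl rfl⟩
  · intro g _ g' _ h
    exact unitary_ext_val (Matrix.ext_of_mulVec_single fun i => congrFun h i)

/-- The indicator diagonal matrix of a set of indices. -/
def diagInd (E : Type*) [Field E] (I : Finset (Fin n)) : Matrix (Fin n) (Fin n) E :=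
  Matrix.diagonal fun k => if k ∈ I then 1 else 0

theorem diagInd_conj (I : Finset (Fin n)) : ((diagInd E I).map c)ᵀ = diagInd E I := by
  rw [diagInd, Matrix.diagonal_map (map_zero c), Matrix.diagonal_transpose]
  congr 1
  ext k
  simp [apply_ite c]

theorem diagInd_mul_self (I : Finset (Fin n)) : diagInd E I * diagInd E I = diagInd E I := by
  rw [diagInd, Matrix.diagonal_mul_diagonal]
  congr 1
  ext k
  split_ifs <;> simp

theorem one_sub_diagInd_conj (I : Finset (Fin n)) :
    ((1 - diagInd E I).map c)ᵀ = 1 - diagInd E I := by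
  rw [Matrix.map_sub _ (map_sub c), Matrix.transpose_sub, diagInd_conj, map_conj_one,
    Matrix.transpose_one]

/-- The partial Weyl element exchanging the basis vectors with indices in `I`. -/
def weyl (c : E ≃ₐ[F] E) (I : Finset (Fin n)) : U c n :=
  unitaryMk (Matrix.fromBlocks (1 - diagInd E I) (-diagInd E I) (diagInd E I) (1 - diagInd E I)) (by
    have h := diagInd_mul_self (E := E) I
    have h' : ((-diagInd E I).map c)ᵀ = -diagInd E I := by
      rw [Matrix.map_neg _ (map_neg c), Matrix.transpose_neg, diagInd_conj]
    apply blocks_unitary <;>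
      simp only [diagInd_conj, one_sub_diagInd_conj, h', mul_sub, sub_mul, mul_one, one_mul,
        mul_neg, neg_mul, h] <;> abel)

theorem weyl_mem (I : Finset (Fin n)) : weyl c I ∈ weylMonoid c n := by
  have key : ∀ i, (weyl c I).val.val *ᵥ Pi.single i 1 ∈ signedBasis E n := by
    have hval : (weyl c I).val.val = Matrix.fromBlocks (1 - diagInd E I) (-diagInd E I)
      (diagInd E I) (1 - diagInd E I) := rfl
    have hcol : ∀ i k, ((weyl c I).val.val *ᵥ Pi.single i 1) k = (weyl c I).val.val k i :=
      fun i k => by rw [Matrix.mulVec_single_one, Matrix.col_apply]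
    rintro (i | i) <;> by_cases hi : i ∈ I
    · refine ⟨.inr i, Or.inl (funext ?_)⟩
      rintro (k | k) <;> rw [hcol, hval] <;> by_cases hk : k = i <;>
        simp [diagInd, hk, hi]
    · refine ⟨.inl i, Or.inl (funext ?_)⟩
      rintro (k | k) <;> rw [hcol, hval] <;> by_cases hk : k = i <;>
        simp [diagInd, hk, hi]
    · refine ⟨.inl i, Or.inr (funext ?_)⟩
      rintro (k | k) <;> rw [hcol, hval] <;> by_cases hk : k = i <;>
        simp [diagInd, hk, hi]
    · refine ⟨.inr i, Or.inl (funext ?_)⟩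
      rintro (k | k) <;> rw [hcol, hval] <;> by_cases hk : k = i <;>
        simp [diagInd, hk, hi]
  rintro x ⟨i, rfl | rfl⟩
  · exact key i
  · rw [Matrix.mulVec_neg]
    obtain ⟨j, hj | hj⟩ := key i
    · exact ⟨j, Or.inr (by rw [hj])⟩
    · exact ⟨j, Or.inl (by rw [hj, neg_neg])⟩

/-- The lower n rows of g span an isotropic subspace; this is the lower left block of g g⁻¹ = 1. -/
theorem isotropy (g : U c n) :
    g.val.val.toBlocks₂₂ * (g.val.val.toBlocks₂₁.map c)ᵀ
      = g.val.val.toBlocks₂₁ * (g.val.val.toBlocks₂₂.map c)ᵀ := by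
  have h1 : (g * g⁻¹).val.val = 1 := by rw [mul_inv_cancel]; rfl
  have h2 : (g * g⁻¹).val.val = g.val.val * (g⁻¹).val.val := rfl
  rw [h2, unitary_inv_blocks] at h1
  conv_lhs at h1 => rw [unitary_val_fromBlocks g]
  rw [Matrix.fromBlocks_multiply, ← Matrix.fromBlocks_one, Matrix.fromBlocks_inj] at h1
  have h3 := h1.2.2.1
  rw [Matrix.mul_neg, add_neg_eq_zero] at h3
  exact h3.symm

theorem toBlocks₂₂_mul_weyl (g : U c n) (I : Finset (Fin n)) :
    (g * weyl c I).val.val.toBlocks₂₂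
      = g.val.val.toBlocks₂₂ - (g.val.val.toBlocks₂₁ + g.val.val.toBlocks₂₂) * diagInd E I := by
  change (g.val.val * Matrix.fromBlocks _ _ _ _).toBlocks₂₂ = _
  conv_lhs => rw [unitary_val_fromBlocks g]
  rw [Matrix.fromBlocks_multiply, Matrix.toBlocks_fromBlocks₂₂]
  rw [mul_sub, mul_neg, mul_one, add_mul]
  abel

/-- Left multiplication by an element of the Siegel parabolic. -/
theorem toBlocks₂₂_mul {p g : U c n} (hp : p.val.val.toBlocks₂₁ = 0) :
    (p * g).val.val.toBlocks₂₂ = p.val.val.toBlocks₂₂ * g.val.val.toBlocks₂₂ := by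
  change (p.val.val * g.val.val).toBlocks₂₂ = _
  conv_lhs => rw [unitary_val_fromBlocks p, unitary_val_fromBlocks g]
  rw [Matrix.fromBlocks_multiply, Matrix.toBlocks_fromBlocks₂₂, hp, zero_mul, zero_add]

/-- A row vector killing the lower blocks is zero. -/
theorem eq_zero_of_vecMul_eq_zero (g : U c n) {x : Fin n → E} (h₁ : x ᵥ* g.val.val.toBlocks₂₁ = 0)
    (h₂ : x ᵥ* g.val.val.toBlocks₂₂ = 0) : x = 0 := by
  have h1 : (Sum.elim 0 x : Space E n) ᵥ* g.val.val = 0 := by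
    rw [unitary_val_fromBlocks g, Matrix.vecMul_fromBlocks]
    ext (k | k) <;> simp [h₁, h₂]
  have h2 : (Sum.elim 0 x : Space E n) = 0 := by
    have h3 : g.val.val * (g.val⁻¹).val = 1 := Units.mul_inv _
    rw [← Matrix.vecMul_one (Sum.elim 0 x : Space E n), ← h3, ← Matrix.vecMul_vecMul, h1,
      Matrix.zero_vecMul]
  ext k
  exact congrFun h2 (.inr k)

/-- Some translate by a partial Weyl element lies in the big cell. -/
theorem exists_isUnit_toBlocks₂₂ (g : U c n) :
    ∃ w ∈ weylMonoid c n, IsUnit (g * w).val.val.toBlocks₂₂.det := by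
  let K : U c n → Submodule E (Fin n → E) := fun w =>
    LinearMap.ker (g * w).val.val.toBlocks₂₂.vecMulLinear
  have hKmem : ∀ w x, x ∈ K w ↔ x ᵥ* (g * w).val.val.toBlocks₂₂ = 0 := fun w x => Iff.rfl
  -- Choose w with the left kernel of the lower right block as small as possible. A nonzero kernel
  -- could be shrunk by one further column exchange.
  obtain ⟨w, hw, hmin⟩ := finite_weylMonoid.exists_minimalFor (fun w => Module.finrank E (K w))
    (weylMonoid c n : Set (U c n)) ⟨1, one_mem _⟩
  refine ⟨w, hw, ?_⟩
  rw [isUnit_iff_ne_zero]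
  intro hdet
  obtain ⟨x, hx0, hx⟩ := Matrix.exists_vecMul_eq_zero_iff.2 hdet
  set g' := g * w with hg'
  have hx1 : x ᵥ* g'.val.val.toBlocks₂₁ ≠ 0 := fun h => hx0 (eq_zero_of_vecMul_eq_zero g' h hx)
  obtain ⟨j, hj⟩ := Function.ne_iff.1 hx1
  have hcol : ∀ (y : Fin n → E) (i : Fin n),
      (y ᵥ* (g' * weyl c {j}).val.val.toBlocks₂₂) i
        = if i = j then - (y ᵥ* g'.val.val.toBlocks₂₁) j else (y ᵥ* g'.val.val.toBlocks₂₂) i := by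
    intro y i
    rw [toBlocks₂₂_mul_weyl, Matrix.vecMul_sub, ← Matrix.vecMul_vecMul, diagInd, Pi.sub_apply,
      Matrix.vecMul_diagonal, Matrix.vecMul_add]
    by_cases hi : i = j
    · subst hi
      simp
    · simp [hi]
  have hlt : K (w * weyl c {j}) < K w := by
    refine lt_of_le_of_ne ?_ ?_
    · intro y hy
      rw [hKmem, ← mul_assoc, ← hg'] at hy
      have hy1 : (y ᵥ* g'.val.val.toBlocks₂₁) j = 0 := by
        have := congrFun hy j
        rw [hcol, if_pos rfl, Pi.zero_apply, neg_eq_zero] at this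
        exact this
      have hy2 : ∀ i, i ≠ j → (y ᵥ* g'.val.val.toBlocks₂₂) i = 0 := by
        intro i hi
        have := congrFun hy i
        rwa [hcol, if_neg hi] at this
      -- By isotropy y D (x C)* = y C (x D)*, which is 0 since x D = 0. On the left only the j-th
      -- coordinate of y D survives, and (x C)_j ≠ 0 forces it to vanish.
      have hiso : (y ᵥ* g'.val.val.toBlocks₂₂) ⬝ᵥ (fun i => c ((x ᵥ* g'.val.val.toBlocks₂₁) i)) = 0 := by
        have hstar : ∀ A : Matrix (Fin n) (Fin n) E, (fun i => c ((x ᵥ* A) i))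
            = (A.map c)ᵀ *ᵥ fun i => c (x i) := by
          intro A
          rw [Matrix.mulVec_transpose]
          ext i
          simp [Matrix.vecMul, dotProduct]
        rw [hstar, Matrix.dotProduct_mulVec, Matrix.vecMul_vecMul, isotropy, ← Matrix.vecMul_vecMul,
          ← Matrix.dotProduct_mulVec, ← hstar, hx]
        simp
      rw [dotProduct, Finset.sum_eq_single j (fun i _ hi => by rw [hy2 i hi, zero_mul])
        (by simp)] at hiso
      have hy3 : (y ᵥ* g'.val.val.toBlocks₂₂) j = 0 :=
        (mul_eq_zero.1 hiso).resolve_right (by simpa using hj)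
      rw [hKmem]
      ext i
      by_cases hi : i = j
      · rw [hi, hy3, Pi.zero_apply]
      · rw [hy2 i hi, Pi.zero_apply]
    · intro heq
      have : x ∈ K (w * weyl c {j}) := by rw [heq]; exact hx
      rw [hKmem, ← mul_assoc, ← hg'] at this
      have := congrFun this j
      rw [hcol, if_pos rfl, Pi.zero_apply, neg_eq_zero] at this
      exact hj this
  have h1 := Submodule.finrank_lt_finrank_of_lt hlt
  have h2 := hmin (mul_mem hw (weyl_mem {j})) h1.le
  exact absurd h1 (not_lt.2 h2)

/-- The big cell decomposition. -/
theorem exists_eq_mul_lowerU {g : U c n}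
    (hg : IsUnit g.val.val.toBlocks₂₂.det) :
    ∃ p ∈ siegelParabolic c n, ∃ (S : Matrix (Fin n) (Fin n) E) (hS : (S.map c)ᵀ = S),
      g = p * lowerU S hS := by
  set C := g.val.val.toBlocks₂₁ with hC
  set D := g.val.val.toBlocks₂₂ with hD
  have hDD : D * D⁻¹ = 1 := Matrix.mul_nonsing_inv _ hg
  have hDD' : D⁻¹ * D = 1 := Matrix.nonsing_inv_mul _ hg
  have hiso : D * (C.map c)ᵀ = C * (D.map c)ᵀ := isotropy g
  have hS : ((D⁻¹ * C).map c)ᵀ = D⁻¹ * C := by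
    have h1 : (D.map c)ᵀ * ((D⁻¹).map c)ᵀ = 1 := by
      rw [← Matrix.transpose_mul, ← Matrix.map_mul, hDD', map_conj_one, Matrix.transpose_one]
    rw [Matrix.map_mul, Matrix.transpose_mul]
    calc (C.map c)ᵀ * ((D⁻¹).map c)ᵀ = D⁻¹ * (D * (C.map c)ᵀ) * ((D⁻¹).map c)ᵀ := by
          rw [← mul_assoc, hDD', one_mul]
      _ = D⁻¹ * C * ((D.map c)ᵀ * ((D⁻¹).map c)ᵀ) := by
          rw [hiso]
          simp only [mul_assoc]
      _ = D⁻¹ * C := by rw [h1, mul_one]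
  -- The matrix S = D⁻¹C clears the lower left block, and isotropy makes it hermitian.
  refine ⟨g * (lowerU (D⁻¹ * C) hS)⁻¹, ?_, D⁻¹ * C, hS, by group⟩
  rw [mem_siegelParabolic]
  change (g.val.val * ((lowerU (D⁻¹ * C) hS)⁻¹).val.val).toBlocks₂₁ = 0
  rw [unitary_inv_blocks]
  conv_lhs => rw [unitary_val_fromBlocks g]
  rw [Matrix.fromBlocks_multiply, Matrix.toBlocks_fromBlocks₂₁, ← hC, ← hD]
  change C * ((1 : Matrix (Fin n) (Fin n) E).map c)ᵀ + D * -((D⁻¹ * C).map c)ᵀ = 0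
  rw [hS, map_conj_one, Matrix.transpose_one, mul_one, mul_neg, ← mul_assoc, hDD, one_mul,
    add_neg_cancel]

/-- Principal minors of a hermitian matrix as lower right minors of Weyl translates. -/
theorem det_lowerU_mul_weyl {m : ℕ} (ι : Fin m → Fin n) (hι : Function.Injective ι)
    (S : Matrix (Fin n) (Fin n) E) (hS : (S.map c)ᵀ = S) :
    (lowerU S hS * weyl c (Finset.univ.image ι)).val.val.toBlocks₂₂.det
      = (-(S.submatrix ι ι)).det := by
  -- Factor the projector onto the indices of ι through dimension m; det(1 + AB) = det(1 + BA) then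
  -- reduces the determinant to the minor.
  have h1 : diagInd E (Finset.univ.image ι)
      = (1 : Matrix (Fin n) (Fin n) E).submatrix id ι * (1 : Matrix (Fin n) (Fin n) E).submatrix ι id := by
    ext p q
    rw [diagInd, Matrix.diagonal_apply, Matrix.mul_apply]
    simp only [Matrix.submatrix_apply, Matrix.one_apply, id]
    split_ifs with hpq hp
    · subst hpq
      obtain ⟨t, -, rfl⟩ := Finset.mem_image.1 hp
      rw [Finset.sum_eq_single t]
      · simp
      · intro s _ hs
        simp [hι.ne hs]
      · simp
    · subst hpq
      refine (Finset.sum_eq_zero fun t _ => ?_).symm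
      have : p ≠ ι t := fun h => hp (h ▸ Finset.mem_image_of_mem _ (Finset.mem_univ t))
      simp [this]
    · refine (Finset.sum_eq_zero fun t _ => ?_).symm
      by_cases h : p = ι t
      · have : ι t ≠ q := fun h' => hpq (h.trans h')
        simp [this]
      · simp [h]
  rw [toBlocks₂₂_mul_weyl]
  change ((1 : Matrix (Fin n) (Fin n) E) - (S + 1) * diagInd E (Finset.univ.image ι)).det = _
  have h2 : (1 : Matrix (Fin n) (Fin n) E).submatrix ι id *
      (-(S + 1) * (1 : Matrix (Fin n) (Fin n) E).submatrix id ι) = -(S.submatrix ι ι) - 1 := by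
    ext p q
    simp [Matrix.mul_apply, Matrix.one_apply, hι.eq_iff]
    ring
  rw [h1, ← Matrix.mul_assoc, sub_eq_add_neg, ← Matrix.neg_mul, ← Matrix.neg_mul,
    Matrix.det_one_add_mul_comm, h2, add_sub_cancel]

variable [Algebra.IsQuadraticExtension F E] [ValuativeRel F]

/-- Iwasawa decomposition: modulo the Siegel parabolic, every element is a bounded opposite unipotent
element times a partial Weyl element. -/
theorem exists_iwasawa (hc : c ≠ AlgEquiv.refl) (g : U c n) :
    ∃ p ∈ siegelParabolic c n, ∃ w ∈ weylMonoid c n,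
      ∃ (S : Matrix (Fin n) (Fin n) E) (hS : (S.map c)ᵀ = S),
        (∀ i j, valuation F (quadNorm hc (S i j)) ≤ 1) ∧ g * w = p * lowerU S hS := by
  -- Maximizing the norm of this determinant over the finite set of Weyl elements bounds the
  -- principal minors of S: a further partial Weyl element multiplies the determinant by the
  -- corresponding minor, up to sign.
  let f : U c n → ValueGroupWithZero F := fun w =>
    valuation F (quadNorm hc (g * w).val.val.toBlocks₂₂.det)
  obtain ⟨w, hw, hmax⟩ := finite_weylMonoid.exists_maximalFor f
    (weylMonoid c n : Set (U c n)) ⟨1, one_mem _⟩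
  have hmax' : ∀ w' ∈ weylMonoid c n, f w' ≤ f w := fun w' hw' => by
    rcases le_total (f w') (f w) with h | h
    · exact h
    · exact hmax hw' h
  have hunit : IsUnit (g * w).val.val.toBlocks₂₂.det := by
    obtain ⟨w₀, hw₀, hu⟩ := exists_isUnit_toBlocks₂₂ g
    rw [isUnit_iff_ne_zero] at hu ⊢
    intro h0
    have h1 := hmax' w₀ hw₀
    simp only [f, h0, (quadNorm_eq_zero hc).2 rfl, map_zero, le_zero_iff, map_eq_zero] at h1
    exact hu ((quadNorm_eq_zero hc).1 h1)
  obtain ⟨p, hp, S, hS, hgS⟩ := exists_eq_mul_lowerU hunit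
  have hp21 := mem_siegelParabolic.1 hp
  have hminor : ∀ {m : ℕ} (ι : Fin m → Fin n), Function.Injective ι →
      valuation F (quadNorm hc (-(S.submatrix ι ι)).det) ≤ 1 := by
    intro m ι hι
    have h1 := hmax' _ (mul_mem hw (weyl_mem (Finset.univ.image ι)))
    have h2 : (g * (w * weyl c (Finset.univ.image ι))).val.val.toBlocks₂₂.det
        = p.val.val.toBlocks₂₂.det * (-(S.submatrix ι ι)).det := by
      rw [← mul_assoc, hgS, mul_assoc, toBlocks₂₂_mul hp21, Matrix.det_mul,
        det_lowerU_mul_weyl ι hι]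
    have h3 : (g * w).val.val.toBlocks₂₂.det = p.val.val.toBlocks₂₂.det := by
      rw [hgS, toBlocks₂₂_mul hp21]
      change (_ * (1 : Matrix (Fin n) (Fin n) E)).det = _
      rw [mul_one]
    simp only [f, h2, h3, quadNorm_mul, map_mul] at h1
    have h4 : valuation F (quadNorm hc p.val.val.toBlocks₂₂.det) ≠ 0 := by
      rw [Ne, map_eq_zero, quadNorm_eq_zero, ← h3]
      exact hunit.ne_zero
    have h5 : 0 < valuation F (quadNorm hc p.val.val.toBlocks₂₂.det) := zero_lt_iff.2 h4
    exact le_of_mul_le_mul_left (h1.trans_eq (mul_one _).symm) h5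
  have hsq : ∀ a : F, valuation F (a * a) ≤ 1 → valuation F a ≤ 1 := by
    intro a ha
    by_contra h
    rw [not_le] at h
    rw [map_mul] at ha
    exact absurd ha (not_le.2 (one_lt_mul'' h h))
  have hS' : ∀ i j, c (S j i) = S i j := fun i j => by
    conv_rhs => rw [← hS]
    rfl
  have hdiag : ∀ i, ∃ r : F, S i i = algebraMap F E r ∧ valuation F r ≤ 1 := by
    intro i
    obtain ⟨r, hr⟩ := conj_fixed hc (hS' i i)
    refine ⟨r, hr, hsq r ?_⟩
    have h1 := hminor (fun _ : Fin 1 => i) (fun _ _ _ => Subsingleton.elim _ _)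
    simp only [Matrix.det_fin_one, Matrix.neg_apply, Matrix.submatrix_apply, hr] at h1
    rw [← map_neg, quadNorm_algebraMap, neg_mul_neg] at h1
    exact h1
  refine ⟨p, hp, w, hw, S, hS, fun i j => ?_, hgS⟩
  obtain ⟨r, hr, hr1⟩ := hdiag i
  obtain ⟨r', hr', hr1'⟩ := hdiag j
  by_cases hij : i = j
  · subst hij
    rw [hr, quadNorm_algebraMap, map_mul]
    exact mul_le_one' hr1 hr1
  · have h1 := hminor ![i, j] (by
      intro a b hab
      fin_cases a <;> fin_cases b <;> simp_all)
    -- The 2×2 minor is S_ii S_jj - N(S_ij). As the diagonal entries and the minor are integral, so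
    -- is N(S_ij).
    have h2 : (-(S.submatrix ![i, j] ![i, j])).det
        = algebraMap F E (r * r' - quadNorm hc (S i j)) := by
      rw [Matrix.det_fin_two, map_sub, map_mul, algebraMap_quadNorm, ← hr, ← hr', hS' j i]
      simp only [Matrix.neg_apply, Matrix.submatrix_apply, Matrix.cons_val_zero,
        Matrix.cons_val_one, neg_mul_neg]
    rw [h2, quadNorm_algebraMap] at h1
    have h3 := hsq _ h1
    have h4 : quadNorm hc (S i j) = r * r' - (r * r' - quadNorm hc (S i j)) := by ring
    rw [h4]
    refine (Valuation.map_sub _ _ _).trans (max_le ?_ h3)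
    rw [map_mul]
    exact mul_le_one' hr1 hr1'

variable [TopologicalSpace F] [IsNonarchimedeanLocalField F]
    [TopologicalSpace E] [IsTopologicalRing E] [IsModuleTopology F E]

/-- The double cosets of the Siegel parabolic and an open subgroup are finite in number. -/
theorem exists_finite_cover (hc : c ≠ AlgEquiv.refl) {K : Subgroup (U c n)}
    (hK : IsOpen (K : Set (U c n))) :
    ∃ T : Finset (U c n), ∀ g, ∃ p ∈ siegelParabolic c n, ∃ t ∈ T, ∃ k ∈ K, g = p * t * k := by
  have := t2Space_of_quadratic F hc
  let B : Set (Matrix (Fin n) (Fin n) E) := {S | ∀ i j, valuation F (quadNorm hc (S i j)) ≤ 1}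
  have hB : IsCompact B := by
    have h := isCompact_univ_pi fun _ : Fin n => isCompact_univ_pi fun _ : Fin n =>
      isCompact_quadNorm_le_one (F := F) hc
    have hBe : B = Set.univ.pi fun _ : Fin n => Set.univ.pi fun _ : Fin n =>
        {x : E | valuation F (quadNorm hc x) ≤ 1} := by
      refine Set.ext fun S => ?_
      exact ⟨fun h i _ j _ => h i j, fun h i j => h i trivial j trivial⟩
    rw [hBe]
    exact h
  let H : Set (Matrix (Fin n) (Fin n) E) := {S | (S.map c)ᵀ = S}
  have hH : IsClosed H := by
    have hcont := continuous_conj (F := F) c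
    refine isClosed_eq ?_ continuous_id
    exact (continuous_id.matrix_map hcont).matrix_transpose
  have hBH : IsCompact (B ∩ H) := hB.inter_right hH
  let L : {S // S ∈ B ∩ H} → U c n := fun S => lowerU S.1 S.2.2
  have hL : Continuous L := by
    refine continuous_unitary (F := F) ?_
    change Continuous fun S : {S // S ∈ B ∩ H} => Matrix.fromBlocks 1 0 S.1 1
    exact Continuous.matrix_fromBlocks continuous_const continuous_const continuous_subtype_val
      continuous_const
  have hcomp : CompactSpace {S // S ∈ B ∩ H} := isCompact_iff_compactSpace.1 hBH
  -- By the Iwasawa decomposition this compact set meets every coset of the parabolic, and finitely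
  -- many left translates of K cover it.
  have hC : IsCompact (⋃ w ∈ (weylMonoid c n : Set (U c n)), (fun x => x * w⁻¹) '' Set.range L) :=
    finite_weylMonoid.isCompact_biUnion fun w _ =>
      (isCompact_range hL).image (continuous_mul_const _)
  obtain ⟨T, -, hT⟩ := hC.elim_nhds_subcover (fun t => (fun x => t⁻¹ * x) ⁻¹' (K : Set (U c n)))
    (fun t _ => by
      refine (hK.preimage (continuous_const_mul _)).mem_nhds ?_
      rw [Set.mem_preimage, inv_mul_cancel]
      exact one_mem K)
  refine ⟨T, fun g => ?_⟩
  obtain ⟨p, hp, w, hw, S, hS, hSb, hg⟩ := exists_iwasawa hc g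
  have hmem : lowerU S hS * w⁻¹ ∈
      ⋃ w ∈ (weylMonoid c n : Set (U c n)), (fun x => x * w⁻¹) '' Set.range L :=
    Set.mem_iUnion₂.2 ⟨w, hw, lowerU S hS, ⟨⟨S, hSb, hS⟩, rfl⟩, rfl⟩
  obtain ⟨t, ht, hk⟩ := Set.mem_iUnion₂.1 (hT hmem)
  refine ⟨p, hp, t, ht, _, hk, ?_⟩
  rw [mul_assoc, mul_inv_cancel_left, ← mul_assoc, ← hg, mul_inv_cancel_right]

end Iwasawa

/-! ### Generalities on representations -/

section Representations

variable {G : Type*} [Group G] {V W : Type*} [AddCommGroup V] [Module ℂ V] [AddCommGroup W]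
  [Module ℂ W]

theorem IsSubquotient.of_injective {π : Representation ℂ G V} {ρ : Representation ℂ G W}
    (f : π.IntertwiningMap ρ) (hf : Function.Injective f) : IsSubquotient π ρ := by
  have hf' : Function.Injective f.toLinearMap := hf
  have hcomm : ∀ g v, f.toLinearMap (π g v) = ρ g (f.toLinearMap v) := fun g v =>
    LinearMap.congr_fun (f.isIntertwining' g) v
  let B : Subrepresentation ρ :=
    { toSubmodule := LinearMap.range f.toLinearMap
      apply_mem_toSubmodule := by
        rintro g _ ⟨v, rfl⟩
        exact ⟨π g v, hcomm g v⟩ }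
  let e : V ≃ₗ[ℂ] LinearMap.range f.toLinearMap := LinearEquiv.ofInjective f.toLinearMap hf'
  refine ⟨B, LinearMap.intertwiningMap_of_isIntertwiningMap _ _ e.symm.toLinearMap ?_,
    e.symm.surjective⟩
  intro g w
  obtain ⟨v, rfl⟩ := e.surjective w
  change e.symm (B.toRepresentation g (e v)) = π g (e.symm (e v))
  rw [e.symm_apply_apply, e.symm_apply_eq]
  exact Subtype.ext (hcomm g v).symm

variable {ρ : Representation ℂ G V}

/-- Zorn's lemma. The hypothesis says that A generates V modulo B, so finiteness of A keeps the
union of a chain of proper subrepresentations proper. -/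
theorem exists_isCoatom_ge {B : Subrepresentation ρ} (hB : B ≠ ⊤) (A : Finset V)
    (hA : ∀ C : Subrepresentation ρ, B ≤ C → (∀ a ∈ A, a ∈ C) → C = ⊤) :
    ∃ C, B ≤ C ∧ IsCoatom C := by
  obtain ⟨C, hBC, hC⟩ := zorn_le_nonempty₀ {C : Subrepresentation ρ | B ≤ C ∧ C ≠ ⊤} (by
    intro s hs hchain D hD
    have hdir : DirectedOn (· ≤ ·) s := hchain.directedOn
    have hdir' : DirectedOn (· ≤ ·) (Subrepresentation.toSubmodule '' s) := by
      rintro _ ⟨x, hx, rfl⟩ _ ⟨y, hy, rfl⟩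
      obtain ⟨z, hz, hxz, hyz⟩ := hdir x hx y hy
      exact ⟨_, ⟨z, hz, rfl⟩, hxz, hyz⟩
    have hmem : ∀ v, v ∈ sSup (Subrepresentation.toSubmodule '' s) ↔ ∃ x ∈ s, v ∈ x := by
      intro v
      rw [Submodule.mem_sSup_of_directed (Set.Nonempty.image _ ⟨D, hD⟩) hdir']
      constructor
      · rintro ⟨_, ⟨x, hx, rfl⟩, hv⟩
        exact ⟨x, hx, hv⟩
      · rintro ⟨x, hx, hv⟩
        exact ⟨_, ⟨x, hx, rfl⟩, hv⟩
    let S : Subrepresentation ρ :=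
      { toSubmodule := sSup (Subrepresentation.toSubmodule '' s)
        apply_mem_toSubmodule := by
          intro g v hv
          obtain ⟨x, hx, hvx⟩ := (hmem v).1 hv
          exact (hmem _).2 ⟨x, hx, x.apply_mem_toSubmodule g hvx⟩ }
    have hle : ∀ x ∈ s, x ≤ S := fun x hx v hv => (hmem v).2 ⟨x, hx, hv⟩
    refine ⟨S, ⟨(hs hD).1.trans (hle D hD), fun htop => ?_⟩, hle⟩
    obtain ⟨x, hx, hAx⟩ := DirectedOn.exists_mem_subset_of_finset_subset_biUnion
      (f := fun x : Subrepresentation ρ => (x : Set V)) (s := A) ⟨D, hD⟩ hdir (by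
        intro a _
        have : a ∈ S := by rw [htop]; exact Submodule.mem_top
        obtain ⟨x, hx, hax⟩ := (hmem a).1 this
        exact Set.mem_iUnion₂.2 ⟨x, hx, hax⟩)
    exact (hs hx).2 (hA x (hs hx).1 fun a ha => hAx ha)) B ⟨le_rfl, hB⟩
  refine ⟨C, hBC, hC.prop.2, fun D hD => ?_⟩
  by_contra hne
  exact absurd (hC.le_of_ge ⟨hBC.trans hD.le, hne⟩ hD.le) (not_le_of_gt hD)

/-- The quotient of a representation by a subrepresentation. -/
abbrev quotientRep (C : Subrepresentation ρ) : Representation ℂ G (V ⧸ C.toSubmodule) :=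
  ρ.quotient C.toSubmodule fun g _ hv => C.apply_mem_toSubmodule g hv

theorem isIrreducible_quotientRep {C : Subrepresentation ρ} (hC : IsCoatom C) :
    (quotientRep C).IsIrreducible := by
  have hcomap : ∀ D : Subrepresentation (quotientRep C), D = ⊥ ∨ D = ⊤ := by
    intro D
    let D' : Subrepresentation ρ :=
      { toSubmodule := D.toSubmodule.comap C.toSubmodule.mkQ
        apply_mem_toSubmodule := fun g v hv => D.apply_mem_toSubmodule g hv }
    have hle : C ≤ D' := by
      intro v hv
      change C.toSubmodule.mkQ v ∈ D.toSubmodule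
      have : C.toSubmodule.mkQ v = 0 := (Submodule.Quotient.mk_eq_zero _).2 hv
      rw [this]
      exact zero_mem _
    rcases hC.le_iff.1 hle with h | h
    · right
      refine SetLike.ext fun x => ⟨fun _ => Submodule.mem_top, fun _ => ?_⟩
      obtain ⟨v, rfl⟩ := C.toSubmodule.mkQ_surjective x
      have hv : v ∈ D' := by rw [h]; exact Submodule.mem_top
      exact hv
    · left
      refine SetLike.ext fun x => ⟨fun hx => ?_, fun hx => ?_⟩
      · obtain ⟨v, rfl⟩ := C.toSubmodule.mkQ_surjective x
        have hv : v ∈ D' := hx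
        rw [h] at hv
        have : C.toSubmodule.mkQ v = 0 := (Submodule.Quotient.mk_eq_zero _).2 hv
        rw [this]
        exact zero_mem (⊥ : Submodule ℂ (V ⧸ C.toSubmodule))
      · have hx' : x = 0 := hx
        rw [hx']
        exact zero_mem D.toSubmodule
  refine { exists_pair_ne := ⟨⊥, ⊤, fun h => hC.1 ?_⟩, eq_bot_or_eq_top := hcomap }
  refine SetLike.ext fun v => ⟨fun _ => Submodule.mem_top, fun _ => ?_⟩
  have hv : C.toSubmodule.mkQ v ∈ (⊤ : Subrepresentation (quotientRep C)) := Submodule.mem_top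
  rw [← h] at hv
  have hv' : C.toSubmodule.mkQ v = 0 := hv
  exact (Submodule.Quotient.mk_eq_zero _).1 hv'

end Representations

/-! ### The unipotent radical of the Siegel parabolic -/

section Lagrangian

variable {F E : Type*} [Field F] [Field E] [Algebra F E] {c : E ≃ₐ[F] E} {n : ℕ}

variable (E n) in
/-- The Lagrangian subspace spanned by the first `n` basis vectors. -/
def lagrangian : Submodule E (Space E n) where
  carrier := {x | ∀ k, x (.inr k) = 0}
  zero_mem' _ := rfl
  add_mem' hx hy k := by rw [Pi.add_apply, hx k, hy k, add_zero]
  smul_mem' a x hx k := by rw [Pi.smul_apply, hx k, smul_zero]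

theorem lagrangian_le_perp : lagrangian E n ≤ perp c n (lagrangian E n) := by
  intro x hx y hy
  rw [herm_apply]
  refine Finset.sum_eq_zero fun k _ => ?_
  rw [hx k, hy k, map_zero, zero_mul, mul_zero, sub_zero]

theorem single_mem_lagrangian (k : Fin n) : (Pi.single (.inl k) 1 : Space E n) ∈ lagrangian E n :=
  fun _ => by simp

theorem isIsotropicFlag_lagrangian (hn : 0 < n) : IsIsotropicFlag c n {lagrangian E n} where
  nonempty := Set.singleton_nonempty _
  isChain := Set.subsingleton_singleton.isChain
  ne_bot := by
    rintro _ rfl h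
    have h1 := single_mem_lagrangian (E := E) (⟨0, hn⟩ : Fin n)
    rw [h, Submodule.mem_bot] at h1
    simpa using congrFun h1 (.inl ⟨0, hn⟩)
  isotropic := by
    rintro _ rfl
    exact lagrangian_le_perp

/-- The full flag adds to the Lagrangian only 0, the whole space and the orthogonal, and the last
two are not strictly below it. -/
theorem pred_lagrangian : pred c n {lagrangian E n} (lagrangian E n) = ⊥ := by
  refine le_bot_iff.1 (sSup_le ?_)
  rintro Z ⟨((rfl | rfl) | rfl) | ⟨_, rfl, rfl⟩, hlt⟩
  · exact le_rfl
  · exact absurd hlt not_top_lt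
  · exact absurd hlt (lt_irrefl _)
  · exact absurd hlt (not_lt_of_ge lagrangian_le_perp)

theorem isSiegelUnipotent_of_mem {g : U c n} (hg : g ∈ unipotentRadical c n {lagrangian E n}) :
    IsSiegelUnipotent g := by
  have hcol : ∀ (k : Fin n) i, g.val.val i (.inl k) = (Pi.single (.inl k) 1 : Space E n) i := by
    intro k i
    have h1 := hg (lagrangian E n) (Or.inl (Or.inr rfl)) _ (single_mem_lagrangian k)
    rw [pred_lagrangian, Submodule.mem_bot, sub_eq_zero] at h1
    rw [← h1, Matrix.mulVec_single_one, Matrix.col_apply]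
  constructor
  · ext i j
    rw [Matrix.toBlocks₁₁, Matrix.of_apply, hcol, Matrix.one_apply, Pi.single_apply]
    simp only [Sum.inl.injEq]
  · ext i j
    rw [Matrix.toBlocks₂₁, Matrix.of_apply, hcol]
    simp

theorem isSiegelUnipotent_iff {g : U c n} :
    IsSiegelUnipotent g ↔ ∃ h : g ∈ siegelParabolic c n, siegelLevi c n ⟨g, h⟩ = 1 := by
  refine ⟨fun h => ⟨mem_siegelParabolic.2 h.2, Units.ext h.1⟩, fun ⟨h, h1⟩ => ⟨?_, h.1⟩⟩
  exact congrArg Units.val h1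

theorem IsSiegelUnipotent.conj {u p : U c n} (hu : IsSiegelUnipotent u)
    (hp : p ∈ siegelParabolic c n) : IsSiegelUnipotent (p * u * p⁻¹) := by
  obtain ⟨hu, hu1⟩ := isSiegelUnipotent_iff.1 hu
  refine isSiegelUnipotent_iff.2 ⟨mul_mem (mul_mem hp hu) (inv_mem hp), ?_⟩
  change siegelLevi c n (⟨p, hp⟩ * ⟨u, hu⟩ * ⟨p, hp⟩⁻¹) = 1
  rw [map_mul, map_mul, hu1, mul_one, map_inv, mul_inv_cancel]

/-- The embedding of the Levi subgroup `GLₙ(E)`. -/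
def leviHom (hcc : ∀ x, c (c x) = x) : GL (Fin n) E →* U c n where
  toFun := leviU hcc
  map_one' := leviU_one hcc
  map_mul' := leviU_mul hcc

theorem siegelLevi_leviHom (hcc : ∀ x, c (c x) = x) (a : GL (Fin n) E) :
    siegelLevi c n ⟨leviHom hcc a, leviU_mem hcc a⟩ = a :=
  Units.ext (Matrix.toBlocks_fromBlocks₁₁ ..)

theorem isSiegelUnipotent_leviHom_inv_mul (hcc : ∀ x, c (c x) = x) (p : siegelParabolic c n) :
    IsSiegelUnipotent ((leviHom hcc (siegelLevi c n p))⁻¹ * p.val) := by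
  refine isSiegelUnipotent_iff.2 ⟨mul_mem (inv_mem (leviU_mem hcc _)) p.2, ?_⟩
  change siegelLevi c n (⟨leviHom hcc (siegelLevi c n p), leviU_mem hcc _⟩⁻¹ * p) = 1
  rw [map_mul, map_inv, siegelLevi_leviHom, inv_mul_cancel]

variable [Algebra.IsQuadraticExtension F E] [ValuativeRel F] [TopologicalSpace F]
  [IsNonarchimedeanLocalField F] [TopologicalSpace E] [IsTopologicalRing E] [IsModuleTopology F E]

theorem continuous_leviHom (hcc : ∀ x, c (c x) = x) :
    Continuous (leviHom hcc : GL (Fin n) E →* U c n) := by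
  refine continuous_unitary (F := F) ?_
  have hcont := continuous_conj (F := F) c
  have h1 : Continuous fun a : GL (Fin n) E => (a⁻¹).val :=
    Units.continuous_val.comp continuous_inv
  exact Continuous.matrix_fromBlocks Units.continuous_val continuous_const continuous_const
    (h1.matrix_map hcont).matrix_transpose

end Lagrangian

/-! ### Representations with a functional invariant under the Siegel unipotent radical -/

section Jacquet

variable {F E : Type*} [Field F] [Field E] [Algebra F E] {c : E ≃ₐ[F] E} {n : ℕ}
  {V : Type*} [AddCommGroup V] [Module ℂ V] {π : Representation ℂ (U c n) V} {ℓ : V →ₗ[ℂ] ℂ}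

/-- An invariant form factors through the coinvariants for the stabilizer of the Lagrangian, so
these cannot vanish. -/
theorem not_isCuspidal_of_invariant (hn : 0 < n) (hℓ : ℓ ≠ 0)
    (hinv : ∀ u, IsSiegelUnipotent u → ∀ v, ℓ (π u v) = ℓ v) : ¬ IsCuspidal c n π := by
  intro hcusp
  have hsub := hcusp _ (isIsotropicFlag_lagrangian hn)
  let f := Representation.Coinvariants.lift
    (π.comp (unipotentRadical c n {lagrangian E n}).subtype) ℓ
    fun u => LinearMap.ext fun v => hinv u (isSiegelUnipotent_of_mem u.2) v
  refine hℓ (LinearMap.ext fun v => ?_)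
  change f (Representation.Coinvariants.mk _ v) = 0
  rw [Subsingleton.elim (Representation.Coinvariants.mk _ v) 0, map_zero]

/-- The span of the vectors `π u v - v` with `u` in the Siegel unipotent radical, as a
representation of the Levi subgroup. -/
def jacquetKernel (π : Representation ℂ (U c n) V) (hcc : ∀ x, c (c x) = x) :
    Subrepresentation (π.comp (leviHom hcc)) where
  toSubmodule := Submodule.span ℂ {x | ∃ u v, IsSiegelUnipotent u ∧ x = π u v - v}
  apply_mem_toSubmodule := by
    intro a x hx
    induction hx using Submodule.span_induction with
    | zero => rw [map_zero]; exact zero_mem _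
    | add x y _ _ hx hy => rw [map_add]; exact add_mem hx hy
    | smul t x _ hx => rw [map_smul]; exact Submodule.smul_mem _ _ hx
    | mem x hx =>
      obtain ⟨u, v, hu, rfl⟩ := hx
      refine Submodule.subset_span ⟨leviHom hcc a * u * (leviHom hcc a)⁻¹, π (leviHom hcc a) v,
        hu.conj (leviU_mem hcc a), ?_⟩
      rw [map_sub]
      change π (leviHom hcc a) (π u v) - π (leviHom hcc a) v = _
      rw [← Module.End.mul_apply, ← map_mul, ← Module.End.mul_apply (π (_ * _ * _)), ← map_mul,
        inv_mul_cancel_right]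

theorem sub_mem_jacquetKernel (hcc : ∀ x, c (c x) = x) {u : U c n} (hu : IsSiegelUnipotent u)
    (v : V) : π u v - v ∈ jacquetKernel π hcc :=
  Submodule.subset_span ⟨u, v, hu, rfl⟩

theorem jacquetKernel_ne_top (hcc : ∀ x, c (c x) = x) (hℓ : ℓ ≠ 0)
    (hinv : ∀ u, IsSiegelUnipotent u → ∀ v, ℓ (π u v) = ℓ v) : jacquetKernel π hcc ≠ ⊤ := by
  intro h
  have hle : (jacquetKernel π hcc).toSubmodule ≤ LinearMap.ker ℓ := by
    refine Submodule.span_le.2 ?_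
    rintro _ ⟨u, v, hu, rfl⟩
    rw [SetLike.mem_coe, LinearMap.mem_ker, map_sub, hinv u hu, sub_self]
  refine hℓ (LinearMap.ext fun v => hle ?_)
  rw [h]
  exact Submodule.mem_top

/-- Modulo the span of the `π u v - v`, the Siegel parabolic acts through its Levi quotient. -/
theorem sub_leviHom_mem (hcc : ∀ x, c (c x) = x) (p : siegelParabolic c n) (v : V) :
    π p.val v - π (leviHom hcc (siegelLevi c n p)) v ∈ jacquetKernel π hcc := by
  have h := (jacquetKernel π hcc).apply_mem_toSubmodule (siegelLevi c n p)
    (sub_mem_jacquetKernel (π := π) hcc (isSiegelUnipotent_leviHom_inv_mul hcc p) v)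
  rw [map_sub] at h
  change π (leviHom hcc _) (π _ v) - π (leviHom hcc _) v ∈ _ at h
  rwa [← Module.End.mul_apply, ← map_mul, mul_inv_cancel_left] at h

variable [TopologicalSpace E] [IsTopologicalRing E]

/-- Frobenius reciprocity: an irreducible representation embeds into the induction of `σ` if it has a
nonzero map to `σ` which is equivariant under the Siegel parabolic. -/
theorem isSubquotient_siegelInd (hπ : IsSmooth π) (hirr : π.IsIrreducible) {W : Type*}
    [AddCommGroup W] [Module ℂ W] {σ : Representation ℂ (GL (Fin n) E) W} {q : V →ₗ[ℂ] W}
    (hq : q ≠ 0) (hqσ : ∀ (p : siegelParabolic c n) v, q (π p.val v) = σ (siegelLevi c n p) (q v)) :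
    IsSubquotient (W := (smoothVectors (Representation.coind (siegelParabolic c n).subtype
      (σ.comp (siegelLevi c n)))).toSubmodule) π (siegelInd c n σ) := by
  let τ := σ.comp (siegelLevi c n)
  -- Frobenius map v ↦ (g ↦ q(π(g)v)). Its kernel is a subrepresentation, hence zero by
  -- irreducibility, since evaluation at 1 recovers q ≠ 0.
  let Φ : V →ₗ[ℂ] Representation.coindV (siegelParabolic c n).subtype τ :=
    { toFun := fun v => ⟨fun g => q (π g v), by
        intro p g
        change q (π (p.val * g) v) = _
        rw [map_mul, Module.End.mul_apply]
        exact hqσ p _⟩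
      map_add' := fun v w => Subtype.ext <| funext fun g => by
        change q (π g (v + w)) = _
        rw [map_add, map_add]
        rfl
      map_smul' := fun a v => Subtype.ext <| funext fun g => by
        change q (π g (a • v)) = _
        rw [map_smul, map_smul]
        rfl }
  have hΦ : ∀ g v, Φ (π g v) = Representation.coind (siegelParabolic c n).subtype τ g (Φ v) := by
    intro g v
    refine Subtype.ext (funext fun x => ?_)
    change q (π x (π g v)) = q (π (x * g) v)
    rw [map_mul, Module.End.mul_apply]
  have hsm : ∀ v, Φ v ∈ (smoothVectors
      (Representation.coind (siegelParabolic c n).subtype τ)).toSubmodule := by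
    intro v
    obtain ⟨K, hK, hv⟩ := hπ v
    refine ⟨K, hK, fun k hk => ?_⟩
    rw [← hΦ, hv k hk]
  let f : π.IntertwiningMap (siegelInd c n σ) :=
    LinearMap.intertwiningMap_of_isIntertwiningMap _ _ (Φ.codRestrict _ hsm)
      fun g v => Subtype.ext (hΦ g v)
  let D : Subrepresentation π :=
    { toSubmodule := LinearMap.ker Φ
      apply_mem_toSubmodule := fun g v hv => by
        rw [LinearMap.mem_ker] at hv ⊢
        rw [hΦ, hv, map_zero] }
  have hker : LinearMap.ker Φ = ⊥ := by
    refine (congrArg Subrepresentation.toSubmodule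
      ((hirr.eq_bot_or_eq_top D).resolve_right fun h => hq ?_) :)
    ext v
    have hv : v ∈ D := by rw [h]; exact Submodule.mem_top
    have h1 : Φ v = 0 := hv
    have h2 : q (π 1 v) = 0 := congrFun (congrArg Subtype.val h1) 1
    rwa [map_one, Module.End.one_apply] at h2
  refine IsSubquotient.of_injective f fun v w h => ?_
  exact LinearMap.ker_eq_bot.1 hker (congrArg Subtype.val h)

theorem mkQ_parabolic (hcc : ∀ x, c (c x) = x) {C : Subrepresentation (π.comp (leviHom hcc))}
    (hle : jacquetKernel π hcc ≤ C) (p : siegelParabolic c n) (v : V) :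
    C.toSubmodule.mkQ (π p.val v) = quotientRep C (siegelLevi c n p) (C.toSubmodule.mkQ v) := by
  change C.toSubmodule.mkQ (π p.val v) = C.toSubmodule.mkQ (π (leviHom hcc (siegelLevi c n p)) v)
  rw [← sub_eq_zero, ← map_sub]
  exact (Submodule.Quotient.mk_eq_zero _).2 (hle (sub_leviHom_mem (π := π) hcc p v))

variable [Algebra.IsQuadraticExtension F E] [ValuativeRel F] [TopologicalSpace F]
  [IsNonarchimedeanLocalField F] [IsModuleTopology F E]

theorem isSmooth_quotientRep (hcc : ∀ x, c (c x) = x) (hπ : IsSmooth π)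
    (C : Subrepresentation (π.comp (leviHom hcc))) : IsSmooth (quotientRep C) := by
  intro x
  obtain ⟨v, rfl⟩ := C.toSubmodule.mkQ_surjective x
  obtain ⟨K, hK, hv⟩ := hπ v
  refine ⟨K.comap (leviHom hcc), hK.preimage (continuous_leviHom hcc), fun k hk => ?_⟩
  change C.toSubmodule.mkQ (π (leviHom hcc k) v) = _
  rw [hv _ hk]

/-- The Jacquet module of an irreducible representation has an irreducible quotient. -/
theorem exists_isCoatom_jacquetKernel_le (hc : c ≠ AlgEquiv.refl) (hπ : IsSmooth π)
    (hirr : π.IsIrreducible) (hne : jacquetKernel π (conj_conj hc) ≠ ⊤) :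
    ∃ C, jacquetKernel π (conj_conj hc) ≤ C ∧ IsCoatom C := by
  classical
  have hcc := conj_conj hc
  obtain ⟨v, hv⟩ : ∃ v : V, v ≠ 0 := by
    by_contra! h
    exact hne (SetLike.ext fun v => ⟨fun _ => Submodule.mem_top, fun _ => by
      rw [h v]
      exact zero_mem (jacquetKernel π (conj_conj hc)).toSubmodule⟩)
  obtain ⟨K, hK, hKv⟩ := hπ v
  obtain ⟨T, hT⟩ := exists_finite_cover hc hK
  -- Modulo the Jacquet kernel, P acts through its Levi quotient. Since G = P T K and K fixes v, the
  -- vectors π(t)v with t in T generate the Jacquet module over the Levi subgroup.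
  refine exists_isCoatom_ge hne (T.image fun t => π t v) fun C hBC hC => ?_
  have horb : ∀ g, π g v ∈ C.toSubmodule := by
    intro g
    obtain ⟨p, hp, t, ht, k, hk, rfl⟩ := hT g
    rw [map_mul, Module.End.mul_apply, hKv k hk, map_mul, Module.End.mul_apply]
    have h1 := hBC (sub_leviHom_mem (π := π) (conj_conj hc) ⟨p, hp⟩ (π t v))
    have h2 := C.apply_mem_toSubmodule (siegelLevi c n ⟨p, hp⟩)
      (hC _ (Finset.mem_image_of_mem _ ht))
    have h3 := C.toSubmodule.add_mem h1 h2
    change π p (π t v) - π (leviHom _ _) (π t v) + π (leviHom _ _) (π t v) ∈ C.toSubmodule at h3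
    rwa [sub_add_cancel] at h3
  let D : Subrepresentation π :=
    { toSubmodule := Submodule.span ℂ (Set.range fun g => π g v)
      apply_mem_toSubmodule := by
        intro g x hx
        induction hx using Submodule.span_induction with
        | zero => rw [map_zero]; exact zero_mem _
        | add x y _ _ hx hy => rw [map_add]; exact add_mem hx hy
        | smul t x _ hx => rw [map_smul]; exact Submodule.smul_mem _ _ hx
        | mem x hx =>
          obtain ⟨h, rfl⟩ := hx
          refine Submodule.subset_span ⟨g * h, ?_⟩
          change π (g * h) v = π g (π h v)
          rw [map_mul, Module.End.mul_apply] }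
  have hvD : v ∈ D := Submodule.subset_span ⟨1, by
    change π 1 v = v
    rw [map_one, Module.End.one_apply]⟩
  have hD : D = ⊤ := by
    refine (hirr.eq_bot_or_eq_top D).resolve_left fun h => hv ?_
    rw [h] at hvD
    exact hvD
  refine SetLike.ext fun x => ⟨fun _ => Submodule.mem_top, fun _ => ?_⟩
  have hx : x ∈ D := by rw [hD]; exact Submodule.mem_top
  refine Submodule.span_le.2 ?_ hx
  rintro _ ⟨g, rfl⟩
  exact horb g

end Jacquet

end UnitaryPeriod

end

theorem corollary2 {F E : Type*} [Field F] [ValuativeRel F] [TopologicalSpace F]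
    [IsNonarchimedeanLocalField F] [Field E] [Algebra F E] [Algebra.IsQuadraticExtension F E]
    [TopologicalSpace E] [IsTopologicalRing E] [IsModuleTopology F E]
    (c : E ≃ₐ[F] E) (hc : c ≠ AlgEquiv.refl) (n : ℕ) (hn : 0 < n)
    {V : Type u} [AddCommGroup V] [Module ℂ V]
    (π : Representation ℂ (UnitaryPeriod.U c n) V) (hπ : UnitaryPeriod.IsSmooth π)
    (hdist : UnitaryPeriod.IsDistinguished π (UnitaryPeriod.Sp c n)) :
    (π.IsIrreducible →
      ∃ (W : Type u) (_ : AddCommGroup W) (_ : Module ℂ W)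
        (σ : Representation ℂ (GL (Fin n) E) W),
        UnitaryPeriod.IsSmooth σ ∧ σ.IsIrreducible ∧
          UnitaryPeriod.IsSubquotient π (UnitaryPeriod.siegelInd c n σ)) ∧
      ¬ UnitaryPeriod.IsCuspidal c n π := by
  -- Stage n - 1 is the last: no index remains beyond it, and its invariance already covers the
  -- whole Siegel unipotent radical.
  obtain ⟨ℓ, hℓ⟩ := UnitaryPeriod.exists_isStage hc hπ hdist (n - 1) (Nat.sub_lt hn one_pos)
  have hinv : ∀ u, UnitaryPeriod.IsSiegelUnipotent u → ∀ v, ℓ (π u v) = ℓ v :=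
    fun u hu => hℓ.invariant hc hu
  refine ⟨fun hirr => ?_, UnitaryPeriod.not_isCuspidal_of_invariant hn hℓ.ne_zero hinv⟩
  have hcc := UnitaryPeriod.conj_conj hc
  obtain ⟨C, hle, hC⟩ := UnitaryPeriod.exists_isCoatom_jacquetKernel_le hc hπ hirr
    (UnitaryPeriod.jacquetKernel_ne_top hcc hℓ.ne_zero hinv)
  refine ⟨_, _, _, UnitaryPeriod.quotientRep C, UnitaryPeriod.isSmooth_quotientRep hcc hπ C,
    UnitaryPeriod.isIrreducible_quotientRep hC,
    UnitaryPeriod.isSubquotient_siegelInd hπ hirr (fun h => hC.1 ?_)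
      (UnitaryPeriod.mkQ_parabolic hcc hle)⟩
  refine SetLike.ext fun v => ⟨fun _ => Submodule.mem_top, fun _ => ?_⟩
  exact (Submodule.Quotient.mk_eq_zero _).1 (LinearMap.congr_fun h v)
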